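/- Let $G\rightrightarrows M$ be a Lie groupoid ($G$, $M$ finite-dimensional smooth Hausdorff manifolds) with source $\alpha$, target $\beta$ (both submersions), identity section $\epsilon$, inversion $i$ and product $gh$ defined for $\beta(g)=\alpha(h)$; write $l_g$, $r_g$ for the left and right translations. Let $\tau:AG\to M$, $A_xG=\ker T_{\epsilon(x)}\alpha$, be its Lie algebroid, with anchor $\rho=T\beta|_{AG}$, and for a section $X$ of $AG$ let $\overleftarrow{X}(g)=T l_g(X(\beta(g)))$ and $\overrightarrow{X}(g)=-T r_g(Ti(X(\alpha(g))))$. Let $V\alpha=\ker T\alpha$, $V\beta=\ker T\beta$, and let $\pi^\tau:\mathcal P^\tau G\cong V\beta\oplus_G V\alpha\to G$ be the Lie algebroid over $G$ with anchor $(X_g,Y_g)\mapsto X_g+Y_g$ whose bracket is transported from the Lie algebroid of the Lie groupoid $\{(g,h,s)\in G^3:\beta(g)=\beta(h),\ \alpha(h)=\alpha(s)\}\rightrightarrows G$ with source $g$, target $s$ and product $(g,h,s)(s,h',s')=(g,h's^{-1}h,s')$, by identifying $(X_g,Y_g)$ with $(0,X_g,X_g+Y_g)$; it is characterized by $[(\overrightarrow{X},\overleftarrow{Y}),(\overrightarrow{X'},\overleftarrow{Y'})]=(-\overrightarrow{[X,X']},\overleftarrow{[Y,Y']})$.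 Let $d$ be its differential. For a smooth function $L:G\to\mathbb R$ put $\Theta_L^+(g)(X_g,Y_g)=Y_g(L)$, $\Theta_L^-(g)(X_g,Y_g)=-X_g(L)$ and $\Omega_L=-d\Theta_L^+=-d\Theta_L^-$. Assume that $L$ is regular, that is, that $\Omega_L$ is symplectic (nondegenerate at every point; it is closed since it is exact). A section $\xi$ of $\mathcal P^\tau G$ is Hamiltonian if $i_\xi\Omega_L=df$ for some $f\in C^\infty(G)$; this $\xi=\xi_f$ exists and is unique for every $f$. Put $\{f,g\}_L=-\Omega_L(\xi_f,\xi_g)$ for $f,g\in C^\infty(G)$. On the dual bundle $\tau^*:A^*G\to M$ let $\Omega=-d\Theta$ be the canonical symplectic section of the prolongation $\mathcal P^{\tau^*}(AG)\to A^*G$, whose fibre at $\mu$ is $\{(v,X)\in A_{\tau^*(\mu)}G\times T_\mu(A^*G):\rho(v)=T\tau^*(X)\}$, where $\Theta(\mu)(v,X)=\mu(v)$ and $d$ is the differential of this Lie algebroid; every $\bar f\in C^\infty(A^*G)$ has a unique Hamiltonian section $\xi_{\bar f}$, $i_{\xi_{\bar f}}\Omega=d\bar f$, and the canonical linear Poisson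 bracket on $A^*G$ is $\{\bar f,\bar g\}=-\Omega(\xi_{\bar f},\xi_{\bar g})$. The Legendre transformations $\mathbb F^{\pm}L:G\to A^*G$ are $$(\mathbb F^-L)(h)(v)=-v(L\circ r_h\circ i)\ \ (v\in A_{\alpha(h)}G),\qquad (\mathbb F^+L)(g)(v)=v(L\circ l_g)\ \ (v\in A_{\beta(g)}G).$$ Then: 1. The Hamiltonian sections with respect to $\Omega_L$ form a Lie subalgebra of the Lie algebra of smooth sections of $\pi^\tau:\mathcal P^\tau G\to G$. 2. $G$ endowed with $\{\cdot,\cdot\}_L$ is a Poisson manifold: $\{\cdot,\cdot\}_L$ is a skew-symmetric $\mathbb R$-bilinear operation on $C^\infty(G)$, a derivation in each argument with respect to the usual product of functions, and satisfies the Jacobi identity. 3. Both Legendre transformations $\mathbb F^{+}L$ and $\mathbb F^{-}L$ are local Poisson isomorphisms: each is a local diffeomorphism, and $\{\bar f\circ\mathbb F^{\pm}L,\bar g\circ\mathbb F^{\pm}L\}_L=\{\bar f,\bar g\}\circ\mathbb F^{\pm}L$ for all $\bar f,\bar g\in C^\infty(A^*G)$. -/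

import Mathlib

open Set Bundle
open scoped Manifold ContDiff Bundle

noncomputable section

/-- A Lie groupoid `G ⇉ M`, for manifolds `G`, `M` modelled on `EG`, `EM`. Only the values of `mul`
on the set `{(g, h) | tgt g = src h}` of composable pairs carry information; smoothness of the
multiplication is smoothness on that subset of `G × G`. -/
structure LieGroupoid (EG EM : Type*) [NormedAddCommGroup EG] [NormedSpace ℝ EG]
    [NormedAddCommGroup EM] [NormedSpace ℝ EM] (G M : Type*) [TopologicalSpace G]
    [ChartedSpace EG G] [TopologicalSpace M] [ChartedSpace EM M] where
  src : G → M
  tgt : G → M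
  unit : M → G
  inv : G → G
  mul : G → G → G
  src_unit : ∀ x, src (unit x) = x
  tgt_unit : ∀ x, tgt (unit x) = x
  src_inv : ∀ g, src (inv g) = tgt g
  tgt_inv : ∀ g, tgt (inv g) = src g
  src_mul : ∀ g h, tgt g = src h → src (mul g h) = src g
  tgt_mul : ∀ g h, tgt g = src h → tgt (mul g h) = tgt h
  assoc : ∀ g h k, tgt g = src h → tgt h = src k → mul g (mul h k) = mul (mul g h) k
  unit_left : ∀ g, mul (unit (src g)) g = g
  unit_right : ∀ g, mul g (unit (tgt g)) = g
  inv_left : ∀ g, mul (inv g) g = unit (tgt g)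
  inv_right : ∀ g, mul g (inv g) = unit (src g)
  contMDiff_src : ContMDiff 𝓘(ℝ, EG) 𝓘(ℝ, EM) ∞ src
  contMDiff_tgt : ContMDiff 𝓘(ℝ, EG) 𝓘(ℝ, EM) ∞ tgt
  contMDiff_unit : ContMDiff 𝓘(ℝ, EM) 𝓘(ℝ, EG) ∞ unit
  contMDiff_inv : ContMDiff 𝓘(ℝ, EG) 𝓘(ℝ, EG) ∞ inv
  contMDiffOn_mul : ContMDiffOn (𝓘(ℝ, EG).prod 𝓘(ℝ, EG)) 𝓘(ℝ, EG) ∞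
    (fun p : G × G => mul p.1 p.2) {p | tgt p.1 = src p.2}
  surjective_mfderiv_src : ∀ g, Function.Surjective (mfderiv 𝓘(ℝ, EG) 𝓘(ℝ, EM) src g)
  surjective_mfderiv_tgt : ∀ g, Function.Surjective (mfderiv 𝓘(ℝ, EG) 𝓘(ℝ, EM) tgt g)

namespace LieGroupoid

variable {EG EM G M : Type*} [NormedAddCommGroup EG] [NormedSpace ℝ EG]
  [NormedAddCommGroup EM] [NormedSpace ℝ EM] [TopologicalSpace G] [ChartedSpace EG G]
  [TopologicalSpace M] [ChartedSpace EM M]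

section Algebroid

/-- The fibre `A_x G = ker (T_{ε(x)} α)` of the Lie algebroid `AG → M`. -/
def Alg (𝒢 : LieGroupoid EG EM G M) (x : M) : Type _ :=
  (mfderiv 𝓘(ℝ, EG) 𝓘(ℝ, EM) 𝒢.src (𝒢.unit x)).ker

variable (𝒢 : LieGroupoid EG EM G M)

instance (x : M) : AddCommGroup (𝒢.Alg x) :=
  inferInstanceAs (AddCommGroup (mfderiv 𝓘(ℝ, EG) 𝓘(ℝ, EM) 𝒢.src (𝒢.unit x)).ker)
instance (x : M) : Module ℝ (𝒢.Alg x) :=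
  inferInstanceAs (Module ℝ (mfderiv 𝓘(ℝ, EG) 𝓘(ℝ, EM) 𝒢.src (𝒢.unit x)).ker)
instance (x : M) : TopologicalSpace (𝒢.Alg x) :=
  inferInstanceAs (TopologicalSpace (mfderiv 𝓘(ℝ, EG) 𝓘(ℝ, EM) 𝒢.src (𝒢.unit x)).ker)
instance (x : M) : IsTopologicalAddGroup (𝒢.Alg x) :=
  inferInstanceAs (IsTopologicalAddGroup (mfderiv 𝓘(ℝ, EG) 𝓘(ℝ, EM) 𝒢.src (𝒢.unit x)).ker)
instance (x : M) : ContinuousSMul ℝ (𝒢.Alg x) :=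
  inferInstanceAs (ContinuousSMul ℝ (mfderiv 𝓘(ℝ, EG) 𝓘(ℝ, EM) 𝒢.src (𝒢.unit x)).ker)

/-- The inclusion `A_x G ⊆ T_{ε(x)} G`. -/
def algIncl (x : M) : 𝒢.Alg x →L[ℝ] TangentSpace 𝓘(ℝ, EG) (𝒢.unit x) :=
  (mfderiv 𝓘(ℝ, EG) 𝓘(ℝ, EM) 𝒢.src (𝒢.unit x)).ker.subtypeL

/-- An element of `A_x G` from a tangent vector at `ε(x)` in the kernel of `T_{ε(x)} α`. -/
def algMk (x : M) (v : TangentSpace 𝓘(ℝ, EG) (𝒢.unit x))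
    (hv : mfderiv 𝓘(ℝ, EG) 𝓘(ℝ, EM) 𝒢.src (𝒢.unit x) v = 0) : 𝒢.Alg x := ⟨v, hv⟩

lemma mfderiv_src_algIncl (x : M) (v : 𝒢.Alg x) :
    mfderiv 𝓘(ℝ, EG) 𝓘(ℝ, EM) 𝒢.src (𝒢.unit x) (𝒢.algIncl x v) = 0 := v.2

lemma algIncl_algMk (x : M) (v : TangentSpace 𝓘(ℝ, EG) (𝒢.unit x)) (hv) :
    𝒢.algIncl x (𝒢.algMk x v hv) = v := rfl

lemma algIncl_injective (x : M) : Function.Injective (𝒢.algIncl x) := Subtype.val_injective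

lemma isInducing_algIncl (x : M) : Topology.IsInducing (𝒢.algIncl x) :=
  Topology.IsInducing.subtypeVal

end Algebroid

/-- The model fibre of `AG`; its dimension is `dim G - dim M`. -/
abbrev AlgModel (EG EM : Type*) [NormedAddCommGroup EG] [NormedSpace ℝ EG]
    [NormedAddCommGroup EM] [NormedSpace ℝ EM] : Type :=
  EuclideanSpace ℝ (Fin (Module.finrank ℝ EG - Module.finrank ℝ EM))

section Bundle

set_option linter.unusedSectionVars false

variable [FiniteDimensional ℝ EG] [FiniteDimensional ℝ EM]

lemma exists_complement (B : EG →L[ℝ] EM) (hB : Function.Surjective B) :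
    ∃ p : EG →L[ℝ] AlgModel EG EM, (p.prod B).IsInvertible := by
  have hd : Module.finrank ℝ B.ker = Module.finrank ℝ (AlgModel EG EM) := by
    have h := LinearMap.finrank_range_add_finrank_ker (B : EG →ₗ[ℝ] EM)
    rw [LinearMap.range_eq_top.2 hB, finrank_top] at h
    rw [finrank_euclideanSpace_fin]
    omega
  let e : B.ker ≃ₗ[ℝ] AlgModel EG EM := LinearEquiv.ofFinrankEq _ _ hd
  obtain ⟨q, hq⟩ := Submodule.exists_isCompl (B : EG →ₗ[ℝ] EM).ker
  let p0 : EG →ₗ[ℝ] AlgModel EG EM := e.toLinearMap ∘ₗ Submodule.projectionOnto _ q hq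
  refine ⟨p0.toContinuousLinearMap, ?_⟩
  have hinj : Function.Injective (p0.toContinuousLinearMap.prod B) := by
    rw [injective_iff_map_eq_zero]
    intro v hv
    have h1 : e (Submodule.projectionOnto _ q hq v) = 0 := congrArg Prod.fst hv
    have h2 : B v = 0 := congrArg Prod.snd hv
    have h3 : Submodule.projectionOnto _ q hq v = 0 := e.map_eq_zero_iff.1 h1
    have h4 := Submodule.projectionOnto_apply_left hq (⟨v, h2⟩ : (B : EG →ₗ[ℝ] EM).ker)
    rw [show Submodule.projectionOnto _ q hq v = ⟨v, h2⟩ from h4] at h3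
    exact congrArg Subtype.val h3
  have hle : Module.finrank ℝ EM ≤ Module.finrank ℝ EG := by
    have h := LinearMap.finrank_range_add_finrank_ker (B : EG →ₗ[ℝ] EM)
    rw [LinearMap.range_eq_top.2 hB, finrank_top] at h
    omega
  let E := LinearEquiv.ofInjectiveOfFinrankEq
    (p0.toContinuousLinearMap.prod B : EG →ₗ[ℝ] AlgModel EG EM × EM) hinj (by
      rw [Module.finrank_prod, finrank_euclideanSpace_fin]; omega)
  refine ⟨E.toContinuousLinearEquiv, ?_⟩
  ext v <;> rfl

variable [IsManifold 𝓘(ℝ, EG) ∞ G] [IsManifold 𝓘(ℝ, EM) ∞ M] (𝒢 : LieGroupoid EG EM G M)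

/-- The tangent trivializations of `G` near `ε(x₀)` and of `M` near `x₀`. -/
abbrev trivG (x₀ : M) : Trivialization EG (π EG (TangentSpace 𝓘(ℝ, EG) : G → Type _)) :=
  trivializationAt EG (TangentSpace 𝓘(ℝ, EG)) (𝒢.unit x₀)

abbrev trivM (_ : LieGroupoid EG EM G M) (x₀ : M) :
    Trivialization EM (π EM (TangentSpace 𝓘(ℝ, EM) : M → Type _)) :=
  trivializationAt EM (TangentSpace 𝓘(ℝ, EM)) x₀

/-- The differential `T_{ε(x)} α` read in the trivializations near `x₀`. -/
def dsrc (x₀ x : M) : EG →L[ℝ] EM :=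
  ((𝒢.trivM x₀).continuousLinearMapAt ℝ (𝒢.src (𝒢.unit x))) ∘L
    (mfderiv 𝓘(ℝ, EG) 𝓘(ℝ, EM) 𝒢.src (𝒢.unit x)) ∘L ((𝒢.trivG x₀).symmL ℝ (𝒢.unit x))

def dom (x₀ : M) : Set M := (𝒢.trivM x₀).baseSet ∩ 𝒢.unit ⁻¹' (𝒢.trivG x₀).baseSet

lemma isOpen_dom (x₀ : M) : IsOpen (𝒢.dom x₀) :=
  (𝒢.trivM x₀).open_baseSet.inter
    ((𝒢.trivG x₀).open_baseSet.preimage 𝒢.contMDiff_unit.continuous)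

lemma mem_dom (x₀ : M) : x₀ ∈ 𝒢.dom x₀ :=
  ⟨mem_baseSet_trivializationAt _ _ _,
    mem_baseSet_trivializationAt EG (TangentSpace 𝓘(ℝ, EG)) (𝒢.unit x₀)⟩

lemma contMDiffOn_clm {s : Set M} {B : M → EG →L[ℝ] EM}
    (h : ∀ w, ContMDiffOn 𝓘(ℝ, EM) 𝓘(ℝ, EM) ∞ (fun x => B x w) s) :
    ContMDiffOn 𝓘(ℝ, EM) 𝓘(ℝ, EG →L[ℝ] EM) ∞ B s := by
  let b := Module.finBasis ℝ EG
  have key : B = fun x => ∑ i, (ContinuousLinearMap.smulRightL ℝ EG EM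
      ((b.coord i).toContinuousLinearMap)) (B x (b i)) := by
    funext x
    ext w
    rw [sum_apply]
    conv_lhs => rw [← b.sum_repr w, map_sum]
    refine Finset.sum_congr rfl fun i _ => ?_
    simp
  rw [key]
  intro x hx
  have : ∀ i, ContMDiffWithinAt 𝓘(ℝ, EM) 𝓘(ℝ, EG →L[ℝ] EM) ∞ (fun x =>
      (ContinuousLinearMap.smulRightL ℝ EG EM
      ((b.coord i).toContinuousLinearMap)) (B x (b i))) s x := fun i =>
    (ContinuousLinearMap.contMDiff _).contMDiffAt.comp_contMDiffWithinAt x (h (b i) x hx)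
  exact ContMDiffWithinAt.sum fun i _ => this i

lemma contMDiffOn_dsrc (x₀ : M) :
    ContMDiffOn 𝓘(ℝ, EM) 𝓘(ℝ, EG →L[ℝ] EM) ∞ (𝒢.dsrc x₀) (𝒢.dom x₀) := by
  refine contMDiffOn_clm fun w => ?_
  have h1 : ContMDiffOn 𝓘(ℝ, EM) (𝓘(ℝ, EG).prod 𝓘(ℝ, EG)) ∞
      (fun x => (𝒢.unit x, w)) (𝒢.dom x₀) :=
    (𝒢.contMDiff_unit.prodMk contMDiff_const).contMDiffOn
  have h2 := ((𝒢.trivG x₀).contMDiffOn_symm (IB := 𝓘(ℝ, EG)) (n := ∞)).comp h1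
    (fun x hx => by
      rw [Set.mem_preimage, Trivialization.mem_target]
      exact hx.2)
  have e2 : EqOn (fun x => (⟨𝒢.unit x, (𝒢.trivG x₀).symmL ℝ (𝒢.unit x) w⟩ :
      TangentBundle 𝓘(ℝ, EG) G))
      ((𝒢.trivG x₀).toOpenPartialHomeomorph.symm ∘ fun x => (𝒢.unit x, w)) (𝒢.dom x₀) := by
    intro x hx
    have := (𝒢.trivG x₀).mk_symm hx.2 w
    refine Eq.trans ?_ this
    exact congrArg (TotalSpace.mk _) (Trivialization.symmL_apply (R := ℝ) (𝒢.trivG x₀) hx.2 w)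
  have h3 := (𝒢.contMDiff_src.contMDiff_tangentMap (m := ∞) (by simp)).comp_contMDiffOn (h2.congr e2)
  have h4 := ((𝒢.trivM x₀).contMDiffOn (IB := 𝓘(ℝ, EM)) (n := ∞)).comp h3 (fun x hx => by
      rw [Set.mem_preimage, Trivialization.mem_source]
      change 𝒢.src (𝒢.unit x) ∈ _
      rw [𝒢.src_unit]
      exact hx.1)
  have h5 := contMDiff_snd.comp_contMDiffOn h4
  refine h5.congr fun x hx => ?_
  have hx' : 𝒢.src (𝒢.unit x) ∈ (𝒢.trivM x₀).baseSet := by rw [𝒢.src_unit]; exact hx.1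
  change (𝒢.trivM x₀).continuousLinearMapAt ℝ _ _ = _
  rw [Trivialization.continuousLinearMapAt_apply_of_mem (R := ℝ) (hb := hx')]
  rfl

lemma surjective_dsrc (x₀ : M) : Function.Surjective (𝒢.dsrc x₀ x₀) := by
  have hx := 𝒢.mem_dom x₀
  have hx' : 𝒢.src (𝒢.unit x₀) ∈ (𝒢.trivM x₀).baseSet := by rw [𝒢.src_unit]; exact hx.1
  intro w
  obtain ⟨u, hu⟩ := 𝒢.surjective_mfderiv_src (𝒢.unit x₀) ((𝒢.trivM x₀).symmL ℝ _ w)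
  refine ⟨(𝒢.trivG x₀).continuousLinearMapAt ℝ _ u, ?_⟩
  change (𝒢.trivM x₀).continuousLinearMapAt ℝ _ (mfderiv _ _ _ _ ((𝒢.trivG x₀).symmL ℝ _ _)) = w
  rw [Trivialization.symmL_continuousLinearMapAt _ hx.2, hu,
    Trivialization.continuousLinearMapAt_symmL _ hx']

/-- A linear map `EG → F` completing the differential of `α` at `ε(x₀)` to an isomorphism. -/
def compl (x₀ : M) : EG →L[ℝ] AlgModel EG EM :=
  Classical.choose (exists_complement (𝒢.dsrc x₀ x₀) (𝒢.surjective_dsrc x₀))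

def frame (x₀ x : M) : EG →L[ℝ] AlgModel EG EM × EM := (𝒢.compl x₀).prod (𝒢.dsrc x₀ x)

lemma isInvertible_frame (x₀ : M) : (𝒢.frame x₀ x₀).IsInvertible :=
  Classical.choose_spec (exists_complement (𝒢.dsrc x₀ x₀) (𝒢.surjective_dsrc x₀))

lemma contMDiffOn_frame (x₀ : M) :
    ContMDiffOn 𝓘(ℝ, EM) 𝓘(ℝ, EG →L[ℝ] AlgModel EG EM × EM) ∞ (𝒢.frame x₀) (𝒢.dom x₀) := by
  have e : 𝒢.frame x₀ = fun x => (ContinuousLinearMap.inl ℝ (AlgModel EG EM) EM) ∘L 𝒢.compl x₀ +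
      (ContinuousLinearMap.inr ℝ (AlgModel EG EM) EM) ∘L 𝒢.dsrc x₀ x := by
    funext x; ext v <;> simp [frame]
  rw [e]
  exact contMDiffOn_const.add (contMDiffOn_const.clm_comp (𝒢.contMDiffOn_dsrc x₀))

/-- The open set on which the trivialization of `AG` near `x₀` is defined. -/
def algBase (x₀ : M) : Set M := 𝒢.dom x₀ ∩ 𝒢.frame x₀ ⁻¹' {T | T.IsInvertible}

lemma isOpen_algBase (x₀ : M) : IsOpen (𝒢.algBase x₀) :=
  (𝒢.contMDiffOn_frame x₀).continuousOn.isOpen_inter_preimage (𝒢.isOpen_dom x₀)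
    ContinuousLinearEquiv.isOpen

lemma mem_algBase (x₀ : M) : x₀ ∈ 𝒢.algBase x₀ := ⟨𝒢.mem_dom x₀, 𝒢.isInvertible_frame x₀⟩

/-- `A_x G → F`. -/
def algCoord (x₀ x : M) : 𝒢.Alg x →L[ℝ] AlgModel EG EM :=
  𝒢.compl x₀ ∘L (𝒢.trivG x₀).continuousLinearMapAt ℝ (𝒢.unit x) ∘L 𝒢.algIncl x

/-- `F → T_{ε(x)} G`, inverse to `algCoord` over `algBase`. -/
def algSymm₀ (x₀ x : M) : AlgModel EG EM →L[ℝ] TangentSpace 𝓘(ℝ, EG) (𝒢.unit x) :=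
  (𝒢.trivG x₀).symmL ℝ (𝒢.unit x) ∘L (𝒢.frame x₀ x).inverse ∘L
    ContinuousLinearMap.inl ℝ (AlgModel EG EM) EM

lemma mfderiv_src_algSymm₀ {x₀ x : M} (hx : x ∈ 𝒢.algBase x₀) (w : AlgModel EG EM) :
    mfderiv 𝓘(ℝ, EG) 𝓘(ℝ, EM) 𝒢.src (𝒢.unit x) (𝒢.algSymm₀ x₀ x w) = 0 := by
  have hx' : 𝒢.src (𝒢.unit x) ∈ (𝒢.trivM x₀).baseSet := by rw [𝒢.src_unit]; exact hx.1.1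
  have h : 𝒢.frame x₀ x ((𝒢.frame x₀ x).inverse (w, 0)) = (w, 0) :=
    hx.2.self_apply_inverse _
  have h2 : (𝒢.trivM x₀).continuousLinearMapAt ℝ _
      (mfderiv 𝓘(ℝ, EG) 𝓘(ℝ, EM) 𝒢.src (𝒢.unit x) (𝒢.algSymm₀ x₀ x w)) = 0 :=
    congrArg Prod.snd h
  rw [← Trivialization.symmL_continuousLinearMapAt (R := ℝ) (𝒢.trivM x₀) hx'
    (mfderiv 𝓘(ℝ, EG) 𝓘(ℝ, EM) 𝒢.src (𝒢.unit x) (𝒢.algSymm₀ x₀ x w)), h2, map_zero]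

open Classical in
def algSymm (x₀ x : M) (w : AlgModel EG EM) : 𝒢.Alg x :=
  if hx : x ∈ 𝒢.algBase x₀ then 𝒢.algMk x (𝒢.algSymm₀ x₀ x w) (𝒢.mfderiv_src_algSymm₀ hx w) else 0

lemma algIncl_algSymm {x₀ x : M} (hx : x ∈ 𝒢.algBase x₀) (w : AlgModel EG EM) :
    𝒢.algIncl x (𝒢.algSymm x₀ x w) = 𝒢.algSymm₀ x₀ x w := by
  rw [algSymm, dif_pos hx, algIncl_algMk]

lemma algCoord_algSymm {x₀ x : M} (hx : x ∈ 𝒢.algBase x₀) (w : AlgModel EG EM) :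
    𝒢.algCoord x₀ x (𝒢.algSymm x₀ x w) = w := by
  have h : 𝒢.frame x₀ x ((𝒢.frame x₀ x).inverse (w, 0)) = (w, 0) :=
    hx.2.self_apply_inverse _
  change 𝒢.compl x₀ ((𝒢.trivG x₀).continuousLinearMapAt ℝ _ (𝒢.algIncl x _)) = w
  rw [𝒢.algIncl_algSymm hx]
  change 𝒢.compl x₀ ((𝒢.trivG x₀).continuousLinearMapAt ℝ _ ((𝒢.trivG x₀).symmL ℝ _ _)) = w
  rw [Trivialization.continuousLinearMapAt_symmL _ hx.1.2]
  exact congrArg Prod.fst h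

lemma algSymm_algCoord {x₀ x : M} (hx : x ∈ 𝒢.algBase x₀) (v : 𝒢.Alg x) :
    𝒢.algSymm x₀ x (𝒢.algCoord x₀ x v) = v := by
  apply 𝒢.algIncl_injective
  rw [𝒢.algIncl_algSymm hx]
  set u := (𝒢.trivG x₀).continuousLinearMapAt ℝ (𝒢.unit x) (𝒢.algIncl x v) with hu
  have h1 : 𝒢.frame x₀ x u = (𝒢.algCoord x₀ x v, 0) := by
    refine Prod.ext rfl ?_
    change (𝒢.trivM x₀).continuousLinearMapAt ℝ _ (mfderiv _ _ _ _
      ((𝒢.trivG x₀).symmL ℝ _ u)) = 0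
    rw [hu, Trivialization.symmL_continuousLinearMapAt _ hx.1.2, mfderiv_src_algIncl, map_zero]
  change (𝒢.trivG x₀).symmL ℝ _ ((𝒢.frame x₀ x).inverse (𝒢.algCoord x₀ x v, 0)) = _
  rw [← h1, hx.2.inverse_apply_self, hu, Trivialization.symmL_continuousLinearMapAt _ hx.1.2]

/-- The trivialization of `AG` near `x₀`. -/
def algPretriv (x₀ : M) :
    Pretrivialization (AlgModel EG EM) (π (AlgModel EG EM) 𝒢.Alg) where
  toFun p := (p.1, 𝒢.algCoord x₀ p.1 p.2)
  invFun q := ⟨q.1, 𝒢.algSymm x₀ q.1 q.2⟩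
  source := TotalSpace.proj ⁻¹' 𝒢.algBase x₀
  target := 𝒢.algBase x₀ ×ˢ univ
  map_source' p hp := ⟨hp, trivial⟩
  map_target' q hq := hq.1
  left_inv' p hp := by
    obtain ⟨x, v⟩ := p
    exact congrArg (TotalSpace.mk x) (𝒢.algSymm_algCoord hp v)
  right_inv' q hq := by
    obtain ⟨x, w⟩ := q
    exact congrArg (Prod.mk x) (𝒢.algCoord_algSymm hq.1 w)
  open_target := (𝒢.isOpen_algBase x₀).prod isOpen_univ
  baseSet := 𝒢.algBase x₀
  open_baseSet := 𝒢.isOpen_algBase x₀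
  source_eq := rfl
  target_eq := rfl
  proj_toFun _ _ := rfl

lemma algPretriv_symm {x₀ x : M} (hx : x ∈ 𝒢.algBase x₀) (w : AlgModel EG EM) :
    (𝒢.algPretriv x₀).symm x w = 𝒢.algSymm x₀ x w := by
  rw [Pretrivialization.symm_apply _ hx]
  rfl

lemma exists_algCoordChange (x₀ x₁ : M) : ∃ f : M → AlgModel EG EM →L[ℝ] AlgModel EG EM,
    ContMDiffOn 𝓘(ℝ, EM) 𝓘(ℝ, AlgModel EG EM →L[ℝ] AlgModel EG EM) ∞ f
      (𝒢.algBase x₀ ∩ 𝒢.algBase x₁) ∧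
    ∀ x ∈ 𝒢.algBase x₀ ∩ 𝒢.algBase x₁, ∀ w,
      f x w = (𝒢.algPretriv x₁ ⟨x, (𝒢.algPretriv x₀).symm x w⟩).2 := by
  refine ⟨fun x => 𝒢.compl x₁ ∘L
    ((𝒢.trivG x₀).coordChangeL ℝ (𝒢.trivG x₁) (𝒢.unit x) : EG →L[ℝ] EG) ∘L
    (𝒢.frame x₀ x).inverse ∘L ContinuousLinearMap.inl ℝ (AlgModel EG EM) EM, ?_, ?_⟩
  · refine contMDiffOn_const.clm_comp (ContMDiffOn.clm_comp ?_
      (ContMDiffOn.clm_comp ?_ contMDiffOn_const))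
    · exact (contMDiffOn_coordChangeL (IB := 𝓘(ℝ, EG)) (n := ∞) (𝒢.trivG x₀) (𝒢.trivG x₁)).comp
        𝒢.contMDiff_unit.contMDiffOn (fun x hx => ⟨hx.1.1.2, hx.2.1.2⟩)
    · intro x hx
      have h1 : ContMDiffAt 𝓘(ℝ, EG →L[ℝ] AlgModel EG EM × EM)
          𝓘(ℝ, AlgModel EG EM × EM →L[ℝ] EG) ∞ ContinuousLinearMap.inverse (𝒢.frame x₀ x) :=
        (ContinuousLinearMap.IsInvertible.contDiffAt_map_inverse hx.1.2).contMDiffAt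
      exact h1.comp_contMDiffWithinAt x
        ((𝒢.contMDiffOn_frame x₀ x hx.1.1).mono fun y hy => hy.1.1)
  · intro x hx w
    rw [𝒢.algPretriv_symm hx.1]
    change _ = 𝒢.compl x₁ ((𝒢.trivG x₁).continuousLinearMapAt ℝ _ (𝒢.algIncl x _))
    rw [𝒢.algIncl_algSymm hx.1]
    change 𝒢.compl x₁ ((𝒢.trivG x₀).coordChangeL ℝ (𝒢.trivG x₁) (𝒢.unit x) _) = 
      𝒢.compl x₁ ((𝒢.trivG x₁).continuousLinearMapAt ℝ _ ((𝒢.trivG x₀).symmL ℝ _ _))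
    rw [Trivialization.coordChangeL_apply _ _ ⟨hx.1.1.2, hx.2.1.2⟩,
      Trivialization.continuousLinearMapAt_apply_of_mem (R := ℝ) (hb := hx.2.1.2),
      Trivialization.symmL_apply (R := ℝ) (𝒢.trivG x₀) hx.1.1.2]

lemma isInducing_algCoord {x₀ x : M} (hx : x ∈ 𝒢.algBase x₀) :
    Topology.IsInducing (𝒢.algCoord x₀ x) := by
  have h : Continuous (𝒢.algSymm x₀ x) := by
    rw [(𝒢.isInducing_algIncl x).continuous_iff]
    exact (𝒢.algSymm₀ x₀ x).continuous.congr fun w => (𝒢.algIncl_algSymm hx w).symm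
  exact Topology.IsInducing.of_comp (𝒢.algCoord x₀ x).continuous h (by
    rw [show 𝒢.algSymm x₀ x ∘ 𝒢.algCoord x₀ x = id from
      funext fun v => 𝒢.algSymm_algCoord hx v]
    exact Topology.IsInducing.id)

def algPrebundle : VectorPrebundle ℝ (AlgModel EG EM) 𝒢.Alg where
  pretrivializationAtlas := range 𝒢.algPretriv
  pretrivialization_linear' := by
    rintro _ ⟨x₀, rfl⟩
    exact ⟨fun x _ => (𝒢.algCoord x₀ x).toLinearMap.isLinear⟩
  pretrivializationAt := 𝒢.algPretriv
  mem_base_pretrivializationAt := 𝒢.mem_algBase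
  pretrivialization_mem_atlas x := ⟨x, rfl⟩
  exists_coordChange := by
    rintro _ ⟨x₀, rfl⟩ _ ⟨x₁, rfl⟩
    obtain ⟨f, hf, h⟩ := 𝒢.exists_algCoordChange x₀ x₁
    exact ⟨f, hf.continuousOn, h⟩
  totalSpaceMk_isInducing x :=
    (Topology.isInducing_const_prod (x := x)).2 (𝒢.isInducing_algCoord (𝒢.mem_algBase x))

instance : 𝒢.algPrebundle.IsContMDiff 𝓘(ℝ, EM) ∞ where
  exists_contMDiffCoordChange := by
    rintro _ ⟨x₀, rfl⟩ _ ⟨x₁, rfl⟩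
    exact 𝒢.exists_algCoordChange x₀ x₁

instance : TopologicalSpace (TotalSpace (AlgModel EG EM) 𝒢.Alg) := 𝒢.algPrebundle.totalSpaceTopology
instance : FiberBundle (AlgModel EG EM) 𝒢.Alg := 𝒢.algPrebundle.toFiberBundle
instance : VectorBundle ℝ (AlgModel EG EM) 𝒢.Alg := 𝒢.algPrebundle.toVectorBundle
instance : ContMDiffVectorBundle ∞ (AlgModel EG EM) 𝒢.Alg 𝓘(ℝ, EM) :=
  𝒢.algPrebundle.contMDiffVectorBundle 𝓘(ℝ, EM)

end Bundle

end LieGroupoid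

/-! ### Bundles with an anchor and a bracket of sections -/

section Calculus

variable {E H N : Type*} [NormedAddCommGroup E] [NormedSpace ℝ E] [TopologicalSpace H]
  [TopologicalSpace N] [ChartedSpace H N]

/-- A family of real vector spaces over a manifold `N`, with a notion of smooth section, an anchor
and a bracket of sections. It is only a container in which the two concrete Lie algebroids
`LieGroupoid.pTau` and `LieGroupoid.pTauStar` below are recorded, so that the exterior differential
and Hamiltonian sections need to be written only once. -/
structure BundleBracket (I : ModelWithCorners ℝ E H) (N : Type*) [TopologicalSpace N]
    [ChartedSpace H N] (V : N → Type*) [∀ x, AddCommGroup (V x)] [∀ x, Module ℝ (V x)] where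
  IsSection : (∀ x, V x) → Prop
  anchor : ∀ x, V x →ₗ[ℝ] TangentSpace I x
  bracket : (∀ x, V x) → (∀ x, V x) → ∀ x, V x

/-- Real smooth functions on `N`. -/
def IsSmoothFun (I : ModelWithCorners ℝ E H) (f : N → ℝ) : Prop := ContMDiff I 𝓘(ℝ, ℝ) ∞ f

namespace BundleBracket

variable {I : ModelWithCorners ℝ E H} {V : N → Type*} [∀ x, AddCommGroup (V x)]
  [∀ x, Module ℝ (V x)] (A : BundleBracket I N V)

/-- The function `df(σ) = ρ(σ) f`. -/
def deriv (f : N → ℝ) (σ : ∀ x, V x) (x : N) : ℝ :=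
  mfderiv I 𝓘(ℝ, ℝ) f x (A.anchor x (σ x))

/-- The differential of a `1`-section `θ`:
`dθ(σ, σ') = ρ(σ)(θ(σ')) - ρ(σ')(θ(σ)) - θ([σ, σ'])`. -/
def extDeriv (θ : ∀ x, V x →ₗ[ℝ] ℝ) (σ σ' : ∀ x, V x) (x : N) : ℝ :=
  A.deriv (fun y => θ y (σ' y)) σ x - A.deriv (fun y => θ y (σ y)) σ' x - θ x (A.bracket σ σ' x)

/-- The sections form a Lie algebra over `ℝ` under the bracket. -/
structure IsLieAlgebra : Prop where
  zero : A.IsSection 0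
  add : ∀ σ σ', A.IsSection σ → A.IsSection σ' → A.IsSection (σ + σ')
  smul : ∀ (c : ℝ) σ, A.IsSection σ → A.IsSection (c • σ)
  bracket : ∀ σ σ', A.IsSection σ → A.IsSection σ' → A.IsSection (A.bracket σ σ')
  bracket_add : ∀ σ σ' σ'', A.IsSection σ → A.IsSection σ' → A.IsSection σ'' →
    A.bracket σ (σ' + σ'') = A.bracket σ σ' + A.bracket σ σ''
  bracket_smul : ∀ (c : ℝ) σ σ', A.IsSection σ → A.IsSection σ' →
    A.bracket σ (c • σ') = c • A.bracket σ σ'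
  bracket_skew : ∀ σ σ', A.IsSection σ → A.IsSection σ' → A.bracket σ σ' = -A.bracket σ' σ
  jacobi : ∀ σ σ' σ'', A.IsSection σ → A.IsSection σ' → A.IsSection σ'' →
    A.bracket σ (A.bracket σ' σ'') + A.bracket σ' (A.bracket σ'' σ)
      + A.bracket σ'' (A.bracket σ σ') = 0

/-- `S` is a Lie subalgebra of the Lie algebra of sections: a linear subspace of the space of
sections that is closed under the bracket. -/
structure IsLieSubalgebra (S : Set (∀ x, V x)) : Prop where
  isSection : ∀ σ ∈ S, A.IsSection σ
  zero : 0 ∈ S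
  add : ∀ σ ∈ S, ∀ σ' ∈ S, σ + σ' ∈ S
  smul : ∀ (c : ℝ), ∀ σ ∈ S, c • σ ∈ S
  bracket : ∀ σ ∈ S, ∀ σ' ∈ S, A.bracket σ σ' ∈ S

variable (Ω : (∀ x, V x) → (∀ x, V x) → N → ℝ)

/-- A `2`-section `Ω`, given by its values on pairs of sections, is nondegenerate at every point.
(Every vector is the value of a section.) -/
def Nondegenerate : Prop :=
  ∀ σ, A.IsSection σ → ∀ x, (∀ σ', A.IsSection σ' → Ω σ σ' x = 0) → σ x = 0

/-- `ξ` is a Hamiltonian section associated with `f` with respect to `Ω`: `i_ξ Ω = df`. -/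
def IsHamiltonian (f : N → ℝ) (ξ : ∀ x, V x) : Prop :=
  A.IsSection ξ ∧ ∀ σ, A.IsSection σ → Ω ξ σ = A.deriv f σ

/-- The Hamiltonian section `ξ_f`. -/
def ham (f : N → ℝ) : ∀ x, V x := Classical.epsilon (A.IsHamiltonian Ω f)

/-- The bracket of functions `{f, g} = -Ω(ξ_f, ξ_g)`. -/
def poisson (f g : N → ℝ) : N → ℝ := -Ω (A.ham Ω f) (A.ham Ω g)

end BundleBracket

/-- A bracket of functions makes `N` a Poisson manifold: it is a skew-symmetric bilinear operation
on smooth functions, a derivation in each argument, and satisfies the Jacobi identity. -/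
structure IsPoissonBracket (I : ModelWithCorners ℝ E H) (br : (N → ℝ) → (N → ℝ) → N → ℝ) :
    Prop where
  smooth : ∀ f g, IsSmoothFun I f → IsSmoothFun I g → IsSmoothFun I (br f g)
  skew : ∀ f g, IsSmoothFun I f → IsSmoothFun I g → br f g = -br g f
  add_left : ∀ f g h, IsSmoothFun I f → IsSmoothFun I g → IsSmoothFun I h →
    br (f + g) h = br f h + br g h
  add_right : ∀ f g h, IsSmoothFun I f → IsSmoothFun I g → IsSmoothFun I h →
    br f (g + h) = br f g + br f h
  smul_left : ∀ (c : ℝ) f g, IsSmoothFun I f → IsSmoothFun I g → br (c • f) g = c • br f g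
  smul_right : ∀ (c : ℝ) f g, IsSmoothFun I f → IsSmoothFun I g → br f (c • g) = c • br f g
  leibniz_left : ∀ f g h, IsSmoothFun I f → IsSmoothFun I g → IsSmoothFun I h →
    br (f * g) h = f * br g h + g * br f h
  leibniz_right : ∀ f g h, IsSmoothFun I f → IsSmoothFun I g → IsSmoothFun I h →
    br f (g * h) = g * br f h + h * br f g
  jacobi : ∀ f g h, IsSmoothFun I f → IsSmoothFun I g → IsSmoothFun I h →
    br f (br g h) + br g (br h f) + br h (br f g) = 0

end Calculus

namespace LieGroupoid

variable {EG EM G M : Type*} [NormedAddCommGroup EG] [NormedSpace ℝ EG]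
  [NormedAddCommGroup EM] [NormedSpace ℝ EM] [TopologicalSpace G] [ChartedSpace EG G]
  [TopologicalSpace M] [ChartedSpace EM M] (𝒢 : LieGroupoid EG EM G M)

/-- `T_h l_g` for the left translation `l_g : α⁻¹(β(g)) → α⁻¹(α(g))`. The derivative within the
fibre `α⁻¹(β(g))` is only meaningful, and only used, on vectors tangent to that fibre. -/
def tangentL (g h : G) :
    TangentSpace 𝓘(ℝ, EG) h →L[ℝ] TangentSpace 𝓘(ℝ, EG) (𝒢.mul g h) :=
  mfderivWithin 𝓘(ℝ, EG) 𝓘(ℝ, EG) (fun k => 𝒢.mul g k) (𝒢.src ⁻¹' {𝒢.tgt g}) h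

/-- `T_h r_g` for the right translation `r_g : β⁻¹(α(g)) → β⁻¹(β(g))`, used on vectors tangent to
the fibre `β⁻¹(α(g))`. -/
def tangentR (g h : G) :
    TangentSpace 𝓘(ℝ, EG) h →L[ℝ] TangentSpace 𝓘(ℝ, EG) (𝒢.mul h g) :=
  mfderivWithin 𝓘(ℝ, EG) 𝓘(ℝ, EG) (fun k => 𝒢.mul k g) (𝒢.tgt ⁻¹' {𝒢.src g}) h

/-! ### The Lie algebroid `P^τ G = Vβ ⊕ Vα → G` -/

/-- The ambient fibre `T_g G ⊕ T_g G` of `P^τ G = Vβ ⊕ Vα`. -/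
abbrev PTau (_ : LieGroupoid EG EM G M) (g : G) : Type _ :=
  TangentSpace 𝓘(ℝ, EG) g × TangentSpace 𝓘(ℝ, EG) g

variable [IsManifold 𝓘(ℝ, EG) ∞ G]

/-- Smooth sections `(X, Y)` of `Vβ ⊕ Vα`. -/
structure IsPTauSection (σ : ∀ g, 𝒢.PTau g) : Prop where
  smooth_fst : ContMDiff 𝓘(ℝ, EG) 𝓘(ℝ, EG).tangent ∞
    (fun g => (⟨g, (σ g).1⟩ : TangentBundle 𝓘(ℝ, EG) G))
  smooth_snd : ContMDiff 𝓘(ℝ, EG) 𝓘(ℝ, EG).tangent ∞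
    (fun g => (⟨g, (σ g).2⟩ : TangentBundle 𝓘(ℝ, EG) G))
  tgt_fst : ∀ g, mfderiv 𝓘(ℝ, EG) 𝓘(ℝ, EM) 𝒢.tgt g (σ g).1 = 0
  src_snd : ∀ g, mfderiv 𝓘(ℝ, EG) 𝓘(ℝ, EM) 𝒢.src g (σ g).2 = 0

/-- The Lie groupoid over `G` with space of arrows
`{(g, h, s) ∈ G × G × G | β(g) = β(h), α(h) = α(s)}`, source `g`, target `s`, units `(g, g, g)` and
product `(g, h, s)(s, h', s') = (g, h' s⁻¹ h, s')`, has the Lie algebroid `Vβ ⊕ Vα`, where `(X, Y)`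
stands for the vector `(0, X, X + Y)` at a unit. The left-invariant vector field that extends
a section `(X, Y)` takes the value `(0, T r_{s⁻¹h} X(s), X(s) + Y(s))` at `(g, h, s)`; since it is
tangent to the source fibres, the constant entry `g` is dropped. -/
def starField (σ : ∀ g, 𝒢.PTau g) (p : G × G) :
    TangentSpace (𝓘(ℝ, EG).prod 𝓘(ℝ, EG)) p :=
  ((𝒢.tangentR (𝒢.mul (𝒢.inv p.2) p.1) p.2 (σ p.2).1 : EG), ((σ p.2).1 + (σ p.2).2 : EG))

/-- The source fibre `{(h, s) | β(h) = β(g), α(h) = α(s)}` over `g` of that groupoid. -/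
def starFibre (g : G) : Set (G × G) :=
  {p | 𝒢.tgt p.1 = 𝒢.tgt g ∧ 𝒢.src p.1 = 𝒢.src p.2}

/-- The bracket on sections of `P^τ G = Vβ ⊕ Vα`: the Lie bracket, at the unit, of the
left-invariant vector fields on the source fibre. The vector fields are tangent to the submanifold
`starFibre g`, so their bracket within that set does not depend on any extension. -/
def pTauBracket (σ σ' : ∀ g, 𝒢.PTau g) (g : G) : 𝒢.PTau g :=
  let W : EG × EG := VectorField.mlieBracketWithin (𝓘(ℝ, EG).prod 𝓘(ℝ, EG))
    (𝒢.starField σ) (𝒢.starField σ') (𝒢.starFibre g) (g, g)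
  (W.1, W.2 - W.1)

/-- The Lie algebroid `P^τ G = Vβ ⊕ Vα → G`, with anchor `(X, Y) ↦ X + Y`. -/
def pTau : BundleBracket 𝓘(ℝ, EG) G 𝒢.PTau where
  IsSection := 𝒢.IsPTauSection
  anchor _ := LinearMap.fst ℝ _ _ + LinearMap.snd ℝ _ _
  bracket := 𝒢.pTauBracket

/-- The Poincaré-Cartan `1`-section `Θ_L⁺(X, Y) = Y(L)`. -/
def thetaPlus (L : G → ℝ) (g : G) : 𝒢.PTau g →ₗ[ℝ] ℝ :=
  (mfderiv 𝓘(ℝ, EG) 𝓘(ℝ, ℝ) L g).toLinearMap ∘ₗ LinearMap.snd ℝ _ _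

/-- The Poincaré-Cartan `2`-section `Ω_L = -dΘ_L⁺`. -/
def omegaL (L : G → ℝ) (σ σ' : ∀ g, 𝒢.PTau g) : G → ℝ :=
  -𝒢.pTau.extDeriv (𝒢.thetaPlus L) σ σ'

/-- `L` is regular if `Ω_L` is symplectic. Being exact, `Ω_L` is always closed, so this means that
`Ω_L` is nondegenerate. -/
def IsRegular (L : G → ℝ) : Prop := 𝒢.pTau.Nondegenerate (𝒢.omegaL L)

/-- The bracket `{f, g}_L = -Ω_L(ξ_f, ξ_g)`. -/
def poissonL (L : G → ℝ) : (G → ℝ) → (G → ℝ) → G → ℝ := 𝒢.pTau.poisson (𝒢.omegaL L)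

/-! ### The dual bundle `A^*G` and its linear Poisson bracket -/

/-- The total space `A^*G` of the dual of the Lie algebroid `AG → M`. -/
abbrev Dual : Type _ :=
  TotalSpace (AlgModel EG EM →L[ℝ] ℝ) (fun x : M => 𝒢.Alg x →L[ℝ] Bundle.Trivial M ℝ x)

variable [FiniteDimensional ℝ EG] [FiniteDimensional ℝ EM] [IsManifold 𝓘(ℝ, EM) ∞ M]

/-- The model of the manifold `A^*G`. -/
abbrev dualModel (EG EM : Type*) [NormedAddCommGroup EG] [NormedSpace ℝ EG]
    [NormedAddCommGroup EM] [NormedSpace ℝ EM] :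
    ModelWithCorners ℝ (EM × (AlgModel EG EM →L[ℝ] ℝ)) (ModelProd EM (AlgModel EG EM →L[ℝ] ℝ)) :=
  𝓘(ℝ, EM).prod 𝓘(ℝ, AlgModel EG EM →L[ℝ] ℝ)

/-- The ambient fibre `A_{τ*(μ)} G ⊕ T_μ(A^*G)` of the prolongation `P^{τ*}(AG) → A^*G`. -/
abbrev PTauStar (μ : 𝒢.Dual) : Type _ := 𝒢.Alg μ.proj × TangentSpace (dualModel EG EM) μ

/-- Smooth sections `(v, X)` of the prolongation `P^{τ*}(AG)` of `AG` over `τ* : A^*G → M`, whose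
fibre at `μ` is `{(v, X) | ρ(v) = T τ* (X)}`, with `ρ(v) = T β (v)`. -/
structure IsPTauStarSection (σ : ∀ μ, 𝒢.PTauStar μ) : Prop where
  smooth_fst : ContMDiff (dualModel EG EM) (𝓘(ℝ, EM).prod 𝓘(ℝ, AlgModel EG EM)) ∞
    (fun μ : 𝒢.Dual => (⟨μ.proj, (σ μ).1⟩ : TotalSpace (AlgModel EG EM) 𝒢.Alg))
  smooth_snd : ContMDiff (dualModel EG EM) (dualModel EG EM).tangent ∞
    (fun μ : 𝒢.Dual => (⟨μ, (σ μ).2⟩ : TangentBundle (dualModel EG EM) 𝒢.Dual))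
  anchor_eq : ∀ μ : 𝒢.Dual,
    (mfderiv 𝓘(ℝ, EG) 𝓘(ℝ, EM) 𝒢.tgt (𝒢.unit μ.proj) (𝒢.algIncl μ.proj (σ μ).1) : EM) =
      (mfderiv (dualModel EG EM) 𝓘(ℝ, EM) (TotalSpace.proj : 𝒢.Dual → M) μ (σ μ).2 : EM)

/-- `P^{τ*}(AG)` is the Lie algebroid of the Lie groupoid over `A^*G` with space of arrows
`{(μ, g, μ') | τ*(μ) = α(g), β(g) = τ*(μ')}` and product `(μ, g, μ')(μ', h, μ'') = (μ, gh, μ'')`.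
The left-invariant vector field that extends a section `(v, X)` takes the value
`(0, T l_g v(μ'), X(μ'))` at `(μ, g, μ')`; the constant entry `μ` is dropped. -/
def prolField (σ : ∀ μ, 𝒢.PTauStar μ) (p : G × 𝒢.Dual) :
    TangentSpace (𝓘(ℝ, EG).prod (dualModel EG EM)) p :=
  ((𝒢.tangentL p.1 (𝒢.unit p.2.proj) (𝒢.algIncl p.2.proj (σ p.2).1) : EG),
    ((σ p.2).2 : EM × (AlgModel EG EM →L[ℝ] ℝ)))

/-- The source fibre `{(g, μ') | α(g) = τ*(μ), β(g) = τ*(μ')}` over `μ` of that groupoid. -/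
def prolFibre (μ : 𝒢.Dual) : Set (G × 𝒢.Dual) :=
  {p | 𝒢.src p.1 = μ.proj ∧ 𝒢.tgt p.1 = p.2.proj}

open Classical in
/-- The bracket on sections of `P^{τ*}(AG)`: the Lie bracket, at the unit, of the left-invariant
vector fields on the source fibre. The first component of that bracket is always in the kernel of
`T α`. -/
def pTauStarBracket (σ σ' : ∀ μ, 𝒢.PTauStar μ) (μ : 𝒢.Dual) : 𝒢.PTauStar μ :=
  let W : EG × (EM × (AlgModel EG EM →L[ℝ] ℝ)) :=
    VectorField.mlieBracketWithin (𝓘(ℝ, EG).prod (dualModel EG EM))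
      (𝒢.prolField σ) (𝒢.prolField σ') (𝒢.prolFibre μ) (𝒢.unit μ.proj, μ)
  (if h : mfderiv 𝓘(ℝ, EG) 𝓘(ℝ, EM) 𝒢.src (𝒢.unit μ.proj) W.1 = 0 then
    𝒢.algMk μ.proj W.1 h else 0, W.2)

/-- The Lie algebroid `P^{τ*}(AG) → A^*G`, with anchor `(v, X) ↦ X`. -/
def pTauStar : BundleBracket (dualModel EG EM) 𝒢.Dual 𝒢.PTauStar where
  IsSection := 𝒢.IsPTauStarSection
  anchor _ := LinearMap.snd ℝ _ _
  bracket := 𝒢.pTauStarBracket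

/-- The Liouville section `Θ(μ)(v, X) = μ(v)`. -/
def liouville (μ : 𝒢.Dual) : 𝒢.PTauStar μ →ₗ[ℝ] ℝ :=
  μ.snd.toLinearMap ∘ₗ LinearMap.fst ℝ _ _

/-- The canonical symplectic section `Ω = -dΘ` of `P^{τ*}(AG)`. -/
def omegaDual (σ σ' : ∀ μ, 𝒢.PTauStar μ) : 𝒢.Dual → ℝ :=
  -𝒢.pTauStar.extDeriv 𝒢.liouville σ σ'

/-- The canonical linear Poisson bracket `{f, g} = -Ω(ξ_f, ξ_g)` on `A^*G`. -/
def poissonDual : (𝒢.Dual → ℝ) → (𝒢.Dual → ℝ) → 𝒢.Dual → ℝ := 𝒢.pTauStar.poisson 𝒢.omegaDual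

/-- The Legendre transformation `(F⁺L)(g)(v) = v(L ∘ l_g)` for `v ∈ A_{β(g)} G`. -/
def legendrePlus (L : G → ℝ) (g : G) : 𝒢.Dual :=
  ⟨𝒢.tgt g, (mfderivWithin 𝓘(ℝ, EG) 𝓘(ℝ, ℝ) (fun k => L (𝒢.mul g k))
    (𝒢.src ⁻¹' {𝒢.tgt g}) (𝒢.unit (𝒢.tgt g))) ∘L 𝒢.algIncl (𝒢.tgt g)⟩

/-- The Legendre transformation `(F⁻L)(h)(v) = -v(L ∘ r_h ∘ i)` for `v ∈ A_{α(h)} G`. -/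
def legendreMinus (L : G → ℝ) (h : G) : 𝒢.Dual :=
  ⟨𝒢.src h, -((mfderivWithin 𝓘(ℝ, EG) 𝓘(ℝ, ℝ) (fun k => L (𝒢.mul (𝒢.inv k) h))
    (𝒢.src ⁻¹' {𝒢.src h}) (𝒢.unit (𝒢.src h))) ∘L 𝒢.algIncl (𝒢.src h))⟩

end LieGroupoid

end

noncomputable section

open Filter Topology

set_option linter.unusedSectionVars false

section TangentCalculus

variable {E H N E' H' N' E'' H'' N'' : Type*}
  [NormedAddCommGroup E] [NormedSpace ℝ E] [TopologicalSpace H] {I : ModelWithCorners ℝ E H}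
  [TopologicalSpace N] [ChartedSpace H N]
  [NormedAddCommGroup E'] [NormedSpace ℝ E'] [TopologicalSpace H'] {I' : ModelWithCorners ℝ E' H'}
  [TopologicalSpace N'] [ChartedSpace H' N']
  [NormedAddCommGroup E''] [NormedSpace ℝ E''] [TopologicalSpace H'']
  {I'' : ModelWithCorners ℝ E'' H''} [TopologicalSpace N''] [ChartedSpace H'' N'']

/-- The manifold derivative as a map between the model spaces. -/
def tderiv (I : ModelWithCorners ℝ E H) (I' : ModelWithCorners ℝ E' H') (f : N → N') (x : N) :
    E →L[ℝ] E' := mfderiv I I' f x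

/-- `f` is smooth at all points near `x`. -/
def SmoothNear (I : ModelWithCorners ℝ E H) (I' : ModelWithCorners ℝ E' H') (f : N → N') (x : N) :
    Prop := ∀ᶠ y in 𝓝 x, ContMDiffAt I I' ∞ f y

/-- `V` is a smooth vector field along `f` near `x`. -/
def SmoothAlong (I : ModelWithCorners ℝ E H) (I' : ModelWithCorners ℝ E' H') [IsManifold I' ∞ N']
    (f : N → N') (V : N → E') (x : N) : Prop :=
  SmoothNear I I'.tangent (fun y => (⟨f y, V y⟩ : TangentBundle I' N')) x

/-- `V` is a smooth vector field near `x`. -/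
abbrev SmoothField (I : ModelWithCorners ℝ E H) [IsManifold I ∞ N] (V : N → E) (x : N) : Prop :=
  SmoothAlong I I (fun y : N => y) V x

/-- The bracket of vector fields. -/
def fieldBracket (I : ModelWithCorners ℝ E H) (V W : N → E) (x : N) : E :=
  VectorField.mlieBracket I (M := N) (fun y => (V y : TangentSpace I y)) (fun y => W y) x

theorem ContMDiff.smoothNear {f : N → N'} (h : ContMDiff I I' ∞ f) (x : N) :
    SmoothNear I I' f x := Eventually.of_forall h

theorem ContMDiffOn.smoothNear {f : N → N'} {s : Set N} (h : ContMDiffOn I I' ∞ f s) {x : N}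
    (hs : s ∈ 𝓝 x) : SmoothNear I I' f x := by
  filter_upwards [eventually_mem_nhds_iff.2 hs] with y hy
  exact h.contMDiffAt hy

namespace SmoothNear

theorem contMDiffAt {f : N → N'} {x : N} (h : SmoothNear I I' f x) : ContMDiffAt I I' ∞ f x :=
  h.self_of_nhds

theorem eventually {f : N → N'} {x : N} (h : SmoothNear I I' f x) :
    ∀ᶠ y in 𝓝 x, SmoothNear I I' f y := eventually_eventually_nhds.2 h

theorem mdifferentiableAt {f : N → N'} {x : N} (h : SmoothNear I I' f x) :
    MDifferentiableAt I I' f x := h.contMDiffAt.mdifferentiableAt (by simp)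

theorem continuousAt {f : N → N'} {x : N} (h : SmoothNear I I' f x) : ContinuousAt f x :=
  h.contMDiffAt.continuousAt

theorem comp {g : N' → N''} {f : N → N'} {x : N} (hg : SmoothNear I' I'' g (f x))
    (hf : SmoothNear I I' f x) : SmoothNear I I'' (fun y => g (f y)) x := by
  filter_upwards [hf.continuousAt.eventually hg, hf] with y h1 h2
  exact ContMDiffAt.comp y h1 h2

theorem comp_of_eq {g : N' → N''} {f : N → N'} {x : N} {y : N'} (hg : SmoothNear I' I'' g y)
    (hf : SmoothNear I I' f x) (h : f x = y) : SmoothNear I I'' (fun y => g (f y)) x := by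
  subst h
  exact hg.comp hf

theorem congr {f g : N → N'} {x : N} (hf : SmoothNear I I' f x) (h : g =ᶠ[𝓝 x] f) :
    SmoothNear I I' g x := by
  filter_upwards [hf, eventually_eventually_nhds.2 h] with y h1 h2
  exact h1.congr_of_eventuallyEq h2

theorem prodMk {f : N → N'} {g : N → N''} {x : N} (hf : SmoothNear I I' f x)
    (hg : SmoothNear I I'' g x) : SmoothNear I (I'.prod I'') (fun y => (f y, g y)) x := by
  filter_upwards [hf, hg] with y h1 h2
  exact h1.prodMk h2

theorem prodMk_space {f : N → E'} {g : N → E''} {x : N} (hf : SmoothNear I 𝓘(ℝ, E') f x)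
    (hg : SmoothNear I 𝓘(ℝ, E'') g x) : SmoothNear I 𝓘(ℝ, E' × E'') (fun y => (f y, g y)) x := by
  filter_upwards [hf, hg] with y h1 h2
  exact h1.prodMk_space h2

theorem add {f g : N → E'} {x : N} (hf : SmoothNear I 𝓘(ℝ, E') f x)
    (hg : SmoothNear I 𝓘(ℝ, E') g x) : SmoothNear I 𝓘(ℝ, E') (fun y => f y + g y) x := by
  filter_upwards [hf, hg] with y h1 h2
  exact h1.add h2

theorem sub {f g : N → E'} {x : N} (hf : SmoothNear I 𝓘(ℝ, E') f x)
    (hg : SmoothNear I 𝓘(ℝ, E') g x) : SmoothNear I 𝓘(ℝ, E') (fun y => f y - g y) x := by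
  filter_upwards [hf, hg] with y h1 h2
  exact h1.sub h2

theorem neg {f : N → E'} {x : N} (hf : SmoothNear I 𝓘(ℝ, E') f x) :
    SmoothNear I 𝓘(ℝ, E') (fun y => - f y) x := by
  filter_upwards [hf] with y h1
  exact h1.neg

theorem smul {f : N → ℝ} {g : N → E'} {x : N} (hf : SmoothNear I 𝓘(ℝ, ℝ) f x)
    (hg : SmoothNear I 𝓘(ℝ, E') g x) : SmoothNear I 𝓘(ℝ, E') (fun y => f y • g y) x := by
  filter_upwards [hf, hg] with y h1 h2
  exact h1.smul h2

theorem sum {ι : Type*} {f : ι → N → E'} {x : N} {s : Finset ι}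
    (hf : ∀ i, SmoothNear I 𝓘(ℝ, E') (f i) x) :
    SmoothNear I 𝓘(ℝ, E') (fun y => ∑ i ∈ s, f i y) x := by
  filter_upwards [(Finset.eventually_all s).2 fun i _ => hf i] with y h
  exact ContMDiffAt.sum h

theorem const (c : N') (x : N) : SmoothNear I I' (fun _ : N => c) x :=
  Eventually.of_forall fun _ => contMDiffAt_const

theorem id (x : N) : SmoothNear I I (fun y : N => y) x :=
  Eventually.of_forall fun _ => contMDiffAt_id

theorem fst (p : N × N') : SmoothNear (I.prod I') I (fun q : N × N' => q.1) p :=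
  Eventually.of_forall fun _ => contMDiffAt_fst

theorem snd (p : N × N') : SmoothNear (I.prod I') I' (fun q : N × N' => q.2) p :=
  Eventually.of_forall fun _ => contMDiffAt_snd

theorem clm (L : E →L[ℝ] E') {f : N'' → E} {x : N''} (hf : SmoothNear I'' 𝓘(ℝ, E) f x) :
    SmoothNear I'' 𝓘(ℝ, E') (fun y => L (f y)) x :=
  (L.contMDiff.smoothNear _).comp hf

theorem clm_apply {L : N → E' →L[ℝ] E''} {f : N → E'} {x : N}
    (hL : SmoothNear I 𝓘(ℝ, E' →L[ℝ] E'') L x)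
    (hf : SmoothNear I 𝓘(ℝ, E') f x) : SmoothNear I 𝓘(ℝ, E'') (fun y => L y (f y)) x := by
  filter_upwards [hL, hf] with y h1 h2
  exact h1.clm_apply h2

/-- A family of linear maps out of a finite-dimensional space is smooth if it is pointwise. -/
theorem of_apply [FiniteDimensional ℝ E'] {L : N → E' →L[ℝ] E''} {x : N}
    (h : ∀ w, SmoothNear I 𝓘(ℝ, E'') (fun y => L y w) x) :
    SmoothNear I 𝓘(ℝ, E' →L[ℝ] E'') L x := by
  let b := Module.finBasis ℝ E'
  have key : L = fun y => ∑ i, (ContinuousLinearMap.smulRightL ℝ E' E''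
      ((b.coord i).toContinuousLinearMap)) (L y (b i)) := by
    funext y
    ext w
    rw [sum_apply]
    conv_lhs => rw [← b.sum_repr w, map_sum]
    refine Finset.sum_congr rfl fun i _ => ?_
    simp
  rw [key]
  exact SmoothNear.sum fun i => (h (b i)).clm _

theorem clm_inverse [CompleteSpace E'] {L : N → E' →L[ℝ] E''} {x : N}
    (hL : SmoothNear I 𝓘(ℝ, E' →L[ℝ] E'') L x) (h : (L x).IsInvertible) :
    SmoothNear I 𝓘(ℝ, E'' →L[ℝ] E') (fun y => (L y).inverse) x := by
  have h1 : ∀ᶠ y in 𝓝 x, (L y).IsInvertible :=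
    hL.continuousAt.eventually (ContinuousLinearEquiv.isOpen.mem_nhds h)
  filter_upwards [hL, h1] with y h2 h3
  exact (ContinuousLinearMap.IsInvertible.contDiffAt_map_inverse h3).contMDiffAt.comp y h2

end SmoothNear

theorem tderiv_comp {g : N' → N''} {f : N → N'} {x : N} (hg : MDifferentiableAt I' I'' g (f x))
    (hf : MDifferentiableAt I I' f x) (v : E) :
    tderiv I I'' (fun y => g (f y)) x v = tderiv I' I'' g (f x) (tderiv I I' f x v) := by
  have := mfderiv_comp x hg hf
  exact congrArg (fun L : E →L[ℝ] E'' => L v) this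

theorem tderiv_comp_of_eq {g : N' → N''} {f : N → N'} {x : N} {y : N'}
    (hg : MDifferentiableAt I' I'' g y)
    (hf : MDifferentiableAt I I' f x) (h : f x = y) (v : E) :
    tderiv I I'' (fun y => g (f y)) x v = tderiv I' I'' g y (tderiv I I' f x v) := by
  subst h
  exact tderiv_comp hg hf v

theorem tderiv_congr {f g : N → N'} {x : N} (h : f =ᶠ[𝓝 x] g) : tderiv I I' f x = tderiv I I' g x :=
  h.mfderiv_eq

theorem tderiv_const (c : N') (x : N) : tderiv I I' (fun _ : N => c) x = 0 := mfderiv_const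

theorem tderiv_id (x : N) : tderiv I I (fun y : N => y) x = ContinuousLinearMap.id ℝ E := mfderiv_id

theorem tderiv_fst (p : N × N') (v : E × E') :
    tderiv (I.prod I') I (fun q : N × N' => q.1) p v = v.1 := by
  have := mfderiv_fst (I := I) (I' := I') (x := p)
  exact congrArg (fun L : E × E' →L[ℝ] E => L v) this

theorem tderiv_snd (p : N × N') (v : E × E') :
    tderiv (I.prod I') I' (fun q : N × N' => q.2) p v = v.2 := by
  have := mfderiv_snd (I := I) (I' := I') (x := p)
  exact congrArg (fun L : E × E' →L[ℝ] E' => L v) this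

theorem tderiv_prodMk {f : N → N'} {g : N → N''} {x : N} (hf : MDifferentiableAt I I' f x)
    (hg : MDifferentiableAt I I'' g x) (v : E) :
    tderiv I (I'.prod I'') (fun y => (f y, g y)) x v = (tderiv I I' f x v, tderiv I I'' g x v) := by
  have := mfderiv_prodMk hf hg
  exact congrArg (fun L : E →L[ℝ] E' × E'' => L v) this

theorem tderiv_add {f g : N → E'} {x : N} (hf : MDifferentiableAt I 𝓘(ℝ, E') f x)
    (hg : MDifferentiableAt I 𝓘(ℝ, E') g x) (v : E) :
    tderiv I 𝓘(ℝ, E') (fun y => f y + g y) x v =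
      tderiv I 𝓘(ℝ, E') f x v + tderiv I 𝓘(ℝ, E') g x v := by
  have := mfderiv_add hf hg
  exact congrArg (fun L : E →L[ℝ] E' => L v) this

theorem tderiv_neg (f : N → E') (x : N) (v : E) :
    tderiv I 𝓘(ℝ, E') (fun y => - f y) x v = - tderiv I 𝓘(ℝ, E') f x v := by
  have := mfderiv_neg (I := I) (f := f) (x := x)
  exact congrArg (fun L : E →L[ℝ] E' => L v) this

theorem tderiv_sub {f g : N → E'} {x : N} (hf : MDifferentiableAt I 𝓘(ℝ, E') f x)
    (hg : MDifferentiableAt I 𝓘(ℝ, E') g x) (v : E) :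
    tderiv I 𝓘(ℝ, E') (fun y => f y - g y) x v =
      tderiv I 𝓘(ℝ, E') f x v - tderiv I 𝓘(ℝ, E') g x v := by
  have := mfderiv_sub hf hg
  exact congrArg (fun L : E →L[ℝ] E' => L v) this

theorem tderiv_clm (L : E →L[ℝ] E') {f : N'' → E} {x : N''}
    (hf : MDifferentiableAt I'' 𝓘(ℝ, E) f x) (v : E'') :
    tderiv I'' 𝓘(ℝ, E') (fun y => L (f y)) x v = L (tderiv I'' 𝓘(ℝ, E) f x v) := by
  rw [tderiv_comp (L.mdifferentiableAt) hf]
  change mfderiv _ _ L (f x) _ = _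
  rw [L.mfderiv_eq]
  rfl

theorem tderiv_clm_apply {L : N → E' →L[ℝ] E''} {f : N → E'} {x : N}
    (hL : MDifferentiableAt I 𝓘(ℝ, E' →L[ℝ] E'') L x)
    (hf : MDifferentiableAt I 𝓘(ℝ, E') f x) (v : E) :
    tderiv I 𝓘(ℝ, E'') (fun y => L y (f y)) x v =
      tderiv I 𝓘(ℝ, E' →L[ℝ] E'') L x v (f x) + L x (tderiv I 𝓘(ℝ, E') f x v) := by
  have h : HasMFDerivAt I 𝓘(ℝ, E'') (fun y => L y (f y)) x
      ((L x).comp (tderiv I 𝓘(ℝ, E') f x) +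
        (tderiv I 𝓘(ℝ, E' →L[ℝ] E'') L x).flip (f x)) := by
    refine ⟨hL.continuousAt.clm_apply hf.continuousAt, ?_⟩
    have h1 := HasFDerivWithinAt.clm_apply hL.hasMFDerivAt.2 hf.hasMFDerivAt.2
    simp only [writtenInExtChartAt, extChartAt_model_space_eq_id, PartialEquiv.refl_coe,
      Function.comp_def, id, extChartAt_to_inv] at h1 ⊢
    exact h1
  have h2 := congrArg (fun A : E →L[ℝ] E'' => A v) h.mfderiv
  refine h2.trans ?_
  change (L x) (tderiv I 𝓘(ℝ, E') f x v) + tderiv I 𝓘(ℝ, E' →L[ℝ] E'') L x v (f x) = _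
  rw [add_comm]

theorem tderiv_smul {f : N → ℝ} {g : N → E'} {x : N} (hf : MDifferentiableAt I 𝓘(ℝ, ℝ) f x)
    (hg : MDifferentiableAt I 𝓘(ℝ, E') g x) (v : E) :
    tderiv I 𝓘(ℝ, E') (fun y => f y • g y) x v =
      tderiv I 𝓘(ℝ, ℝ) f x v • g x + f x • tderiv I 𝓘(ℝ, E') g x v := by
  have h : HasMFDerivAt I 𝓘(ℝ, E') (fun y => f y • g y) x
      (f x • tderiv I 𝓘(ℝ, E') g x + (tderiv I 𝓘(ℝ, ℝ) f x).smulRight (g x)) := by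
    refine ⟨hf.continuousAt.smul hg.continuousAt, ?_⟩
    have h1 := HasFDerivWithinAt.smul hf.hasMFDerivAt.2 hg.hasMFDerivAt.2
    simp only [writtenInExtChartAt, extChartAt_model_space_eq_id, PartialEquiv.refl_coe,
      Function.comp_def, id, extChartAt_to_inv] at h1 ⊢
    exact h1
  have h2 := congrArg (fun A : E →L[ℝ] E' => A v) h.mfderiv
  refine h2.trans ?_
  change f x • tderiv I 𝓘(ℝ, E') g x v + tderiv I 𝓘(ℝ, ℝ) f x v • g x = _
  rw [add_comm]

theorem tderiv_mul {f g : N → ℝ} {x : N} (hf : MDifferentiableAt I 𝓘(ℝ, ℝ) f x)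
    (hg : MDifferentiableAt I 𝓘(ℝ, ℝ) g x) (v : E) :
    tderiv I 𝓘(ℝ, ℝ) (fun y => f y * g y) x v =
      tderiv I 𝓘(ℝ, ℝ) f x v * g x + f x * tderiv I 𝓘(ℝ, ℝ) g x v :=
  tderiv_smul hf hg v

variable [IsManifold I ∞ N] [IsManifold I' ∞ N'] [IsManifold I'' ∞ N'']

theorem SmoothNear.tangentMap {f : N → N'} {x : N} (h : SmoothNear I I' f x) (v : E) :
    SmoothNear I.tangent I'.tangent
      (fun p : TangentBundle I N => (⟨f p.1, tderiv I I' f p.1 p.2⟩ : TangentBundle I' N'))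
      (⟨x, v⟩ : TangentBundle I N) := by
  obtain ⟨O, hO, hOo, hx⟩ := eventually_nhds_iff.1 h
  have h1 : ContMDiffOn I I' ∞ f O := fun y hy => (hO y hy).contMDiffWithinAt
  have h2 := h1.contMDiffOn_tangentMapWithin (m := ∞) (by simp) hOo.uniqueMDiffOn
  have hp : IsOpen (TotalSpace.proj ⁻¹' O : Set (TangentBundle I N)) :=
    hOo.preimage (FiberBundle.continuous_proj E (TangentSpace I))
  refine (ContMDiffOn.congr h2 fun p hp => ?_).smoothNear (hp.mem_nhds hx)
  have h3 : mfderivWithin I I' f O p.1 = mfderiv I I' f p.1 := mfderivWithin_of_isOpen hOo hp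
  exact congrArg (fun L : E →L[ℝ] E' => (⟨f p.1, L p.2⟩ : TangentBundle I' N')) h3.symm

/-- The image of a smooth vector field along `f` under a smooth map. -/
theorem SmoothAlong.map {g : N' → N''} {f : N → N'} {V : N → E'} {x : N}
    (hV : SmoothAlong I I' f V x) (hg : SmoothNear I' I'' g (f x)) :
    SmoothAlong I I'' (fun y => g (f y)) (fun y => tderiv I' I'' g (f y) (V y)) x :=
  SmoothNear.comp (f := fun y => (⟨f y, V y⟩ : TangentBundle I' N')) (hg.tangentMap (V x)) hV

theorem SmoothAlong.coord {f : N → E'} {V : N → E'} {x : N} (hV : SmoothAlong I 𝓘(ℝ, E') f V x) :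
    SmoothNear I 𝓘(ℝ, E') V x :=
  ((contMDiff_snd_tangentBundle_modelSpace E' 𝓘(ℝ, E')).smoothNear _).comp hV

theorem SmoothAlong.deriv {g : N' → E''} {f : N → N'} {V : N → E'} {x : N}
    (hV : SmoothAlong I I' f V x) (hg : SmoothNear I' 𝓘(ℝ, E'') g (f x)) :
    SmoothNear I 𝓘(ℝ, E'') (fun y => tderiv I' 𝓘(ℝ, E'') g (f y) (V y)) x :=
  (hV.map hg).coord

theorem SmoothAlong.comp {f : N' → N''} {V : N' → E''} {k : N → N'} {x : N}
    (hV : SmoothAlong I' I'' f V (k x)) (hk : SmoothNear I I' k x) :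
    SmoothAlong I I'' (fun y => f (k y)) (fun y => V (k y)) x :=
  SmoothNear.comp (f := k) hV hk

theorem SmoothAlong.prodMk {f : N → N'} {V : N → E'} {g : N → N''} {W : N → E''} {x : N}
    (hV : SmoothAlong I I' f V x) (hW : SmoothAlong I I'' g W x) :
    SmoothAlong I (I'.prod I'') (fun y => (f y, g y)) (fun y => (V y, W y)) x := by
  exact ((contMDiff_equivTangentBundleProd_symm (n := ∞) (I := I') (I' := I'') (M := N')
    (M' := N'')).smoothNear _).comp (SmoothNear.prodMk hV hW)

/-- A vector field is smooth if its coordinates are. -/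
theorem SmoothAlong.of_coord [I'.Boundaryless] {f : N → N'} {V : N → E'} {x : N}
    (hf : SmoothNear I I' f x)
    (h : SmoothNear I 𝓘(ℝ, E') (fun y => tderiv I' 𝓘(ℝ, E') (extChartAt I' (f x)) (f y) (V y)) x) :
    SmoothAlong I I' f V x := by
  unfold SmoothAlong
  have hs : ∀ᶠ y in 𝓝 x, f y ∈ (chartAt H' (f x)).source :=
    hf.continuousAt.eventually ((chartAt H' (f x)).open_source.mem_nhds (mem_chart_source H' (f x)))
  filter_upwards [hf, h, hs, eventually_eventually_nhds.2 hs] with y h1 h2 h3 h4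
  refine (Trivialization.contMDiffAt_iff (IB := I')
    (e := trivializationAt E' (TangentSpace I' : N' → Type _) (f x))
    (f := fun y => (⟨f y, V y⟩ : TangentBundle I' N'))
    (by rw [Trivialization.mem_source]; exact h3)).2 ?_
  refine ⟨h1, h2.congr_of_eventuallyEq ?_⟩
  filter_upwards [h4] with z hz
  have h5 := TangentBundle.continuousLinearMapAt_trivializationAt (I := I') hz
  have h6 := congrArg (fun L : E' →L[ℝ] E' => L (V z)) h5
  refine Eq.trans ?_ h6
  exact (Trivialization.continuousLinearMapAt_apply_of_mem (R := ℝ) _ (hb := hz) _).symm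

theorem SmoothAlong.base {f : N → N'} {V : N → E'} {x : N} (h : SmoothAlong I I' f V x) :
    SmoothNear I I' f x :=
  ((contMDiff_proj (IB := I') (n := ∞) (TangentSpace I' : N' → Type _)).smoothNear
    (⟨f x, V x⟩ : TangentBundle I' N')).comp
    (f := fun y => (⟨f y, V y⟩ : TangentBundle I' N')) h

theorem smoothNear_extChartAt (x₀ : N) {x : N} (hx : x ∈ (chartAt H x₀).source) :
    SmoothNear I 𝓘(ℝ, E) (extChartAt I x₀) x :=
  (contMDiffOn_extChartAt (I := I) (n := ∞) (x := x₀)).smoothNear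
    ((chartAt H x₀).open_source.mem_nhds hx)

theorem tderiv_extChartAt_injective (x : N) :
    Function.Injective (tderiv I 𝓘(ℝ, E) (extChartAt I x) x) := by
  have h := mfderivWithin_extChartAt_symm_comp_mfderiv_extChartAt' (I := I) (mem_extChartAt_source x)
  intro v w hvw
  have hv := congrArg (fun L : E →L[ℝ] E => L v) h
  have hw := congrArg (fun L : E →L[ℝ] E => L w) h
  refine Eq.trans hv.symm (Eq.trans ?_ hw)
  exact congrArg (fun u : E => (mfderivWithin 𝓘(ℝ, E) I (extChartAt I x).symm (range I)
    (extChartAt I x x) : E →L[ℝ] E) u) hvw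

end TangentCalculus

section Bracket

variable {E H N E' H' N' E'' H'' N'' : Type*}
  [NormedAddCommGroup E] [NormedSpace ℝ E] [TopologicalSpace H] {I : ModelWithCorners ℝ E H}
  [TopologicalSpace N] [ChartedSpace H N]
  [NormedAddCommGroup E'] [NormedSpace ℝ E'] [TopologicalSpace H'] {I' : ModelWithCorners ℝ E' H'}
  [TopologicalSpace N'] [ChartedSpace H' N']
  [NormedAddCommGroup E''] [NormedSpace ℝ E''] [TopologicalSpace H'']
  {I'' : ModelWithCorners ℝ E'' H''} [TopologicalSpace N''] [ChartedSpace H'' N'']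

/-- `v` is tangent to `s` at `x`, as witnessed by a map into `s` whose derivative fixes `v`. -/
def TangentTo (I : ModelWithCorners ℝ E H) (s : Set N) (x : N) (v : E) : Prop :=
  ∃ φ : N → N, MDifferentiableAt I I φ x ∧ φ x = x ∧ (∀ᶠ y in 𝓝 x, φ y ∈ s) ∧
    tderiv I I φ x v = v

theorem TangentTo.univ (x : N) (v : E) : TangentTo I univ x v :=
  ⟨fun y => y, mdifferentiableAt_id, rfl, by simp, by rw [tderiv_id]; rfl⟩

theorem TangentTo.mem {s : Set N} {x : N} {v : E} (h : TangentTo I s x v) : x ∈ s := by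
  obtain ⟨φ, -, h2, h3, -⟩ := h
  have := h3.self_of_nhds
  rwa [h2] at this

/-- The derivative along a tangent vector of `s` depends only on the values on `s`. -/
theorem TangentTo.tderiv_eq {s : Set N} {x : N} {v : E} (h : TangentTo I s x v) {f g : N → N'}
    (hf : MDifferentiableAt I I' f x) (hg : MDifferentiableAt I I' g x)
    (hfg : ∀ᶠ y in 𝓝 x, y ∈ s → f y = g y) : tderiv I I' f x v = tderiv I I' g x v := by
  obtain ⟨φ, h1, h2, h3, h4⟩ := h
  have e : ∀ᶠ y in 𝓝 x, f (φ y) = g (φ y) := by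
    have := h1.continuousAt
    rw [ContinuousAt, h2] at this
    filter_upwards [this.eventually hfg, h3] with y h5 h6 using h5 h6
  rw [← h4, ← tderiv_comp_of_eq (y := x) hf h1 h2, ← tderiv_comp_of_eq (y := x) hg h1 h2]
  exact congrArg (fun L : E →L[ℝ] E' => L v) (tderiv_congr e)

/-- The derivative within `s` along tangent vectors agrees with the derivative of an extension. -/
theorem TangentTo.mfderivWithin_eq {s : Set N} {x : N} {v : E} (h : TangentTo I s x v)
    {f g : N → N'} (hg : MDifferentiableAt I I' g x)
    (hfg : ∀ᶠ y in 𝓝 x, y ∈ s → f y = g y) :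
    (mfderivWithin I I' f s x : E →L[ℝ] E') v = tderiv I I' g x v := by
  have hx := h.mem
  obtain ⟨φ, h1, h2, h3, h4⟩ := h
  have e0 : f =ᶠ[𝓝[s] x] g := eventually_nhdsWithin_iff.2 hfg
  have e1 : MDifferentiableWithinAt I I' f s x :=
    hg.mdifferentiableWithinAt.congr_of_eventuallyEq e0 (e0.self_of_nhdsWithin hx)
  have e2 : (mfderivWithin I I' f s x : E →L[ℝ] E') v =
      (mfderivWithin I I' f s (φ x) : E →L[ℝ] E') (tderiv I I φ x v) := by rw [h2, h4]
  have e3 : MDifferentiableWithinAt I I' f s (φ x) := by rwa [h2]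
  have hst : φ ⁻¹' s ∈ 𝓝 x := h3
  have e4 := (e3.hasMFDerivWithinAt.comp x (h1.hasMFDerivAt.hasMFDerivWithinAt)
    (subset_refl (φ ⁻¹' s))).hasMFDerivAt hst
  have e5 := congrArg (fun L : E →L[ℝ] E' => L v) e4.mfderiv
  rw [e2]
  refine Eq.trans e5.symm ?_
  have e : ∀ᶠ y in 𝓝 x, f (φ y) = g (φ y) := by
    have := h1.continuousAt
    rw [ContinuousAt, h2] at this
    filter_upwards [this.eventually hfg, h3] with y h5 h6 using h5 h6
  change tderiv I I' (fun y => f (φ y)) x v = _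
  rw [tderiv_congr e, tderiv_comp_of_eq (y := x) hg h1 h2, h4]

variable [IsManifold I ∞ N] [IsManifold I' ∞ N'] [IsManifold I'' ∞ N'']

section Chart

variable [I.Boundaryless] [CompleteSpace E]

/-- The derivative of the inverse of the preferred chart at `x`. -/
def chartSymmDeriv (I : ModelWithCorners ℝ E H) (x : N) (z : E) : E →L[ℝ] E :=
  mfderivWithin 𝓘(ℝ, E) I (extChartAt I x).symm (range I) z

/-- A vector field read in the preferred chart at `x`. -/
def chartField (I : ModelWithCorners ℝ E H) (x : N) (V : N → E) (z : E) : E :=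
  (chartSymmDeriv I x z).inverse (V ((extChartAt I x).symm z))

theorem differentiableAt_chartField {V : N → E} {x : N} (hV : SmoothField I V x) :
    DifferentiableAt ℝ (chartField I x V) (extChartAt I x x) := by
  have h1 := VectorField.contMDiffWithinAt_mpullbackWithin_extChartAt_symm (s := univ) (n := ∞)
    (m := ∞) (I := I) (V := fun y => (V y : TangentSpace I y))
    (hV.self_of_nhds : ContMDiffAt I I.tangent ∞ _ x).contMDiffWithinAt uniqueMDiffOn_univ
    (mem_univ x) (by simp)
  rw [contMDiffWithinAt_vectorSpace_iff_contDiffWithinAt] at h1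
  refine (h1.contDiffAt ?_).differentiableAt (by simp)
  rw [preimage_univ, inter_univ]
  exact extChartAt_target_mem_nhds x

theorem isInvertible_chartSymmDeriv {x : N} {z : E} (hz : z ∈ (extChartAt I x).target) :
    (chartSymmDeriv I x z).IsInvertible :=
  isInvertible_mfderivWithin_extChartAt_symm (I := I) hz

theorem chartSymmDeriv_eq (x : N) (z : E) :
    chartSymmDeriv I x z = tderiv 𝓘(ℝ, E) I (extChartAt I x).symm z := by
  have : mfderivWithin 𝓘(ℝ, E) I (extChartAt I x).symm (range I) z =
      mfderiv 𝓘(ℝ, E) I (extChartAt I x).symm z := by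
    rw [I.range_eq_univ, mfderivWithin_univ]
  exact this

theorem mdifferentiableAt_extChartAt_symm' {x : N} {z : E} (hz : z ∈ (extChartAt I x).target) :
    MDifferentiableAt 𝓘(ℝ, E) I (extChartAt I x).symm z :=
  ((contMDiffOn_extChartAt_symm (n := ∞) x).contMDiffAt
    ((isOpen_extChartAt_target x).mem_nhds hz)).mdifferentiableAt (by simp)

theorem fderiv_comp_extChartAt_symm {f : N → E'} {x : N} {z : E}
    (hz : z ∈ (extChartAt I x).target)
    (hf : MDifferentiableAt I 𝓘(ℝ, E') f ((extChartAt I x).symm z)) (w : E) :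
    fderiv ℝ (fun z => f ((extChartAt I x).symm z)) z w =
      tderiv I 𝓘(ℝ, E') f ((extChartAt I x).symm z) (chartSymmDeriv I x z w) := by
  rw [chartSymmDeriv_eq, ← tderiv_comp hf (mdifferentiableAt_extChartAt_symm' hz)]
  exact congrArg (fun L : E →L[ℝ] E' => L w) mfderiv_eq_fderiv.symm

theorem fderiv_chartField {f : N → E'} {x : N} {z : E} (hz : z ∈ (extChartAt I x).target)
    (hf : MDifferentiableAt I 𝓘(ℝ, E') f ((extChartAt I x).symm z)) (V : N → E) :
    fderiv ℝ (fun z => f ((extChartAt I x).symm z)) z (chartField I x V z) =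
      tderiv I 𝓘(ℝ, E') f ((extChartAt I x).symm z) (V ((extChartAt I x).symm z)) := by
  rw [fderiv_comp_extChartAt_symm hz hf, chartField,
    (isInvertible_chartSymmDeriv hz).self_apply_inverse]

theorem chartSymmDeriv_comp_tderiv (x : N) (v : E) :
    chartSymmDeriv I x (extChartAt I x x) (tderiv I 𝓘(ℝ, E) (extChartAt I x) x v) = v := by
  have h := mfderivWithin_extChartAt_symm_comp_mfderiv_extChartAt' (I := I)
    (mem_extChartAt_source x)
  exact congrArg (fun L : E →L[ℝ] E => L v) h

theorem inverse_tderiv_extChartAt (x : N) (w : E) :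
    (tderiv I 𝓘(ℝ, E) (extChartAt I x) x).inverse w = chartSymmDeriv I x (extChartAt I x x) w := by
  have h2 : (tderiv I 𝓘(ℝ, E) (extChartAt I x) x).IsInvertible :=
    isInvertible_mfderiv_extChartAt (I := I) (mem_extChartAt_source x)
  rw [← chartSymmDeriv_comp_tderiv (I := I) x
    ((tderiv I 𝓘(ℝ, E) (extChartAt I x) x).inverse w), h2.self_apply_inverse]

theorem mlieBracketWithin_eq_chartField (V W : N → E) (s : Set N) (x : N) :
    (VectorField.mlieBracketWithin I (M := N) (fun y => (V y : TangentSpace I y))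
      (fun y => W y) s x : E) =
    chartSymmDeriv I x (extChartAt I x x) (VectorField.lieBracketWithin ℝ (chartField I x V)
      (chartField I x W) ((extChartAt I x).symm ⁻¹' s) (extChartAt I x x)) := by
  have h : (extChartAt I x).symm ⁻¹' s ∩ range I = (extChartAt I x).symm ⁻¹' s := by
    rw [I.range_eq_univ]; simp
  rw [← inverse_tderiv_extChartAt, ← h]
  rfl

theorem fieldBracket_eq_chartField (V W : N → E) (x : N) :
    fieldBracket I V W x = chartSymmDeriv I x (extChartAt I x x)
      (VectorField.lieBracket ℝ (chartField I x V) (chartField I x W) (extChartAt I x x)) := by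
  rw [← VectorField.lieBracketWithin_univ]
  exact mlieBracketWithin_eq_chartField V W univ x

/-- The bracket acts on functions as the commutator. -/
theorem tderiv_fieldBracket [CompleteSpace E'] {f : N → E'} {V W : N → E} {x : N}
    (hf : SmoothNear I 𝓘(ℝ, E') f x)
    (hV : SmoothField I V x) (hW : SmoothField I W x) :
    tderiv I 𝓘(ℝ, E') f x (fieldBracket I V W x) =
      tderiv I 𝓘(ℝ, E') (fun y => tderiv I 𝓘(ℝ, E') f y (W y)) x (V x) -
      tderiv I 𝓘(ℝ, E') (fun y => tderiv I 𝓘(ℝ, E') f y (V y)) x (W x) := by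
  set z := extChartAt I x x with hz
  have hzt : z ∈ (extChartAt I x).target := mem_extChartAt_target x
  have hzx : (extChartAt I x).symm z = x := extChartAt_to_inv x
  have hsymm : ContMDiffAt 𝓘(ℝ, E) I ∞ (extChartAt I x).symm z :=
    (contMDiffOn_extChartAt_symm (n := ∞) x).contMDiffAt
      ((isOpen_extChartAt_target x).mem_nhds hzt)
  set F : E → E' := fun z => f ((extChartAt I x).symm z) with hF
  have hFs : ContDiffAt ℝ ∞ F z := by
    rw [← contMDiffAt_iff_contDiffAt]
    refine ContMDiffAt.comp (I' := I) z ?_ hsymm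
    rw [hzx]; exact hf.contMDiffAt
  have key : ∀ U : N → E, (fun y => fderiv ℝ F y (chartField I x U y)) =ᶠ[𝓝 z]
      fun y => (fun y => tderiv I 𝓘(ℝ, E') f y (U y)) ((extChartAt I x).symm y) := by
    intro U
    have h1 : ∀ᶠ y in 𝓝 z, ContMDiffAt I 𝓘(ℝ, E') ∞ f ((extChartAt I x).symm y) := by
      have := hsymm.continuousAt
      rw [ContinuousAt, hzx] at this
      exact this.eventually hf
    filter_upwards [(isOpen_extChartAt_target x).mem_nhds hzt, h1] with y hy h2
    exact fderiv_chartField hy (h2.mdifferentiableAt (by simp)) U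
  have hF2 : ContDiffAt ℝ 2 F z := hFs.of_le (by norm_cast)
  have h1 := VectorField.fderiv_apply_lieBracket_of_isSymmSndFDerivAt hF2
    (hF2.isSymmSndFDerivAt (by simp)) (differentiableAt_chartField hW)
    (differentiableAt_chartField hV)
  have h2 : ∀ U U' : N → E, SmoothField I U x →
      fderiv ℝ (fun y => fderiv ℝ F y (chartField I x U y)) z (chartField I x U' z) =
      tderiv I 𝓘(ℝ, E') (fun y => tderiv I 𝓘(ℝ, E') f y (U y)) x (U' x) := by
    intro U U' hU
    have h3 : SmoothNear I 𝓘(ℝ, E') (fun y => tderiv I 𝓘(ℝ, E') f y (U y)) x := hU.deriv hf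
    have h4 := fderiv_chartField (f := fun y => tderiv I 𝓘(ℝ, E') f y (U y)) hzt
      (by rw [hzx]; exact h3.mdifferentiableAt) U'
    rw [hzx] at h4
    rw [(key U).fderiv_eq, ← h4]
  rw [h2 W V hW, h2 V W hV] at h1
  rw [← h1, fieldBracket_eq_chartField, fderiv_comp_extChartAt_symm hzt
    (by rw [hzx]; exact hf.mdifferentiableAt), hzx]

/-- The bracket within `s` of fields tangent to `s` is the bracket of any extensions. -/
theorem mlieBracketWithin_eq_fieldBracket {V W V' W' : N → E} {s : Set N} {x : N}
    (hV : SmoothField I V' x) (hW : SmoothField I W' x)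
    (hVV : ∀ᶠ y in 𝓝 x, y ∈ s → V y = V' y) (hWW : ∀ᶠ y in 𝓝 x, y ∈ s → W y = W' y)
    (tV : TangentTo I s x (V' x)) (tW : TangentTo I s x (W' x)) :
    (VectorField.mlieBracketWithin I (M := N) (fun y => (V y : TangentSpace I y))
      (fun y => W y) s x : E) = fieldBracket I V' W' x := by
  have hx := tV.mem
  have e : (VectorField.mlieBracketWithin I (M := N) (fun y => (V y : TangentSpace I y))
      (fun y => W y) s x : E) = (VectorField.mlieBracketWithin I (M := N)
      (fun y => (V' y : TangentSpace I y)) (fun y => W' y) s x : E) :=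
    Filter.EventuallyEq.mlieBracketWithin_vectorField_eq_of_mem (eventually_nhdsWithin_iff.2 hVV)
      (eventually_nhdsWithin_iff.2 hWW) hx
  rw [e, mlieBracketWithin_eq_chartField, fieldBracket_eq_chartField]
  congr 1
  set z := extChartAt I x x with hz
  have hzt : z ∈ (extChartAt I x).target := mem_extChartAt_target x
  have hzx : (extChartAt I x).symm z = x := extChartAt_to_inv x
  have key : ∀ U U' : N → E, SmoothField I U x → TangentTo I s x (U' x) →
      fderivWithin ℝ (chartField I x U) ((extChartAt I x).symm ⁻¹' s) z (chartField I x U' z) =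
      fderiv ℝ (chartField I x U) z (chartField I x U' z) := by
    intro U U' hU hU'
    have hd := differentiableAt_chartField hU
    obtain ⟨φ, h1, h2, h3, h4⟩ := hU'
    let ψ : E → E := fun y => extChartAt I x (φ ((extChartAt I x).symm y))
    have hψ0 : ψ z = z := by simp only [ψ]; rw [hzx, h2]
    have hc1 : MDifferentiableAt I 𝓘(ℝ, E) (extChartAt I x) x :=
      (contMDiffAt_extChartAt (n := ∞)).mdifferentiableAt (by simp)
    have hc2 : MDifferentiableAt I 𝓘(ℝ, E) (fun y => extChartAt I x (φ y)) x :=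
      MDifferentiableAt.comp (g := extChartAt I x) x (by rw [h2]; exact hc1) h1
    have hψd : MDifferentiableAt 𝓘(ℝ, E) 𝓘(ℝ, E) ψ z :=
      MDifferentiableAt.comp (g := fun y => extChartAt I x (φ y)) z (by rw [hzx]; exact hc2)
        (mdifferentiableAt_extChartAt_symm' hzt)
    have hψd' : HasFDerivAt ψ (fderiv ℝ ψ z) z := hψd.differentiableAt.hasFDerivAt
    have hψv : fderiv ℝ ψ z (chartField I x U' z) = chartField I x U' z := by
      have e1 := fderiv_chartField (f := fun y => extChartAt I x (φ y)) hzt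
        (by rw [hzx]; exact hc2) U'
      have e2 := fderiv_chartField (f := extChartAt I x) hzt
        (by rw [hzx]; exact hc1) U'
      have e3 : fderiv ℝ (fun y => extChartAt I x ((extChartAt I x).symm y)) z =
          ContinuousLinearMap.id ℝ E := by
        rw [Filter.EventuallyEq.fderiv_eq (f := fun y => y), fderiv_fun_id]
        filter_upwards [(isOpen_extChartAt_target x).mem_nhds hzt] with y hy
        exact (extChartAt I x).right_inv hy
      rw [hzx] at e1 e2
      rw [tderiv_comp_of_eq (y := x) hc1 h1 h2, h4, ← e2, e3] at e1
      exact e1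
    have hψs : ∀ᶠ y in 𝓝 z, ψ y ∈ (extChartAt I x).symm ⁻¹' s := by
      have hcont : ContinuousAt (extChartAt I x).symm z := continuousAt_extChartAt_symm x
      have hcφ : ContinuousAt φ x := h1.continuousAt
      rw [ContinuousAt, hzx] at hcont
      rw [ContinuousAt, h2] at hcφ
      filter_upwards [hcont.eventually h3,
        hcont.eventually (hcφ.eventually (extChartAt_source_mem_nhds (I := I) x))] with y h5 h6
      simp only [ψ, mem_preimage]
      rwa [(extChartAt I x).left_inv h6]
    have hcomp := HasFDerivWithinAt.comp_hasFDerivAt z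
      (by rw [hψ0]; exact hd.differentiableWithinAt.hasFDerivWithinAt) hψd' hψs
    have hcomp' := HasFDerivAt.comp z (by rw [hψ0]; exact hd.hasFDerivAt) hψd'
    have := congrArg (fun L : E →L[ℝ] E => L (chartField I x U' z)) (hcomp.unique hcomp')
    simp only [ContinuousLinearMap.comp_apply] at this
    rwa [hψv] at this
  rw [VectorField.lieBracketWithin_eq, VectorField.lieBracket_eq]
  change _ - _ = _ - _
  rw [key W' V' hW tV, key V' W' hV tW]

theorem SmoothField.bracket {V W : N → E} {x : N} (hV : SmoothField I V x)
    (hW : SmoothField I W x) : SmoothField I (fieldBracket I V W) x := by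
  filter_upwards [hV, hW] with y h1 h2
  have : IsManifold I (minSmoothness ℝ 2) N := by
    simp only [minSmoothness_of_isRCLikeNormedField]
    exact IsManifold.of_le (n := ∞) (by norm_cast)
  have : IsManifold I (((⊤ : ℕ∞) : WithTop ℕ∞) + 1) N := by
    simpa using (inferInstance : IsManifold I ∞ N)
  exact ContMDiffAt.mlieBracket_vectorField (n := ⊤) (m := ⊤) h1 h2 (by simp)

/-- Brackets of fields that are related along a set to which they are tangent are related. -/
theorem fieldBracket_of_related [I'.Boundaryless] [CompleteSpace E'] {f : N → N'} {V W : N → E}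
    {V' W' : N' → E'} {s : Set N} {x : N} (hf : SmoothNear I I' f x)
    (hV : SmoothField I V x) (hW : SmoothField I W x)
    (hV' : SmoothField I' V' (f x)) (hW' : SmoothField I' W' (f x))
    (tV : TangentTo I s x (V x)) (tW : TangentTo I s x (W x))
    (rV : ∀ᶠ y in 𝓝 x, y ∈ s → tderiv I I' f y (V y) = V' (f y))
    (rW : ∀ᶠ y in 𝓝 x, y ∈ s → tderiv I I' f y (W y) = W' (f y)) :
    tderiv I I' f x (fieldBracket I V W x) = fieldBracket I' V' W' (f x) := by
  apply tderiv_extChartAt_injective (I := I') (f x)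
  set φ := extChartAt I' (f x)
  have hφ : SmoothNear I' 𝓘(ℝ, E') φ (f x) :=
    smoothNear_extChartAt (f x) (mem_chart_source H' (f x))
  have hφf : SmoothNear I 𝓘(ℝ, E') (fun y => φ (f y)) x := hφ.comp hf
  rw [← tderiv_comp hφ.mdifferentiableAt hf.mdifferentiableAt,
    tderiv_fieldBracket hφf hV hW, tderiv_fieldBracket hφ hV' hW']
  have key : ∀ (U Z : N → E) (U' Z' : N' → E'), SmoothField I U x → SmoothField I' U' (f x) →
      TangentTo I s x (Z x) → tderiv I I' f x (Z x) = Z' (f x) →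
      (∀ᶠ y in 𝓝 x, y ∈ s → tderiv I I' f y (U y) = U' (f y)) →
      tderiv I 𝓘(ℝ, E') (fun y => tderiv I 𝓘(ℝ, E') (fun y => φ (f y)) y (U y)) x (Z x) =
      tderiv I' 𝓘(ℝ, E') (fun y => tderiv I' 𝓘(ℝ, E') φ y (U' y)) (f x) (Z' (f x)) := by
    intro U Z U' Z' hU hU' tZ hZ rU
    have h1 : SmoothNear I' 𝓘(ℝ, E') (fun y => tderiv I' 𝓘(ℝ, E') φ y (U' y)) (f x) := hU'.deriv hφ
    have h2 : SmoothNear I 𝓘(ℝ, E')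
      (fun y => tderiv I 𝓘(ℝ, E') (fun y => φ (f y)) y (U y)) x := hU.deriv hφf
    rw [← hZ, ← tderiv_comp h1.mdifferentiableAt hf.mdifferentiableAt]
    refine tZ.tderiv_eq h2.mdifferentiableAt (h1.comp hf).mdifferentiableAt ?_
    filter_upwards [rU, hf, hf.continuousAt.eventually hφ] with y h3 h4 h5 hy
    rw [tderiv_comp (h5.mdifferentiableAt (by simp)) (h4.mdifferentiableAt (by simp)), h3 hy]
  rw [key W V W' V' hW hW' tV (rV.self_of_nhds tV.mem) rW,
    key V W V' W' hV hV' tW (rW.self_of_nhds tV.mem) rV]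

end Chart
end Bracket

section InverseFunction

variable {E H N E' H' N' : Type*}
  [NormedAddCommGroup E] [NormedSpace ℝ E] [TopologicalSpace H] {I : ModelWithCorners ℝ E H}
  [TopologicalSpace N] [ChartedSpace H N]
  [NormedAddCommGroup E'] [NormedSpace ℝ E'] [TopologicalSpace H'] {I' : ModelWithCorners ℝ E' H'}
  [TopologicalSpace N'] [ChartedSpace H' N']
  [IsManifold I ∞ N] [IsManifold I' ∞ N'] [I.Boundaryless] [I'.Boundaryless]

theorem smoothNear_extChartAt_symm (x : N) {z : E} (hz : z ∈ (extChartAt I x).target) :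
    SmoothNear 𝓘(ℝ, E) I (extChartAt I x).symm z :=
  (contMDiffOn_extChartAt_symm (n := ∞) x).smoothNear ((isOpen_extChartAt_target x).mem_nhds hz)

theorem isInvertible_tderiv_extChartAt (x : N) :
    (tderiv I 𝓘(ℝ, E) (extChartAt I x) x).IsInvertible :=
  isInvertible_mfderiv_extChartAt (I := I) (mem_extChartAt_source x)

theorem SmoothNear.exists_inverse_space [CompleteSpace E] {f : E → E'} {x : E}
    (hf : SmoothNear 𝓘(ℝ, E) 𝓘(ℝ, E') f x) (hi : (fderiv ℝ f x).IsInvertible) :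
    ∃ g : E' → E, SmoothNear 𝓘(ℝ, E') 𝓘(ℝ, E) g (f x) ∧ (∀ᶠ y in 𝓝 x, g (f y) = y) ∧
      ∀ᶠ z in 𝓝 (f x), f (g z) = z := by
  obtain ⟨A, hA⟩ := hi
  have h0 : ContDiffAt ℝ ∞ f x := hf.contMDiffAt.contDiffAt
  have hd : HasFDerivAt f (A : E →L[ℝ] E') x := by
    rw [hA]; exact (h0.differentiableAt (by simp)).hasFDerivAt
  set h := h0.toOpenPartialHomeomorph f hd (by simp) with hh
  have hco : (h : E → E') = f := h0.toOpenPartialHomeomorph_coe hd (by simp)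
  have hxs : x ∈ h.source := h0.mem_toOpenPartialHomeomorph_source hd (by simp)
  have hfx : f x ∈ h.target := by rw [← hco]; exact h.map_source hxs
  have hsx : h.symm (f x) = x := by rw [← hco]; exact h.left_inv hxs
  refine ⟨h.symm, ?_, ?_, ?_⟩
  · have hc : ContinuousAt h.symm (f x) := h.continuousAt_symm hfx
    rw [ContinuousAt, hsx] at hc
    have h1 : ContinuousAt (fderiv ℝ f) x := by
      have h2 : ContDiffAt ℝ 1 f x := h0.of_le (by norm_cast)
      exact (h2.fderiv_right (m := 0) (by simp)).continuousAt
    have h2 : ∀ᶠ y in 𝓝 x, (fderiv ℝ f y).IsInvertible :=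
      h1.eventually (ContinuousLinearEquiv.isOpen.mem_nhds ⟨A, hA⟩)
    filter_upwards [h.open_target.mem_nhds hfx, hc.eventually hf, hc.eventually h2] with z h3 h4 h5
    obtain ⟨A', hA'⟩ := h5
    refine (h.contDiffAt_symm (f₀' := A') h3 ?_ ?_).contMDiffAt
    · rw [hA', hco]
      exact (h4.contDiffAt.differentiableAt (by simp)).hasFDerivAt
    · rw [hco]; exact h4.contDiffAt
  · filter_upwards [h.open_source.mem_nhds hxs] with y hy
    rw [← hco]; exact h.left_inv hy
  · filter_upwards [h.open_target.mem_nhds hfx] with z hz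
    have := h.right_inv hz
    rwa [hco] at this

theorem SmoothNear.exists_inverse [CompleteSpace E] {f : N → N'} {x : N}
    (hf : SmoothNear I I' f x) (hi : (tderiv I I' f x).IsInvertible) :
    ∃ g : N' → N, SmoothNear I' I g (f x) ∧ (∀ᶠ y in 𝓝 x, g (f y) = y) ∧
      ∀ᶠ z in 𝓝 (f x), f (g z) = z := by
  set φ := extChartAt I x with hφ
  set φ' := extChartAt I' (f x) with hφ'
  set z := φ x with hz
  have hzt : z ∈ φ.target := mem_extChartAt_target x
  have hzx : φ.symm z = x := extChartAt_to_inv x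
  have sφ : SmoothNear I 𝓘(ℝ, E) φ x := smoothNear_extChartAt x (mem_chart_source H x)
  have sφ' : SmoothNear I' 𝓘(ℝ, E') φ' (f x) := smoothNear_extChartAt (f x) (mem_chart_source H' (f x))
  have s1 : SmoothNear I 𝓘(ℝ, E') (fun y => φ' (f y)) x := sφ'.comp hf
  have s2 : SmoothNear 𝓘(ℝ, E) 𝓘(ℝ, E') (fun y => φ' (f (φ.symm y))) z :=
    s1.comp_of_eq (smoothNear_extChartAt_symm x hzt) hzx
  have hd : fderiv ℝ (fun y => φ' (f (φ.symm y))) z = (tderiv I' 𝓘(ℝ, E') φ' (f x)).comp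
      ((tderiv I I' f x).comp (chartSymmDeriv I x z)) := by
    ext w
    have h1 := fderiv_comp_extChartAt_symm (f := fun y => φ' (f y)) hzt
      (by rw [← hφ, hzx]; exact s1.mdifferentiableAt) w
    rw [← hφ, hzx, tderiv_comp sφ'.mdifferentiableAt hf.mdifferentiableAt] at h1
    exact h1
  have hinv : (fderiv ℝ (fun y => φ' (f (φ.symm y))) z).IsInvertible := by
    rw [hd]
    exact (isInvertible_tderiv_extChartAt (f x)).comp (hi.comp (isInvertible_chartSymmDeriv hzt))
  obtain ⟨g, h1, h2, h3⟩ := s2.exists_inverse_space hinv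
  have e1 : φ' (f (φ.symm z)) = φ' (f x) := by rw [hzx]
  rw [e1] at h1 h3
  have egz : g (φ' (f x)) = z := by have := h2.self_of_nhds; rwa [e1] at this
  have s3 : SmoothNear I' 𝓘(ℝ, E) (fun y => g (φ' y)) (f x) := h1.comp sφ'
  have s4 : SmoothNear I' I (fun y => φ.symm (g (φ' y))) (f x) :=
    (smoothNear_extChartAt_symm x hzt).comp_of_eq s3 egz
  refine ⟨fun y => φ.symm (g (φ' y)), s4, ?_, ?_⟩
  · have hc : ContinuousAt φ x := sφ.continuousAt
    filter_upwards [hc.eventually h2, extChartAt_source_mem_nhds (I := I) x] with y h4 h5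
    rw [φ.left_inv h5] at h4
    rw [h4, φ.left_inv h5]
  · have hc : ContinuousAt φ' (f x) := sφ'.continuousAt
    have hs : ContinuousAt (fun y => f (φ.symm (g (φ' y)))) (f x) := by
      refine (hf.comp_of_eq s4 ?_).continuousAt
      rw [egz, hzx]
    have hs' := hs.eventually_mem (s := φ'.source) (by
      rw [egz, hzx]; exact extChartAt_source_mem_nhds (I := I') (f x))
    filter_upwards [hc.eventually h3, extChartAt_source_mem_nhds (I := I') (f x), hs']
      with y h4 h5 h6
    exact φ'.injOn h6 h5 h4

/-- The inverse function theorem. -/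
theorem SmoothNear.isLocalDiffeomorphAt [CompleteSpace E] {f : N → N'} {x : N}
    (hf : SmoothNear I I' f x) (hi : (tderiv I I' f x).IsInvertible) :
    IsLocalDiffeomorphAt I I' ∞ f x := by
  obtain ⟨g, h1, h2, h3⟩ := hf.exists_inverse hi
  obtain ⟨A, hA, hAo, hxA⟩ := eventually_nhds_iff.1 (hf.and h2)
  obtain ⟨B, hB, hBo, hxB⟩ := eventually_nhds_iff.1 (h1.and h3)
  have fA : ContMDiffOn I I' ∞ f A := fun y hy => (hA y hy).1.contMDiffWithinAt
  have gB : ContMDiffOn I' I ∞ g B := fun y hy => (hB y hy).1.contMDiffWithinAt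
  refine ⟨{ toFun := f, invFun := g, source := A ∩ f ⁻¹' B, target := B ∩ g ⁻¹' A,
            map_source' := ?_, map_target' := ?_, left_inv' := ?_, right_inv' := ?_,
            open_source := fA.continuousOn.isOpen_inter_preimage hAo hBo
            open_target := gB.continuousOn.isOpen_inter_preimage hBo hAo
            contMDiffOn_toFun := fA.mono inter_subset_left
            contMDiffOn_invFun := gB.mono inter_subset_left }, ⟨hxA, hxB⟩, fun _ _ => rfl⟩
  · rintro y ⟨hy, hy'⟩
    exact ⟨hy', by rw [mem_preimage, (hA y hy).2]; exact hy⟩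
  · rintro y ⟨hy, hy'⟩
    exact ⟨hy', by rw [mem_preimage, (hB y hy).2]; exact hy⟩
  · rintro y ⟨hy, -⟩
    exact (hA y hy).2
  · rintro y ⟨hy, -⟩
    exact (hB y hy).2

/-- Near a point where `pr` is submersive one can move smoothly to any nearby fibre. -/
theorem SmoothNear.exists_fibre_map [FiniteDimensional ℝ E] [FiniteDimensional ℝ E'] {pr : N → N'}
    {a : N} (hpr : SmoothNear I I' pr a) (hs : Function.Surjective (tderiv I I' pr a)) :
    ∃ ψ : N × N' → N, SmoothNear (I.prod I') I ψ (a, pr a) ∧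
      (∀ᶠ p in 𝓝 (a, pr a), pr (ψ p) = p.2) ∧ ∀ᶠ b in 𝓝 a, ψ (b, pr b) = b := by
  set φ := extChartAt I a with hφ
  set χ := extChartAt I' (pr a) with hχ
  have sφ : SmoothNear I 𝓘(ℝ, E) φ a := smoothNear_extChartAt a (mem_chart_source H a)
  have sχ : SmoothNear I' 𝓘(ℝ, E') χ (pr a) := smoothNear_extChartAt (pr a) (mem_chart_source H' (pr a))
  have sχpr : SmoothNear I 𝓘(ℝ, E') (fun b => χ (pr b)) a := sχ.comp hpr
  obtain ⟨A, hA⟩ := isInvertible_tderiv_extChartAt (I := I) a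
  obtain ⟨C, hC⟩ := isInvertible_tderiv_extChartAt (I := I') (pr a)
  set D := tderiv I 𝓘(ℝ, E') (fun b => χ (pr b)) a with hD
  have hDs : Function.Surjective D := by
    intro w
    obtain ⟨v, hv⟩ := hs (C.symm w)
    refine ⟨v, ?_⟩
    rw [hD, tderiv_comp sχ.mdifferentiableAt hpr.mdifferentiableAt, hv, ← hC]
    exact C.apply_symm_apply w
  set B : E →L[ℝ] E' := D.comp (A.symm : E →L[ℝ] E) with hB
  have hBs : Function.Surjective B := hDs.comp A.symm.surjective
  obtain ⟨r0, hr0⟩ := (B : E →ₗ[ℝ] E').exists_rightInverse_of_surjective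
    (LinearMap.range_eq_top.2 hBs)
  set r : E' →L[ℝ] E := r0.toContinuousLinearMap with hr
  have hBr : ∀ w, B (r w) = w := fun w => congrArg (fun L : E' →ₗ[ℝ] E' => L w) hr0
  let Φ : N → E := fun b => φ b - r (B (φ b)) + r (χ (pr b))
  have sΦ : SmoothNear I 𝓘(ℝ, E) Φ a := (sφ.sub ((sφ.clm B).clm r)).add (sχpr.clm r)
  have hBΦ : ∀ b, B (Φ b) = χ (pr b) := fun b => by simp [Φ, hBr]
  have hΦd : tderiv I 𝓘(ℝ, E) Φ a = A := by
    ext v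
    rw [tderiv_add (sφ.sub ((sφ.clm B).clm r)).mdifferentiableAt (sχpr.clm r).mdifferentiableAt,
      tderiv_sub sφ.mdifferentiableAt ((sφ.clm B).clm r).mdifferentiableAt,
      tderiv_clm r (sφ.clm B).mdifferentiableAt, tderiv_clm B sφ.mdifferentiableAt,
      tderiv_clm r sχpr.mdifferentiableAt, ← hD, ← hA, hB]
    simp
  obtain ⟨Ψ, h1, h2, h3⟩ := sΦ.exists_inverse (by rw [hΦd]; exact ⟨A, rfl⟩)
  let q : N × N' → E := fun p => Φ p.1 + r (χ p.2 - χ (pr p.1))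
  have sq : SmoothNear (I.prod I') 𝓘(ℝ, E) q (a, pr a) := by
    have i1 : SmoothNear (I.prod I') 𝓘(ℝ, E) (fun p : N × N' => Φ p.1) (a, pr a) :=
      sΦ.comp_of_eq (SmoothNear.fst _) rfl
    have i2 : SmoothNear (I.prod I') 𝓘(ℝ, E') (fun p : N × N' => χ p.2) (a, pr a) :=
      sχ.comp_of_eq (SmoothNear.snd _) rfl
    have i3 : SmoothNear (I.prod I') 𝓘(ℝ, E') (fun p : N × N' => χ (pr p.1)) (a, pr a) :=
      sχpr.comp_of_eq (SmoothNear.fst _) rfl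
    exact i1.add ((i2.sub i3).clm r)
  have q0 : q (a, pr a) = Φ a := by simp [q]
  have sψ : SmoothNear (I.prod I') I (fun p => Ψ (q p)) (a, pr a) := h1.comp_of_eq sq q0
  have hΨ : Ψ (Φ a) = a := h2.self_of_nhds
  refine ⟨fun p => Ψ (q p), sψ, ?_, ?_⟩
  · have hc := sq.continuousAt
    rw [ContinuousAt, q0] at hc
    have hc2 : ContinuousAt (fun p => pr (Ψ (q p))) (a, pr a) := by
      refine (hpr.comp_of_eq sψ ?_).continuousAt
      rw [q0, hΨ]
    have h4 := hc2.eventually_mem (s := χ.source) (by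
      rw [q0, hΨ]; exact extChartAt_source_mem_nhds (I := I') (pr a))
    have h5 : ∀ᶠ p : N × N' in 𝓝 (a, pr a), p.2 ∈ χ.source :=
      continuousAt_snd.eventually_mem (extChartAt_source_mem_nhds (I := I') (pr a))
    filter_upwards [hc.eventually h3, h4, h5] with p h6 h7 h8
    refine χ.injOn h7 h8 ?_
    rw [← hBΦ, h6]
    simp [q, hBΦ, hBr]
  · filter_upwards [h2] with b hb
    simpa [q] using hb

end InverseFunction

section FieldFamilies

variable {E H N E' H' N' E'' H'' N'' F F' : Type*}
  [NormedAddCommGroup E] [NormedSpace ℝ E] [TopologicalSpace H] {I : ModelWithCorners ℝ E H}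
  [TopologicalSpace N] [ChartedSpace H N]
  [NormedAddCommGroup E'] [NormedSpace ℝ E'] [TopologicalSpace H'] {I' : ModelWithCorners ℝ E' H'}
  [TopologicalSpace N'] [ChartedSpace H' N']
  [NormedAddCommGroup E''] [NormedSpace ℝ E''] [TopologicalSpace H'']
  {I'' : ModelWithCorners ℝ E'' H''} [TopologicalSpace N''] [ChartedSpace H'' N'']
  [IsManifold I ∞ N] [IsManifold I' ∞ N'] [IsManifold I'' ∞ N'']
  [I.Boundaryless] [I'.Boundaryless] [I''.Boundaryless]
  [NormedAddCommGroup F] [NormedSpace ℝ F] [FiniteDimensional ℝ F]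
  [NormedAddCommGroup F'] [NormedSpace ℝ F'] [FiniteDimensional ℝ F']

theorem SmoothAlong.congr {f g : N → N'} {V W : N → E'} {x : N} (h : SmoothAlong I I' f V x)
    (hfg : ∀ᶠ y in 𝓝 x, g y = f y ∧ W y = V y) : SmoothAlong I I' g W x := by
  refine SmoothNear.congr h ?_
  filter_upwards [hfg] with y hy
  rw [hy.1, hy.2]

theorem SmoothAlong.coord_chart {f : N → N'} {V : N → E'} {x : N} (h : SmoothAlong I I' f V x) :
    SmoothNear I 𝓘(ℝ, E') (fun y => tderiv I' 𝓘(ℝ, E') (extChartAt I' (f x)) (f y) (V y)) x :=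
  h.deriv (smoothNear_extChartAt (f x) (mem_chart_source H' (f x)))

theorem SmoothAlong.add {f : N → N'} {V W : N → E'} {x : N} (hV : SmoothAlong I I' f V x)
    (hW : SmoothAlong I I' f W x) : SmoothAlong I I' f (fun y => V y + W y) x := by
  refine SmoothAlong.of_coord hV.base ?_
  simp only [map_add]
  exact hV.coord_chart.add hW.coord_chart

theorem SmoothAlong.sub {f : N → N'} {V W : N → E'} {x : N} (hV : SmoothAlong I I' f V x)
    (hW : SmoothAlong I I' f W x) : SmoothAlong I I' f (fun y => V y - W y) x := by
  refine SmoothAlong.of_coord hV.base ?_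
  simp only [map_sub]
  exact hV.coord_chart.sub hW.coord_chart

theorem SmoothAlong.smul {f : N → N'} {V : N → E'} {c : N → ℝ} {x : N}
    (hc : SmoothNear I 𝓘(ℝ, ℝ) c x) (hV : SmoothAlong I I' f V x) :
    SmoothAlong I I' f (fun y => c y • V y) x := by
  refine SmoothAlong.of_coord hV.base ?_
  simp only [map_smul]
  exact hc.smul hV.coord_chart

theorem SmoothAlong.zero {f : N → N'} {x : N} (hf : SmoothNear I I' f x) :
    SmoothAlong I I' f (fun _ => 0) x := by
  refine SmoothAlong.of_coord hf ?_
  simp only [map_zero]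
  exact SmoothNear.const _ _

/-- `T` is a smooth family of vector fields near `x`. -/
def SmoothFamily (I : ModelWithCorners ℝ E H) [IsManifold I ∞ N] (T : N → F →L[ℝ] E) (x : N) :
    Prop := ∀ a, SmoothField I (fun y => T y a) x

theorem SmoothFamily.coord {T : N' → F →L[ℝ] E'} {x : N'} (hT : SmoothFamily I' T x) {f : N' → E''}
    (hf : SmoothNear I' 𝓘(ℝ, E'') f x) :
    SmoothNear I' 𝓘(ℝ, F →L[ℝ] E'') (fun y => (tderiv I' 𝓘(ℝ, E'') f y).comp (T y)) x :=
  SmoothNear.of_apply fun a => (hT a).deriv hf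

theorem SmoothFamily.apply {T : N' → F →L[ℝ] E'} {f : N → N'} {w : N → F} {x : N}
    (hT : SmoothFamily I' T (f x)) (hf : SmoothNear I I' f x) (hw : SmoothNear I 𝓘(ℝ, F) w x) :
    SmoothAlong I I' f (fun y => T (f y) (w y)) x :=
  SmoothAlong.of_coord hf
    (SmoothNear.clm_apply
      (L := fun y => (tderiv I' 𝓘(ℝ, E') (extChartAt I' (f x)) (f y)).comp (T (f y)))
      ((hT.coord (smoothNear_extChartAt (f x) (mem_chart_source H' (f x)))).comp hf) hw)

/-- The bracket of linear combinations of vector fields with smooth coefficients. -/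
theorem fieldBracket_families [CompleteSpace E] {T : N → F →L[ℝ] E} {T' : N → F' →L[ℝ] E}
    {w : N → F} {w' : N → F'} {x : N} (hT : SmoothFamily I T x) (hT' : SmoothFamily I T' x)
    (hw : SmoothNear I 𝓘(ℝ, F) w x) (hw' : SmoothNear I 𝓘(ℝ, F') w' x) :
    fieldBracket I (fun y => T y (w y)) (fun y => T' y (w' y)) x =
      fieldBracket I (fun y => T y (w x)) (fun y => T' y (w' x)) x +
      T' x (tderiv I 𝓘(ℝ, F') w' x (T x (w x))) - T x (tderiv I 𝓘(ℝ, F) w x (T' x (w' x))) := by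
  apply tderiv_extChartAt_injective (I := I) x
  set φ := extChartAt I x
  have hφ : SmoothNear I 𝓘(ℝ, E) φ x := smoothNear_extChartAt x (mem_chart_source H x)
  rw [map_sub, map_add, tderiv_fieldBracket hφ (hT.apply (SmoothNear.id x) hw)
    (hT'.apply (SmoothNear.id x) hw'), tderiv_fieldBracket hφ (hT _) (hT' _)]
  have h1 := (hT.coord hφ).mdifferentiableAt
  have h2 := (hT'.coord hφ).mdifferentiableAt
  have e1 := tderiv_clm_apply h1 hw.mdifferentiableAt (T' x (w' x))
  have e2 := tderiv_clm_apply h2 hw'.mdifferentiableAt (T x (w x))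
  have e3 := tderiv_clm_apply h1 (mdifferentiableAt_const (c := w x)) (T' x (w' x))
  have e4 := tderiv_clm_apply h2 (mdifferentiableAt_const (c := w' x)) (T x (w x))
  rw [tderiv_const] at e3 e4
  simp only [ContinuousLinearMap.comp_apply, zero_apply, map_zero,
    add_zero] at e1 e2 e3 e4
  rw [e1, e2, e3, e4]
  abel

/-- The bracket of product vector fields on a product. -/
theorem fieldBracket_prod [CompleteSpace E] [CompleteSpace E'] {V W : N → E} {V' W' : N' → E'}
    {p : N × N'} (hV : SmoothField I V p.1) (hW : SmoothField I W p.1) (hV' : SmoothField I' V' p.2)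
    (hW' : SmoothField I' W' p.2) :
    fieldBracket (I.prod I') (fun q : N × N' => (V q.1, V' q.2)) (fun q => (W q.1, W' q.2)) p =
      (fieldBracket I V W p.1, fieldBracket I' V' W' p.2) := by
  have s : ∀ (U : N → E) (U' : N' → E'), SmoothField I U p.1 → SmoothField I' U' p.2 →
      SmoothField (I.prod I') (fun q : N × N' => (U q.1, U' q.2)) p := fun U U' hU hU' =>
    SmoothAlong.prodMk (f := fun q : N × N' => q.1) (g := fun q : N × N' => q.2)
      (SmoothAlong.comp (k := fun q : N × N' => q.1) hU (SmoothNear.fst p))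
      (SmoothAlong.comp (k := fun q : N × N' => q.2) hU' (SmoothNear.snd p))
  have h1 := fieldBracket_of_related (s := univ) (SmoothNear.fst p) (s V V' hV hV')
    (s W W' hW hW') hV hW (TangentTo.univ _ _) (TangentTo.univ _ _)
    (Eventually.of_forall fun q _ => tderiv_fst q _)
    (Eventually.of_forall fun q _ => tderiv_fst q _)
  have h2 := fieldBracket_of_related (s := univ) (SmoothNear.snd p) (s V V' hV hV')
    (s W W' hW hW') hV' hW' (TangentTo.univ _ _) (TangentTo.univ _ _)
    (Eventually.of_forall fun q _ => tderiv_snd q _)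
    (Eventually.of_forall fun q _ => tderiv_snd q _)
  rw [tderiv_fst] at h1
  rw [tderiv_snd] at h2
  exact Prod.ext h1 h2

theorem SmoothFamily.prodField {T : N → F →L[ℝ] E} {v : N' → F} {U : N' → E'} {k : N} {p : N'}
    (hT : SmoothFamily I T k) (hv : SmoothNear I' 𝓘(ℝ, F) v p) (hU : SmoothField I' U p) :
    SmoothField (I.prod I') (fun q : N × N' => (T q.1 (v q.2), U q.2)) (k, p) :=
  SmoothAlong.prodMk (f := fun q : N × N' => q.1) (g := fun q : N × N' => q.2)
    (SmoothFamily.apply hT (SmoothNear.fst (k, p)) (hv.comp (SmoothNear.snd (k, p))))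
    (SmoothAlong.comp (k := fun q : N × N' => q.2) hU (SmoothNear.snd (k, p)))

/-- The bracket of the vector fields `(T v, U)` on a product, where `v` and `U` depend only on the
second variable. -/
theorem fieldBracket_prodField [CompleteSpace E] [CompleteSpace E'] {T : N → F →L[ℝ] E}
    {v v' : N' → F} {U U' : N' → E'} {k : N} {p : N'} (hT : SmoothFamily I T k)
    (hv : SmoothNear I' 𝓘(ℝ, F) v p) (hv' : SmoothNear I' 𝓘(ℝ, F) v' p)
    (hU : SmoothField I' U p) (hU' : SmoothField I' U' p) :
    fieldBracket (I.prod I') (fun q : N × N' => (T q.1 (v q.2), U q.2))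
      (fun q : N × N' => (T q.1 (v' q.2), U' q.2)) (k, p) =
    (fieldBracket I (fun y => T y (v p)) (fun y => T y (v' p)) k +
      T k (tderiv I' 𝓘(ℝ, F) v' p (U p) - tderiv I' 𝓘(ℝ, F) v p (U' p)),
      fieldBracket I' U U' p) := by
  let S : (N' → E') → N × N' → F × ℝ →L[ℝ] E × E' := fun Z q =>
    (T q.1).prodMap ((ContinuousLinearMap.id ℝ ℝ).smulRight (Z q.2))
  have hS : ∀ Z, SmoothField I' Z p → SmoothFamily (I.prod I') (S Z) (k, p) := fun Z hZ a =>
    SmoothAlong.prodMk (f := fun q : N × N' => q.1) (g := fun q : N × N' => q.2)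
      (SmoothFamily.apply hT (SmoothNear.fst (k, p)) (SmoothNear.const a.1 _))
      ((SmoothAlong.smul (SmoothNear.const a.2 _) hZ).comp
        (k := fun q : N × N' => q.2) (x := (k, p)) (SmoothNear.snd (k, p)))
  have hw : ∀ u : N' → F, SmoothNear I' 𝓘(ℝ, F) u p →
      SmoothNear (I.prod I') 𝓘(ℝ, F × ℝ) (fun q : N × N' => (u q.2, (1 : ℝ))) (k, p) :=
    fun u hu => (hu.comp (SmoothNear.snd (k, p))).prodMk_space (SmoothNear.const 1 _)
  have hd : ∀ (u : N' → F), SmoothNear I' 𝓘(ℝ, F) u p → ∀ (z : E × E'),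
      tderiv (I.prod I') 𝓘(ℝ, F × ℝ) (fun q : N × N' => (u q.2, (1 : ℝ))) (k, p) z =
      (tderiv I' 𝓘(ℝ, F) u p z.2, 0) := by
    intro u hu z
    have a1 := tderiv_clm (ContinuousLinearMap.fst ℝ F ℝ) (hw u hu).mdifferentiableAt z
    have a2 := tderiv_clm (ContinuousLinearMap.snd ℝ F ℝ) (hw u hu).mdifferentiableAt z
    simp only [ContinuousLinearMap.coe_fst', ContinuousLinearMap.coe_snd'] at a1 a2
    rw [tderiv_comp_of_eq (g := u) (y := p) hu.mdifferentiableAt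
      (SmoothNear.snd (I := I) (I' := I') (k, p)).mdifferentiableAt rfl, tderiv_snd] at a1
    rw [tderiv_const] at a2
    exact (Prod.ext a1 a2).symm
  have e := fieldBracket_families (hS U hU) (hS U' hU') (hw v hv) (hw v' hv')
  rw [hd v hv, hd v' hv'] at e
  have e2 := fieldBracket_prod (p := (k, p)) (hT (v p)) (hT (v' p)) hU hU'
  have hSapp : ∀ Z q a (t : ℝ), S Z q (a, t) = (T q.1 a, t • Z q.2) := fun Z q a t => rfl
  simp only [hSapp, one_smul, zero_smul] at e
  rw [e, e2]
  ext
  · simp only [Prod.fst_add, Prod.fst_sub, map_sub]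
    abel
  · simp

/-- Coefficients of a smooth vector field with respect to a smooth injective family. -/
theorem SmoothFamily.exists_coeff [FiniteDimensional ℝ E] {T : N → F →L[ℝ] E} {V : N → E} {x : N}
    (hT : SmoothFamily I T x) (hV : SmoothField I V x) (hi : Function.Injective (T x))
    (hr : ∀ᶠ y in 𝓝 x, ∃ a, T y a = V y) :
    ∃ w : N → F, SmoothNear I 𝓘(ℝ, F) w x ∧ ∀ᶠ y in 𝓝 x, T y (w y) = V y := by
  set φ := extChartAt I x
  have hφ : SmoothNear I 𝓘(ℝ, E) φ x := smoothNear_extChartAt x (mem_chart_source H x)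
  set S : N → F →L[ℝ] E := fun y => (tderiv I 𝓘(ℝ, E) φ y).comp (T y) with hS
  have sS : SmoothNear I 𝓘(ℝ, F →L[ℝ] E) S x := hT.coord hφ
  have iS : Function.Injective (S x) := (tderiv_extChartAt_injective (I := I) x).comp hi
  obtain ⟨K, hK⟩ : ∃ K : E →L[ℝ] F, K.comp (S x) = ContinuousLinearMap.id ℝ F := by
    obtain ⟨K, hK⟩ := LinearMap.exists_leftInverse_of_injective (S x : F →ₗ[ℝ] E)
      (LinearMap.ker_eq_bot.2 iS)
    exact ⟨K.toContinuousLinearMap, ContinuousLinearMap.ext fun a =>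
      congrArg (fun A : F →ₗ[ℝ] F => A a) hK⟩
  have sKS : SmoothNear I 𝓘(ℝ, F →L[ℝ] F) (fun y => K.comp (S y)) x :=
    SmoothNear.of_apply fun a => (sS.clm_apply (SmoothNear.const a x)).clm K
  have iKS : (K.comp (S x)).IsInvertible := by
    rw [hK]; exact ⟨ContinuousLinearEquiv.refl ℝ F, rfl⟩
  have hev : ∀ᶠ y in 𝓝 x, (K.comp (S y)).IsInvertible :=
    sKS.continuousAt.eventually (ContinuousLinearEquiv.isOpen.mem_nhds iKS)
  refine ⟨fun y => (K.comp (S y)).inverse (K (tderiv I 𝓘(ℝ, E) φ y (V y))),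
    (sKS.clm_inverse iKS).clm_apply ((hV.deriv hφ).clm K), ?_⟩
  filter_upwards [hev, hr] with y h1 ⟨a, ha⟩
  have : K (tderiv I 𝓘(ℝ, E) φ y (V y)) = (K.comp (S y)) a := by rw [← ha]; rfl
  rw [this, h1.inverse_apply_self, ha]

theorem exists_bump [FiniteDimensional ℝ E] [T2Space N] {x : N} {O : Set N} (hO : O ∈ 𝓝 x) :
    ∃ χ : N → ℝ, ContMDiff I 𝓘(ℝ, ℝ) ∞ χ ∧ (∀ᶠ y in 𝓝 x, χ y = 1) ∧ tsupport χ ⊆ O := by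
  obtain ⟨f, -, hf⟩ := (SmoothBumpFunction.nhds_basis_tsupport (I := I) x).mem_iff.1 hO
  exact ⟨f, f.contMDiff, f.eventuallyEq_one, hf⟩

end FieldFamilies

section Tangency

variable {E H N E' H' N' E'' H'' N'' : Type*}
  [NormedAddCommGroup E] [NormedSpace ℝ E] [TopologicalSpace H] {I : ModelWithCorners ℝ E H}
  [TopologicalSpace N] [ChartedSpace H N]
  [NormedAddCommGroup E'] [NormedSpace ℝ E'] [TopologicalSpace H'] {I' : ModelWithCorners ℝ E' H'}
  [TopologicalSpace N'] [ChartedSpace H' N']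
  [NormedAddCommGroup E''] [NormedSpace ℝ E''] [TopologicalSpace H'']
  {I'' : ModelWithCorners ℝ E'' H''} [TopologicalSpace N''] [ChartedSpace H'' N'']
  [IsManifold I ∞ N] [IsManifold I' ∞ N'] [IsManifold I'' ∞ N'']
  [I.Boundaryless] [I'.Boundaryless] [I''.Boundaryless]
  [FiniteDimensional ℝ E] [FiniteDimensional ℝ E'] [FiniteDimensional ℝ E'']

/-- Vectors tangent to a set over which the second variable moves in the fibres of a submersion. -/
theorem TangentTo.graph {s : Set N} {pr : N' → N''} {j : N → N''} {a : N} {b : N'} {u : E} {v : E'}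
    (hu : TangentTo I s a u) (hpr : SmoothNear I' I'' pr b)
    (hs : Function.Surjective (tderiv I' I'' pr b)) (hj : MDifferentiableAt I I'' j a)
    (hab : pr b = j a) (huv : tderiv I' I'' pr b v = tderiv I I'' j a u) :
    TangentTo (I.prod I') {p : N × N' | p.1 ∈ s ∧ pr p.2 = j p.1} (a, b) (u, v) := by
  obtain ⟨φ, h1, h2, h3, h4⟩ := hu
  obtain ⟨ψ, k1, k2, k3⟩ := hpr.exists_fibre_map hs
  have hφ : MDifferentiableAt (I.prod I') I (fun p : N × N' => φ p.1) (a, b) :=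
    MDifferentiableAt.comp (g := φ) (f := Prod.fst) (a, b) h1 mdifferentiableAt_fst
  have hq : MDifferentiableAt (I.prod I') (I'.prod I'') (fun p : N × N' => (p.2, j (φ p.1)))
      (a, b) :=
    mdifferentiableAt_snd.prodMk
      (MDifferentiableAt.comp_of_eq (g := j) (f := fun p : N × N' => φ p.1) _ hj hφ h2)
  have hqv : ((b, j (φ a)) : N' × N'') = (b, pr b) := by rw [h2, hab]
  have hj' : MDifferentiableAt (I.prod I') I'' (fun p : N × N' => j (φ p.1)) (a, b) :=
    MDifferentiableAt.comp_of_eq (g := j) (f := fun p : N × N' => φ p.1) _ hj hφ h2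
  have hψ := k1.mdifferentiableAt
  have hψ' : MDifferentiableAt (I.prod I') I' (fun p : N × N' => ψ (p.2, j (φ p.1))) (a, b) :=
    MDifferentiableAt.comp_of_eq (g := ψ) _ hψ hq hqv
  refine ⟨fun p => (φ p.1, ψ (p.2, j (φ p.1))), hφ.prodMk hψ', ?_, ?_, ?_⟩
  · simp only [h2, ← hab, k3.self_of_nhds]
  · have c1 : ∀ᶠ p : N × N' in 𝓝 (a, b), φ p.1 ∈ s :=
      (continuousAt_fst (p := (a, b))).eventually h3
    have c2 := hq.continuousAt
    rw [ContinuousAt, hqv] at c2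
    filter_upwards [c1, c2.eventually k2] with p h5 h6 using ⟨h5, h6⟩
  · rw [tderiv_prodMk hφ hψ', tderiv_comp_of_eq hψ hq hqv,
      tderiv_comp_of_eq (g := φ) h1 (SmoothNear.fst (a, b)).mdifferentiableAt rfl, tderiv_fst, h4,
      tderiv_prodMk (SmoothNear.snd (a, b)).mdifferentiableAt hj',
      tderiv_snd, tderiv_comp_of_eq (g := j) hj hφ h2,
      tderiv_comp_of_eq (g := φ) h1 (SmoothNear.fst (a, b)).mdifferentiableAt rfl, tderiv_fst, h4,
      ← huv]
    have e := tderiv_congr (I := I') (I' := I') k3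
    have e2 := congrArg (fun A : E' →L[ℝ] E' => A v) e
    simp only [tderiv_id] at e2
    rw [tderiv_comp_of_eq (y := (b, pr b)) hψ
      ((SmoothNear.id b).mdifferentiableAt.prodMk hpr.mdifferentiableAt) rfl,
      tderiv_prodMk (SmoothNear.id b).mdifferentiableAt hpr.mdifferentiableAt, tderiv_id] at e2
    exact Prod.ext rfl e2

/-- The kernel of a submersion is tangent to its fibres. -/
theorem TangentTo.fibre {pr : N' → N''} {c : N''} {b : N'} {v : E'}
    (hpr : SmoothNear I' I'' pr b) (hs : Function.Surjective (tderiv I' I'' pr b))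
    (hb : pr b = c) (hv : tderiv I' I'' pr b v = 0) : TangentTo I' (pr ⁻¹' {c}) b v := by
  obtain ⟨ψ, k1, k2, k3⟩ := hpr.exists_fibre_map hs
  subst hb
  have hq : MDifferentiableAt I' (I'.prod I'') (fun y : N' => (y, pr b)) b :=
    (SmoothNear.id b).mdifferentiableAt.prodMk mdifferentiableAt_const
  refine ⟨fun y => ψ (y, pr b), k1.mdifferentiableAt.comp_of_eq (f := fun y : N' => (y, pr b)) _ hq rfl,
    k3.self_of_nhds, hq.continuousAt.eventually k2, ?_⟩
  have e2 := congrArg (fun A : E' →L[ℝ] E' => A v) (tderiv_congr (I := I') (I' := I') k3)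
  simp only [tderiv_id] at e2
  rw [tderiv_comp_of_eq (y := (b, pr b)) k1.mdifferentiableAt
    ((SmoothNear.id b).mdifferentiableAt.prodMk hpr.mdifferentiableAt) rfl,
    tderiv_prodMk (SmoothNear.id b).mdifferentiableAt hpr.mdifferentiableAt, tderiv_id, hv] at e2
  rw [tderiv_comp_of_eq (y := (b, pr b)) k1.mdifferentiableAt hq rfl,
    tderiv_prodMk (SmoothNear.id b).mdifferentiableAt mdifferentiableAt_const, tderiv_id,
    tderiv_const]
  exact e2

theorem TangentTo.mono {s t : Set N} {x : N} {v : E} (h : TangentTo I s x v) (hst : s ⊆ t) :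
    TangentTo I t x v := by
  obtain ⟨φ, h1, h2, h3, h4⟩ := h
  exact ⟨φ, h1, h2, h3.mono fun y hy => hst hy, h4⟩

end Tangency

namespace LieGroupoid

variable {EG EM G M : Type*} [NormedAddCommGroup EG] [NormedSpace ℝ EG]
  [NormedAddCommGroup EM] [NormedSpace ℝ EM] [TopologicalSpace G] [ChartedSpace EG G]
  [TopologicalSpace M] [ChartedSpace EM M] [FiniteDimensional ℝ EG] [FiniteDimensional ℝ EM]
  [IsManifold 𝓘(ℝ, EG) ∞ G] [IsManifold 𝓘(ℝ, EM) ∞ M] (𝒢 : LieGroupoid EG EM G M)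

/-- The differential of the source map. -/
def srcD (g : G) : EG →L[ℝ] EM := tderiv 𝓘(ℝ, EG) 𝓘(ℝ, EM) 𝒢.src g

/-- The differential of the target map. -/
def tgtD (g : G) : EG →L[ℝ] EM := tderiv 𝓘(ℝ, EG) 𝓘(ℝ, EM) 𝒢.tgt g

/-- The differential of the inversion. -/
def invD (g : G) : EG →L[ℝ] EG := tderiv 𝓘(ℝ, EG) 𝓘(ℝ, EG) 𝒢.inv g

theorem smoothNear_src (g : G) : SmoothNear 𝓘(ℝ, EG) 𝓘(ℝ, EM) 𝒢.src g := 𝒢.contMDiff_src.smoothNear g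
theorem smoothNear_tgt (g : G) : SmoothNear 𝓘(ℝ, EG) 𝓘(ℝ, EM) 𝒢.tgt g := 𝒢.contMDiff_tgt.smoothNear g
theorem smoothNear_inv (g : G) : SmoothNear 𝓘(ℝ, EG) 𝓘(ℝ, EG) 𝒢.inv g := 𝒢.contMDiff_inv.smoothNear g
theorem smoothNear_unit (x : M) : SmoothNear 𝓘(ℝ, EM) 𝓘(ℝ, EG) 𝒢.unit x :=
  𝒢.contMDiff_unit.smoothNear x
theorem surjective_srcD (g : G) : Function.Surjective (𝒢.srcD g) := 𝒢.surjective_mfderiv_src g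
theorem surjective_tgtD (g : G) : Function.Surjective (𝒢.tgtD g) := 𝒢.surjective_mfderiv_tgt g

section Algebra

theorem inv_eq_of_mul {a b : G} (h : 𝒢.tgt a = 𝒢.src b) (e : 𝒢.mul a b = 𝒢.unit (𝒢.src a)) :
    𝒢.inv a = b := by
  have h1 : 𝒢.mul (𝒢.inv a) (𝒢.mul a b) = b := by
    rw [𝒢.assoc _ _ _ (𝒢.tgt_inv a) h, 𝒢.inv_left, h, 𝒢.unit_left]
  rw [← h1, e, ← 𝒢.tgt_inv a, 𝒢.unit_right]

theorem inv_inv (g : G) : 𝒢.inv (𝒢.inv g) = g :=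
  𝒢.inv_eq_of_mul (𝒢.tgt_inv g) (by rw [𝒢.inv_left, 𝒢.src_inv])

theorem inv_unit (x : M) : 𝒢.inv (𝒢.unit x) = 𝒢.unit x := by
  refine 𝒢.inv_eq_of_mul (by rw [𝒢.tgt_unit, 𝒢.src_unit]) ?_
  have := 𝒢.unit_left (𝒢.unit x)
  rw [𝒢.src_unit] at this
  rw [𝒢.src_unit, this]

theorem inv_mul {a b : G} (h : 𝒢.tgt a = 𝒢.src b) :
    𝒢.inv (𝒢.mul a b) = 𝒢.mul (𝒢.inv b) (𝒢.inv a) := by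
  have h' : 𝒢.tgt (𝒢.inv b) = 𝒢.src (𝒢.inv a) := by rw [𝒢.tgt_inv, 𝒢.src_inv, h]
  have h2 : 𝒢.tgt b = 𝒢.src (𝒢.mul (𝒢.inv b) (𝒢.inv a)) := by rw [𝒢.src_mul _ _ h', 𝒢.src_inv]
  refine 𝒢.inv_eq_of_mul (by rw [𝒢.tgt_mul _ _ h, h2]) ?_
  rw [← 𝒢.assoc _ _ _ h h2, 𝒢.assoc b _ _ (𝒢.src_inv b).symm h', 𝒢.inv_right, ← h, ← 𝒢.src_inv a,
    𝒢.unit_left, 𝒢.inv_right, 𝒢.src_mul _ _ h]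

end Algebra

theorem smoothNear_mul {E H N : Type*} [NormedAddCommGroup E] [NormedSpace ℝ E]
    [TopologicalSpace H] {I : ModelWithCorners ℝ E H} [TopologicalSpace N] [ChartedSpace H N]
    {f g : N → G} {x : N} (hf : SmoothNear I 𝓘(ℝ, EG) f x) (hg : SmoothNear I 𝓘(ℝ, EG) g x)
    (h : ∀ᶠ y in 𝓝 x, 𝒢.tgt (f y) = 𝒢.src (g y)) :
    SmoothNear I 𝓘(ℝ, EG) (fun y => 𝒢.mul (f y) (g y)) x := by
  obtain ⟨O, hO, hOo, hx⟩ := eventually_nhds_iff.1 (h.and (hf.prodMk hg))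
  refine ContMDiffOn.smoothNear (s := O) ?_ (hOo.mem_nhds hx)
  exact 𝒢.contMDiffOn_mul.comp (fun y hy => (hO y hy).2.contMDiffWithinAt) fun y hy => (hO y hy).1

/-- The multiplication extends locally to a smooth map on `G × G`. -/
theorem exists_mulExt (a b : G) : ∃ m : G × G → G, 𝒢.tgt a = 𝒢.src b →
    SmoothNear (𝓘(ℝ, EG).prod 𝓘(ℝ, EG)) 𝓘(ℝ, EG) m (a, b) ∧
    ∀ᶠ p in 𝓝 (a, b), 𝒢.tgt p.1 = 𝒢.src p.2 → m p = 𝒢.mul p.1 p.2 := by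
  obtain ⟨ψ, k1, k2, k3⟩ := (𝒢.smoothNear_tgt a).exists_fibre_map (𝒢.surjective_tgtD a)
  refine ⟨fun p => 𝒢.mul (ψ (p.1, 𝒢.src p.2)) p.2, fun h => ?_⟩
  have hq : SmoothNear (𝓘(ℝ, EG).prod 𝓘(ℝ, EG)) (𝓘(ℝ, EG).prod 𝓘(ℝ, EM))
      (fun p : G × G => (p.1, 𝒢.src p.2)) (a, b) :=
    (SmoothNear.fst _).prodMk ((𝒢.smoothNear_src b).comp (SmoothNear.snd (a, b)))
  have hqv : (a, 𝒢.src b) = (a, 𝒢.tgt a) := by rw [h]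
  have hc := hq.continuousAt
  rw [ContinuousAt, hqv] at hc
  refine ⟨𝒢.smoothNear_mul (k1.comp_of_eq hq hqv) (SmoothNear.snd _) (hc.eventually k2), ?_⟩
  filter_upwards [(continuousAt_fst (p := (a, b))).eventually k3] with p hp e
  rw [← e, hp]

/-- A local smooth extension of the multiplication near `(a, b)`. -/
def mulExt (a b : G) : G × G → G := Classical.choose (𝒢.exists_mulExt a b)

/-- The differential of the multiplication; only its values on pairs of vectors tangent to the set of
composable pairs carry information. -/
def mulD (a b : G) : EG × EG →L[ℝ] EG :=
  tderiv (𝓘(ℝ, EG).prod 𝓘(ℝ, EG)) 𝓘(ℝ, EG) (𝒢.mulExt a b) (a, b)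

variable {𝒢} in
theorem smoothNear_mulExt {a b : G} (h : 𝒢.tgt a = 𝒢.src b) :
    SmoothNear (𝓘(ℝ, EG).prod 𝓘(ℝ, EG)) 𝓘(ℝ, EG) (𝒢.mulExt a b) (a, b) :=
  (Classical.choose_spec (𝒢.exists_mulExt a b) h).1

variable {𝒢} in
theorem eventually_mulExt {a b : G} (h : 𝒢.tgt a = 𝒢.src b) :
    ∀ᶠ p in 𝓝 (a, b), 𝒢.tgt p.1 = 𝒢.src p.2 → 𝒢.mulExt a b p = 𝒢.mul p.1 p.2 :=
  (Classical.choose_spec (𝒢.exists_mulExt a b) h).2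

variable {𝒢} in
theorem tangentTo_composable {a b : G} (h : 𝒢.tgt a = 𝒢.src b) {u v : EG}
    (huv : 𝒢.tgtD a u = 𝒢.srcD b v) :
    TangentTo (𝓘(ℝ, EG).prod 𝓘(ℝ, EG)) {p : G × G | 𝒢.tgt p.1 = 𝒢.src p.2} (a, b) (u, v) :=
  (TangentTo.graph (TangentTo.univ a u) (𝒢.smoothNear_src b) (𝒢.surjective_srcD b)
    (𝒢.smoothNear_tgt a).mdifferentiableAt h.symm huv.symm).mono fun _ hp => hp.2.symm

section ChainRule

variable {E H N : Type*} [NormedAddCommGroup E] [NormedSpace ℝ E] [TopologicalSpace H]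
  {I : ModelWithCorners ℝ E H} [TopologicalSpace N] [ChartedSpace H N]

variable {𝒢} in
theorem tderiv_mul {f g : N → G} {x : N}
    (hf : MDifferentiableAt I 𝓘(ℝ, EG) f x) (hg : MDifferentiableAt I 𝓘(ℝ, EG) g x)
    (h : ∀ᶠ y in 𝓝 x, 𝒢.tgt (f y) = 𝒢.src (g y)) (v : E) :
    tderiv I 𝓘(ℝ, EG) (fun y => 𝒢.mul (f y) (g y)) x v =
      𝒢.mulD (f x) (g x) (tderiv I 𝓘(ℝ, EG) f x v, tderiv I 𝓘(ℝ, EG) g x v) := by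
  have hfg := hf.prodMk hg
  have e : (fun y => 𝒢.mul (f y) (g y)) =ᶠ[𝓝 x] fun y => 𝒢.mulExt (f x) (g x) (f y, g y) := by
    filter_upwards [hfg.continuousAt.eventually (eventually_mulExt h.self_of_nhds), h] with y h1 h2
    exact (h1 h2).symm
  rw [tderiv_congr e, tderiv_comp_of_eq (y := (f x, g x))
    (smoothNear_mulExt h.self_of_nhds).mdifferentiableAt hfg rfl, tderiv_prodMk hf hg]
  rfl

variable {𝒢} in
theorem mdifferentiableAt_mul {f g : N → G} {x : N}
    (hf : MDifferentiableAt I 𝓘(ℝ, EG) f x) (hg : MDifferentiableAt I 𝓘(ℝ, EG) g x)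
    (h : ∀ᶠ y in 𝓝 x, 𝒢.tgt (f y) = 𝒢.src (g y)) :
    MDifferentiableAt I 𝓘(ℝ, EG) (fun y => 𝒢.mul (f y) (g y)) x := by
  have hfg := hf.prodMk hg
  have e : (fun y => 𝒢.mul (f y) (g y)) =ᶠ[𝓝 x] fun y => 𝒢.mulExt (f x) (g x) (f y, g y) := by
    filter_upwards [hfg.continuousAt.eventually (eventually_mulExt h.self_of_nhds), h] with y h1 h2
    exact (h1 h2).symm
  exact ((smoothNear_mulExt h.self_of_nhds).mdifferentiableAt.comp_of_eq _ hfg rfl).congr_of_eventuallyEq e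

variable {𝒢} in
theorem tderiv_eq_mulD {m : G × G → G} {a b : G} (h : 𝒢.tgt a = 𝒢.src b)
    (hm : MDifferentiableAt (𝓘(ℝ, EG).prod 𝓘(ℝ, EG)) 𝓘(ℝ, EG) m (a, b))
    (e : ∀ᶠ p in 𝓝 (a, b), 𝒢.tgt p.1 = 𝒢.src p.2 → m p = 𝒢.mul p.1 p.2) {u v : EG}
    (huv : 𝒢.tgtD a u = 𝒢.srcD b v) :
    tderiv (𝓘(ℝ, EG).prod 𝓘(ℝ, EG)) 𝓘(ℝ, EG) m (a, b) (u, v) = 𝒢.mulD a b (u, v) := by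
  refine (tangentTo_composable h huv).tderiv_eq hm (smoothNear_mulExt h).mdifferentiableAt ?_
  filter_upwards [e, eventually_mulExt h] with p h1 h2 h3
  rw [h1 h3, h2 h3]

variable {𝒢} in
/-- The product of two smooth vector fields along composable maps is smooth. -/
theorem smoothAlong_mulD [IsManifold I ∞ N] [I.Boundaryless] {f g : N → G} {V W : N → EG} {x : N}
    (hV : SmoothAlong I 𝓘(ℝ, EG) f V x) (hW : SmoothAlong I 𝓘(ℝ, EG) g W x)
    (h : ∀ᶠ y in 𝓝 x, 𝒢.tgt (f y) = 𝒢.src (g y))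
    (hVW : ∀ᶠ y in 𝓝 x, 𝒢.tgtD (f y) (V y) = 𝒢.srcD (g y) (W y)) :
    SmoothAlong I 𝓘(ℝ, EG) (fun y => 𝒢.mul (f y) (g y))
      (fun y => 𝒢.mulD (f y) (g y) (V y, W y)) x := by
  have h0 := h.self_of_nhds
  have hc : ContinuousAt (fun y => (f y, g y)) x :=
    hV.base.continuousAt.prodMk hW.base.continuousAt
  refine SmoothAlong.congr ((hV.prodMk hW).map (smoothNear_mulExt h0)) ?_
  filter_upwards [h, hVW, hc.eventually (eventually_eventually_nhds.2 (eventually_mulExt h0)),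
    hc.eventually (smoothNear_mulExt h0).eventually] with y h1 h2 h3 h4
  exact ⟨(h3.self_of_nhds h1).symm, (tderiv_eq_mulD h1 h4.mdifferentiableAt h3 h2).symm⟩

end ChainRule

section Translations

variable {𝒢}

theorem srcD_mulD {a b : G} (h : 𝒢.tgt a = 𝒢.src b) {u v : EG} (huv : 𝒢.tgtD a u = 𝒢.srcD b v) :
    𝒢.srcD (𝒢.mul a b) (𝒢.mulD a b (u, v)) = 𝒢.srcD a u := by
  have e := (tangentTo_composable h huv).tderiv_eq (I' := 𝓘(ℝ, EM))
    (f := fun p => 𝒢.src (𝒢.mulExt a b p)) (g := fun p => 𝒢.src p.1)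
    ((𝒢.smoothNear_src _).comp (smoothNear_mulExt h)).mdifferentiableAt
    ((𝒢.smoothNear_src _).comp (SmoothNear.fst (a, b))).mdifferentiableAt (by
      filter_upwards [eventually_mulExt h] with p h1 h2
      rw [h1 h2, 𝒢.src_mul _ _ h2])
  have hm : 𝒢.mulExt a b (a, b) = 𝒢.mul a b := (eventually_mulExt h).self_of_nhds h
  rw [tderiv_comp_of_eq (𝒢.smoothNear_src (𝒢.mul a b)).mdifferentiableAt
    (smoothNear_mulExt h).mdifferentiableAt hm,
    tderiv_comp_of_eq (𝒢.smoothNear_src a).mdifferentiableAt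
    (SmoothNear.fst (a, b)).mdifferentiableAt rfl, tderiv_fst] at e
  exact e

theorem tgtD_mulD {a b : G} (h : 𝒢.tgt a = 𝒢.src b) {u v : EG} (huv : 𝒢.tgtD a u = 𝒢.srcD b v) :
    𝒢.tgtD (𝒢.mul a b) (𝒢.mulD a b (u, v)) = 𝒢.tgtD b v := by
  have e := (tangentTo_composable h huv).tderiv_eq (I' := 𝓘(ℝ, EM))
    (f := fun p => 𝒢.tgt (𝒢.mulExt a b p)) (g := fun p => 𝒢.tgt p.2)
    ((𝒢.smoothNear_tgt _).comp (smoothNear_mulExt h)).mdifferentiableAt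
    ((𝒢.smoothNear_tgt _).comp (SmoothNear.snd (a, b))).mdifferentiableAt (by
      filter_upwards [eventually_mulExt h] with p h1 h2
      rw [h1 h2, 𝒢.tgt_mul _ _ h2])
  have hm : 𝒢.mulExt a b (a, b) = 𝒢.mul a b := (eventually_mulExt h).self_of_nhds h
  rw [tderiv_comp_of_eq (𝒢.smoothNear_tgt (𝒢.mul a b)).mdifferentiableAt
    (smoothNear_mulExt h).mdifferentiableAt hm,
    tderiv_comp_of_eq (𝒢.smoothNear_tgt b).mdifferentiableAt
    (SmoothNear.snd (a, b)).mdifferentiableAt rfl, tderiv_snd] at e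
  exact e

/-- A vector in the kernel of `srcD` is the derivative of a map into the source fibre. -/
theorem exists_srcFibre_map {b : G} {v : EG} (hv : 𝒢.srcD b v = 0) :
    ∃ φ : G → G, MDifferentiableAt 𝓘(ℝ, EG) 𝓘(ℝ, EG) φ b ∧ φ b = b ∧
      (∀ᶠ y in 𝓝 b, 𝒢.src (φ y) = 𝒢.src b) ∧ tderiv 𝓘(ℝ, EG) 𝓘(ℝ, EG) φ b v = v :=
  TangentTo.fibre (𝒢.smoothNear_src b) (𝒢.surjective_srcD b) rfl hv

theorem exists_tgtFibre_map {b : G} {v : EG} (hv : 𝒢.tgtD b v = 0) :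
    ∃ φ : G → G, MDifferentiableAt 𝓘(ℝ, EG) 𝓘(ℝ, EG) φ b ∧ φ b = b ∧
      (∀ᶠ y in 𝓝 b, 𝒢.tgt (φ y) = 𝒢.tgt b) ∧ tderiv 𝓘(ℝ, EG) 𝓘(ℝ, EG) φ b v = v :=
  TangentTo.fibre (𝒢.smoothNear_tgt b) (𝒢.surjective_tgtD b) rfl hv

theorem tderiv_mul_left {a b : G} (h : 𝒢.tgt a = 𝒢.src b) {φ : G → G}
    (h1 : MDifferentiableAt 𝓘(ℝ, EG) 𝓘(ℝ, EG) φ b) (h2 : φ b = b)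
    (h3 : ∀ᶠ y in 𝓝 b, 𝒢.src (φ y) = 𝒢.src b) (v : EG) :
    tderiv 𝓘(ℝ, EG) 𝓘(ℝ, EG) (fun y => 𝒢.mul a (φ y)) b v =
      𝒢.mulD a b (0, tderiv 𝓘(ℝ, EG) 𝓘(ℝ, EG) φ b v) := by
  rw [tderiv_mul mdifferentiableAt_const h1 (h3.mono fun y hy => by rw [hy, h]), tderiv_const, h2]
  rfl

theorem mulD_assoc_left {a b c : G} (h : 𝒢.tgt a = 𝒢.src b) (h' : 𝒢.tgt b = 𝒢.src c) {v : EG}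
    (hv : 𝒢.srcD c v = 0) :
    𝒢.mulD a (𝒢.mul b c) (0, 𝒢.mulD b c (0, v)) = 𝒢.mulD (𝒢.mul a b) c (0, v) := by
  obtain ⟨φ, h1, h2, h3, h4⟩ := exists_srcFibre_map hv
  have hab : 𝒢.tgt (𝒢.mul a b) = 𝒢.src c := by rw [𝒢.tgt_mul _ _ h, h']
  have e1 := tderiv_mul_left hab h1 h2 h3 v
  have e2 := tderiv_mul_left h' h1 h2 h3 v
  have hb : ∀ᶠ y in 𝓝 c, 𝒢.tgt b = 𝒢.src (φ y) := h3.mono fun y hy => by rw [hy, h']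
  have e3 := tderiv_mul (𝒢 := 𝒢) (f := fun _ : G => a) (g := fun y => 𝒢.mul b (φ y)) (x := c)
    mdifferentiableAt_const
    (mdifferentiableAt_mul mdifferentiableAt_const h1 hb)
    (hb.mono fun y hy => by rw [𝒢.src_mul _ _ hy, h]) v
  rw [e2, tderiv_const, h2, h4] at e3
  rw [h4] at e1
  refine e3.symm.trans (Eq.trans ?_ e1)
  refine congrArg (fun A : EG →L[ℝ] EG => A v) (tderiv_congr ?_)
  filter_upwards [hb] with y hy
  rw [𝒢.assoc _ _ _ h hy]

theorem mulD_unit_left {x : M} {b : G} (h : x = 𝒢.src b) {v : EG} (hv : 𝒢.srcD b v = 0) :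
    𝒢.mulD (𝒢.unit x) b (0, v) = v := by
  subst h
  obtain ⟨φ, h1, h2, h3, h4⟩ := exists_srcFibre_map hv
  have e1 := tderiv_mul_left (𝒢.tgt_unit _) h1 h2 h3 v
  rw [h4] at e1
  refine e1.symm.trans (Eq.trans ?_ h4)
  refine congrArg (fun A : EG →L[ℝ] EG => A v) (tderiv_congr ?_)
  filter_upwards [h3] with y hy
  rw [← hy, 𝒢.unit_left]

theorem tangentL_eq {a b : G} (h : 𝒢.tgt a = 𝒢.src b) {v : EG} (hv : 𝒢.srcD b v = 0) :
    (𝒢.tangentL a b : EG →L[ℝ] EG) v = 𝒢.mulD a b (0, v) := by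
  have hq : SmoothNear 𝓘(ℝ, EG) (𝓘(ℝ, EG).prod 𝓘(ℝ, EG)) (fun k : G => (a, k)) b :=
    (SmoothNear.const a b).prodMk (SmoothNear.id b)
  have := TangentTo.mfderivWithin_eq (f := fun k => 𝒢.mul a k) (g := fun k => 𝒢.mulExt a b (a, k))
    (TangentTo.fibre (𝒢.smoothNear_src b) (𝒢.surjective_srcD b) h.symm hv)
    ((smoothNear_mulExt h).comp hq).mdifferentiableAt (by
      filter_upwards [hq.continuousAt.eventually (eventually_mulExt h)] with y hy hs
      exact (hy (show 𝒢.tgt a = 𝒢.src y from (Set.mem_singleton_iff.1 hs).symm)).symm)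
  refine this.trans ?_
  rw [tderiv_comp (smoothNear_mulExt h).mdifferentiableAt hq.mdifferentiableAt,
    tderiv_prodMk (SmoothNear.const a b).mdifferentiableAt (SmoothNear.id b).mdifferentiableAt,
    tderiv_const, tderiv_id]
  rfl

theorem tangentR_eq {a b : G} (h : 𝒢.tgt a = 𝒢.src b) {u : EG} (hu : 𝒢.tgtD a u = 0) :
    (𝒢.tangentR b a : EG →L[ℝ] EG) u = 𝒢.mulD a b (u, 0) := by
  have hq : SmoothNear 𝓘(ℝ, EG) (𝓘(ℝ, EG).prod 𝓘(ℝ, EG)) (fun k : G => (k, b)) a :=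
    (SmoothNear.id a).prodMk (SmoothNear.const b a)
  have := TangentTo.mfderivWithin_eq (f := fun k => 𝒢.mul k b) (g := fun k => 𝒢.mulExt a b (k, b))
    (TangentTo.fibre (𝒢.smoothNear_tgt a) (𝒢.surjective_tgtD a) h hu)
    (SmoothNear.comp (f := fun k : G => (k, b)) (smoothNear_mulExt h) hq).mdifferentiableAt (by
      filter_upwards [hq.continuousAt.eventually (eventually_mulExt h)] with y hy hs
      exact (hy (show 𝒢.tgt y = 𝒢.src b from Set.mem_singleton_iff.1 hs)).symm)
  refine this.trans ?_
  rw [tderiv_comp (f := fun k : G => (k, b)) (smoothNear_mulExt h).mdifferentiableAt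
    hq.mdifferentiableAt, tderiv_prodMk (SmoothNear.id a).mdifferentiableAt (SmoothNear.const b a).mdifferentiableAt,
    tderiv_const, tderiv_id]
  rfl

theorem invD_invD (g : G) (v : EG) : 𝒢.invD (𝒢.inv g) (𝒢.invD g v) = v := by
  have := tderiv_comp (𝒢.smoothNear_inv (𝒢.inv g)).mdifferentiableAt
    (𝒢.smoothNear_inv g).mdifferentiableAt v
  refine this.symm.trans ?_
  simp only [𝒢.inv_inv, tderiv_id]
  rfl

theorem srcD_invD (g : G) (v : EG) : 𝒢.srcD (𝒢.inv g) (𝒢.invD g v) = 𝒢.tgtD g v := by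
  have := tderiv_comp (𝒢.smoothNear_src (𝒢.inv g)).mdifferentiableAt
    (𝒢.smoothNear_inv g).mdifferentiableAt v
  refine this.symm.trans ?_
  simp only [𝒢.src_inv]
  rfl

theorem tgtD_invD (g : G) (v : EG) : 𝒢.tgtD (𝒢.inv g) (𝒢.invD g v) = 𝒢.srcD g v := by
  have := tderiv_comp (𝒢.smoothNear_tgt (𝒢.inv g)).mdifferentiableAt
    (𝒢.smoothNear_inv g).mdifferentiableAt v
  refine this.symm.trans ?_
  simp only [𝒢.tgt_inv]
  rfl

/-- The inversion exchanges left and right translations. -/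
theorem mulD_right_eq {a b : G} (h : 𝒢.tgt a = 𝒢.src b) {u : EG} (hu : 𝒢.tgtD a u = 0) :
    𝒢.mulD a b (u, 0) = 𝒢.invD (𝒢.mul (𝒢.inv b) (𝒢.inv a))
      (𝒢.mulD (𝒢.inv b) (𝒢.inv a) (0, 𝒢.invD a u)) := by
  obtain ⟨φ, h1, h2, h3, h4⟩ := exists_tgtFibre_map hu
  have h' : 𝒢.tgt (𝒢.inv b) = 𝒢.src (𝒢.inv a) := by rw [𝒢.tgt_inv, 𝒢.src_inv, h]
  have c1 : ∀ᶠ y in 𝓝 a, 𝒢.tgt (φ y) = 𝒢.src b := h3.mono fun y hy => by rw [hy, h]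
  have c2 : ∀ᶠ y in 𝓝 a, 𝒢.tgt (𝒢.inv b) = 𝒢.src (𝒢.inv (φ y)) := by
    filter_upwards [c1] with y hy
    rw [𝒢.tgt_inv, 𝒢.src_inv, hy]
  have d1 : MDifferentiableAt 𝓘(ℝ, EG) 𝓘(ℝ, EG) (fun y => 𝒢.inv (φ y)) a :=
    (𝒢.smoothNear_inv (φ a)).mdifferentiableAt.comp a h1
  have e1 := tderiv_mul (𝒢 := 𝒢) (f := φ) (g := fun _ => b) (x := a) h1 mdifferentiableAt_const c1 u
  have e2 := tderiv_mul (𝒢 := 𝒢) (f := fun _ : G => 𝒢.inv b) (x := a) mdifferentiableAt_const d1 c2 u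
  have d2 := mdifferentiableAt_mul (𝒢 := 𝒢) (f := fun _ : G => 𝒢.inv b) (x := a)
    mdifferentiableAt_const d1 c2
  have e3 := tderiv_comp (𝒢.smoothNear_inv _).mdifferentiableAt d2 u
  rw [e2, tderiv_comp_of_eq (𝒢.smoothNear_inv a).mdifferentiableAt h1 h2, tderiv_const, h4] at e3
  rw [tderiv_const, h4, h2] at e1
  simp only [h2] at e3
  refine e1.symm.trans (Eq.trans ?_ e3)
  refine congrArg (fun A : EG →L[ℝ] EG => A u) (tderiv_congr ?_)
  filter_upwards [c1] with y hy
  rw [← 𝒢.inv_mul hy, 𝒢.inv_inv]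

end Translations

end LieGroupoid

namespace LieGroupoid

variable {EG EM G M : Type*} [NormedAddCommGroup EG] [NormedSpace ℝ EG]
  [NormedAddCommGroup EM] [NormedSpace ℝ EM] [TopologicalSpace G] [ChartedSpace EG G]
  [TopologicalSpace M] [ChartedSpace EM M] [FiniteDimensional ℝ EG] [FiniteDimensional ℝ EM]
  [IsManifold 𝓘(ℝ, EG) ∞ G] [IsManifold 𝓘(ℝ, EM) ∞ M] (𝒢 : LieGroupoid EG EM G M)

section Frames

/-- The local frame of `AG` near `x₀`, with values in the tangent spaces at the units. -/
def unitFrame (x₀ x : M) : AlgModel EG EM →L[ℝ] EG := 𝒢.algSymm₀ x₀ x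

/-- The anchor of `AG` in the local frame near `x₀`. -/
def anchorFrame (x₀ x : M) : AlgModel EG EM →L[ℝ] EM := (𝒢.tgtD (𝒢.unit x)).comp (𝒢.unitFrame x₀ x)

/-- The frame of left-invariant vector fields. -/
def leftFrame (x₀ : M) (k : G) : AlgModel EG EM →L[ℝ] EG :=
  (𝒢.mulD k (𝒢.unit (𝒢.tgt k))).comp
    ((ContinuousLinearMap.inr ℝ EG EG).comp (𝒢.unitFrame x₀ (𝒢.tgt k)))

/-- The frame of (negated) right-invariant vector fields. -/
def rightFrame (x₀ : M) (g : G) : AlgModel EG EM →L[ℝ] EG :=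
  (𝒢.invD (𝒢.inv g)).comp (𝒢.leftFrame x₀ (𝒢.inv g))

variable {𝒢} {x₀ : M}

theorem smoothAlong_unitFrame {x : M} (hx : x ∈ 𝒢.algBase x₀) (a : AlgModel EG EM) :
    SmoothAlong 𝓘(ℝ, EM) 𝓘(ℝ, EG) 𝒢.unit (fun y => 𝒢.unitFrame x₀ y a) x := by
  have hd : 𝒢.dom x₀ ∈ 𝓝 x := (𝒢.isOpen_dom x₀).mem_nhds hx.1
  have h1 : SmoothNear 𝓘(ℝ, EM) 𝓘(ℝ, EG) (fun y => (𝒢.frame x₀ y).inverse (a, 0)) x :=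
    SmoothNear.clm_apply (((𝒢.contMDiffOn_frame x₀).smoothNear hd).clm_inverse hx.2)
      (SmoothNear.const _ _)
  have h2 : SmoothNear 𝓘(ℝ, EM) (𝓘(ℝ, EG).prod 𝓘(ℝ, EG))
      (fun y => (𝒢.unit y, (𝒢.frame x₀ y).inverse (a, 0))) x := (𝒢.smoothNear_unit x).prodMk h1
  have h3 : SmoothNear (𝓘(ℝ, EG).prod 𝓘(ℝ, EG)) 𝓘(ℝ, EG).tangent
      (𝒢.trivG x₀).toOpenPartialHomeomorph.symm (𝒢.unit x, (𝒢.frame x₀ x).inverse (a, 0)) :=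
    ((𝒢.trivG x₀).contMDiffOn_symm (IB := 𝓘(ℝ, EG)) (n := ∞)).smoothNear
      ((𝒢.trivG x₀).open_target.mem_nhds (by rw [Trivialization.mem_target]; exact hx.1.2))
  refine (SmoothNear.comp (f := fun y => (𝒢.unit y, (𝒢.frame x₀ y).inverse (a, 0))) h3 h2).congr ?_
  filter_upwards [hd] with y hy
  refine Eq.trans ?_ ((𝒢.trivG x₀).mk_symm hy.2 _)
  exact congrArg (TotalSpace.mk _) (Trivialization.symmL_apply (R := ℝ) (𝒢.trivG x₀) hy.2 _)

theorem srcD_unitFrame {x : M} (hx : x ∈ 𝒢.algBase x₀) (a : AlgModel EG EM) :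
    𝒢.srcD (𝒢.unit x) (𝒢.unitFrame x₀ x a) = 0 := 𝒢.mfderiv_src_algSymm₀ hx a

theorem unitFrame_algCoord {x : M} (hx : x ∈ 𝒢.algBase x₀) (v : 𝒢.Alg x) :
    𝒢.unitFrame x₀ x (𝒢.algCoord x₀ x v) = 𝒢.algIncl x v := by
  rw [← congrArg (𝒢.algIncl x) (𝒢.algSymm_algCoord hx v), 𝒢.algIncl_algSymm hx]
  rfl

theorem unitFrame_injective {x : M} (hx : x ∈ 𝒢.algBase x₀) :
    Function.Injective (𝒢.unitFrame x₀ x) := by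
  intro a b h
  have h' : 𝒢.algSymm x₀ x a = 𝒢.algSymm x₀ x b := by
    apply 𝒢.algIncl_injective
    rw [𝒢.algIncl_algSymm hx, 𝒢.algIncl_algSymm hx]
    exact h
  rw [← 𝒢.algCoord_algSymm hx a, h', 𝒢.algCoord_algSymm hx]

theorem exists_unitFrame {x : M} (hx : x ∈ 𝒢.algBase x₀) {v : EG} (hv : 𝒢.srcD (𝒢.unit x) v = 0) :
    ∃ a, 𝒢.unitFrame x₀ x a = v :=
  ⟨𝒢.algCoord x₀ x (𝒢.algMk x v hv), (unitFrame_algCoord hx _).trans (𝒢.algIncl_algMk x v hv)⟩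

theorem leftFrame_eq {k : G} {x : M} (h : 𝒢.tgt k = x) (a : AlgModel EG EM) :
    𝒢.leftFrame x₀ k a = 𝒢.mulD k (𝒢.unit x) (0, 𝒢.unitFrame x₀ x a) := by
  subst h
  rfl

theorem eventually_tgt_mem {k : G} (hk : 𝒢.tgt k ∈ 𝒢.algBase x₀) :
    ∀ᶠ y in 𝓝 k, 𝒢.tgt y ∈ 𝒢.algBase x₀ :=
  𝒢.contMDiff_tgt.continuous.continuousAt.eventually ((𝒢.isOpen_algBase x₀).mem_nhds hk)

theorem eventually_src_mem {k : G} (hk : 𝒢.src k ∈ 𝒢.algBase x₀) :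
    ∀ᶠ y in 𝓝 k, 𝒢.src y ∈ 𝒢.algBase x₀ :=
  𝒢.contMDiff_src.continuous.continuousAt.eventually ((𝒢.isOpen_algBase x₀).mem_nhds hk)

theorem smoothFamily_leftFrame {k : G} (hk : 𝒢.tgt k ∈ 𝒢.algBase x₀) :
    SmoothFamily 𝓘(ℝ, EG) (𝒢.leftFrame x₀) k := by
  intro a
  have h1 : SmoothAlong 𝓘(ℝ, EG) 𝓘(ℝ, EG) (fun y : G => y) (fun _ => 0) k :=
    SmoothAlong.zero (SmoothNear.id k)
  have h2 : SmoothAlong 𝓘(ℝ, EG) 𝓘(ℝ, EG) (fun y => 𝒢.unit (𝒢.tgt y))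
      (fun y => 𝒢.unitFrame x₀ (𝒢.tgt y) a) k :=
    SmoothAlong.comp (k := 𝒢.tgt) (smoothAlong_unitFrame hk a) (𝒢.smoothNear_tgt k)
  refine SmoothAlong.congr (smoothAlong_mulD (𝒢 := 𝒢) h1 h2 ?_ ?_) ?_
  · exact Eventually.of_forall fun y => (𝒢.src_unit _).symm
  · filter_upwards [eventually_tgt_mem hk] with y hy
    rw [map_zero, srcD_unitFrame hy]
  · exact Eventually.of_forall fun y => ⟨(𝒢.unit_right y).symm, rfl⟩

theorem srcD_leftFrame {k : G} (hk : 𝒢.tgt k ∈ 𝒢.algBase x₀) (a : AlgModel EG EM) :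
    𝒢.srcD k (𝒢.leftFrame x₀ k a) = 0 := by
  have h := srcD_mulD (𝒢 := 𝒢) (a := k) (b := 𝒢.unit (𝒢.tgt k)) (u := 0)
    (v := 𝒢.unitFrame x₀ (𝒢.tgt k) a) (𝒢.src_unit _).symm (by rw [map_zero, srcD_unitFrame hk])
  rw [𝒢.unit_right, map_zero] at h
  exact h

theorem tgtD_leftFrame {k : G} (hk : 𝒢.tgt k ∈ 𝒢.algBase x₀) (a : AlgModel EG EM) :
    𝒢.tgtD k (𝒢.leftFrame x₀ k a) = 𝒢.anchorFrame x₀ (𝒢.tgt k) a := by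
  have h := tgtD_mulD (𝒢 := 𝒢) (a := k) (b := 𝒢.unit (𝒢.tgt k)) (u := 0)
    (v := 𝒢.unitFrame x₀ (𝒢.tgt k) a) (𝒢.src_unit _).symm (by rw [map_zero, srcD_unitFrame hk])
  rw [𝒢.unit_right] at h
  exact h

theorem mulD_leftFrame {g k : G} (h : 𝒢.tgt g = 𝒢.src k) (hk : 𝒢.tgt k ∈ 𝒢.algBase x₀)
    (a : AlgModel EG EM) :
    𝒢.mulD g k (0, 𝒢.leftFrame x₀ k a) = 𝒢.leftFrame x₀ (𝒢.mul g k) a := by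
  have e := mulD_assoc_left (𝒢 := 𝒢) h (𝒢.src_unit _).symm (srcD_unitFrame hk a)
  rw [𝒢.unit_right] at e
  rw [leftFrame_eq (𝒢.tgt_mul _ _ h)]
  exact e

theorem leftFrame_unit {x : M} (hx : x ∈ 𝒢.algBase x₀) (a : AlgModel EG EM) :
    𝒢.leftFrame x₀ (𝒢.unit x) a = 𝒢.unitFrame x₀ x a := by
  rw [leftFrame_eq (𝒢.tgt_unit x)]
  exact mulD_unit_left (𝒢.src_unit x).symm (srcD_unitFrame hx a)

theorem leftFrame_injective {k : G} (hk : 𝒢.tgt k ∈ 𝒢.algBase x₀) :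
    Function.Injective (𝒢.leftFrame x₀ k) := by
  intro a b h
  have e := fun c => mulD_leftFrame (𝒢 := 𝒢) (g := 𝒢.inv k) (k := k) (𝒢.tgt_inv k) hk c
  simp only [𝒢.inv_left, leftFrame_unit hk] at e
  apply unitFrame_injective hk
  rw [← e, ← e, h]

theorem exists_leftFrame {k : G} (hk : 𝒢.tgt k ∈ 𝒢.algBase x₀) {v : EG} (hv : 𝒢.srcD k v = 0) :
    ∃ a, 𝒢.leftFrame x₀ k a = v := by
  have h0 := srcD_mulD (𝒢 := 𝒢) (a := 𝒢.inv k) (b := k) (u := 0) (v := v) (𝒢.tgt_inv k)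
    (by rw [map_zero, hv])
  rw [𝒢.inv_left, map_zero] at h0
  obtain ⟨a, ha⟩ := exists_unitFrame hk h0
  refine ⟨a, ?_⟩
  have e := mulD_assoc_left (𝒢 := 𝒢) (a := k) (b := 𝒢.inv k) (c := k) (𝒢.src_inv k).symm (𝒢.tgt_inv k) hv
  rw [𝒢.inv_left, 𝒢.inv_right, ← ha, mulD_unit_left rfl hv] at e
  exact e

theorem tgt_inv_mem {g : G} (hg : 𝒢.src g ∈ 𝒢.algBase x₀) : 𝒢.tgt (𝒢.inv g) ∈ 𝒢.algBase x₀ := by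
  rwa [𝒢.tgt_inv]

theorem smoothFamily_rightFrame {g : G} (hg : 𝒢.src g ∈ 𝒢.algBase x₀) :
    SmoothFamily 𝓘(ℝ, EG) (𝒢.rightFrame x₀) g := by
  intro a
  have h1 : SmoothAlong 𝓘(ℝ, EG) 𝓘(ℝ, EG) (fun y => 𝒢.inv y)
      (fun y => 𝒢.leftFrame x₀ (𝒢.inv y) a) g :=
    SmoothAlong.comp (k := 𝒢.inv) (smoothFamily_leftFrame (tgt_inv_mem hg) a) (𝒢.smoothNear_inv g)
  refine SmoothAlong.congr (h1.map (𝒢.smoothNear_inv (𝒢.inv g))) ?_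
  exact Eventually.of_forall fun y => ⟨(𝒢.inv_inv y).symm, rfl⟩

theorem tgtD_rightFrame {g : G} (hg : 𝒢.src g ∈ 𝒢.algBase x₀) (a : AlgModel EG EM) :
    𝒢.tgtD g (𝒢.rightFrame x₀ g a) = 0 := by
  have h := tgtD_invD (𝒢 := 𝒢) (𝒢.inv g) (𝒢.leftFrame x₀ (𝒢.inv g) a)
  rw [𝒢.inv_inv, srcD_leftFrame (tgt_inv_mem hg)] at h
  exact h

theorem srcD_rightFrame {g : G} (hg : 𝒢.src g ∈ 𝒢.algBase x₀) (a : AlgModel EG EM) :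
    𝒢.srcD g (𝒢.rightFrame x₀ g a) = 𝒢.anchorFrame x₀ (𝒢.src g) a := by
  have h := srcD_invD (𝒢 := 𝒢) (𝒢.inv g) (𝒢.leftFrame x₀ (𝒢.inv g) a)
  rw [𝒢.inv_inv, tgtD_leftFrame (tgt_inv_mem hg), 𝒢.tgt_inv] at h
  exact h

theorem invD_rightFrame (g : G) (a : AlgModel EG EM) :
    𝒢.invD g (𝒢.rightFrame x₀ g a) = 𝒢.leftFrame x₀ (𝒢.inv g) a := by
  have h := 𝒢.invD_invD (𝒢.inv g) (𝒢.leftFrame x₀ (𝒢.inv g) a)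
  rw [𝒢.inv_inv] at h
  exact h

theorem invD_leftFrame (g : G) (a : AlgModel EG EM) :
    𝒢.invD g (𝒢.leftFrame x₀ g a) = 𝒢.rightFrame x₀ (𝒢.inv g) a := by
  rw [rightFrame, 𝒢.inv_inv]
  rfl

theorem mulD_rightFrame {l k : G} (h : 𝒢.tgt l = 𝒢.src k) (hl : 𝒢.src l ∈ 𝒢.algBase x₀)
    (a : AlgModel EG EM) :
    𝒢.mulD l k (𝒢.rightFrame x₀ l a, 0) = 𝒢.rightFrame x₀ (𝒢.mul l k) a := by
  have h' : 𝒢.tgt (𝒢.inv k) = 𝒢.src (𝒢.inv l) := by rw [𝒢.tgt_inv, 𝒢.src_inv, h]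
  rw [mulD_right_eq h (tgtD_rightFrame hl a), invD_rightFrame, mulD_leftFrame h' (tgt_inv_mem hl),
    invD_leftFrame, 𝒢.inv_mul h', 𝒢.inv_inv, 𝒢.inv_inv]

theorem rightFrame_injective {g : G} (hg : 𝒢.src g ∈ 𝒢.algBase x₀) :
    Function.Injective (𝒢.rightFrame x₀ g) := by
  intro a b h
  apply leftFrame_injective (tgt_inv_mem hg)
  rw [← invD_rightFrame, ← invD_rightFrame, h]

theorem exists_rightFrame {g : G} (hg : 𝒢.src g ∈ 𝒢.algBase x₀) {v : EG} (hv : 𝒢.tgtD g v = 0) :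
    ∃ a, 𝒢.rightFrame x₀ g a = v := by
  have h := 𝒢.srcD_invD g v
  rw [hv] at h
  obtain ⟨a, ha⟩ := exists_leftFrame (tgt_inv_mem hg) h
  refine ⟨a, ?_⟩
  rw [← 𝒢.invD_invD g v, ← ha]
  rfl

end Frames

section Structure

variable {𝒢} {x₀ : M}

theorem fieldBracket_zero {E H N : Type*} [NormedAddCommGroup E] [NormedSpace ℝ E]
    [TopologicalSpace H] {I : ModelWithCorners ℝ E H} [TopologicalSpace N] [ChartedSpace H N]
    (x : N) : fieldBracket I (fun _ : N => (0 : E)) (fun _ => 0) x = 0 := by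
  have := VectorField.mlieBracket_zero_left (I := I) (W := fun y : N => (0 : TangentSpace I y))
  exact congrFun this x

theorem srcD_fieldBracket {V W : G → EG} {k : G} (hV : SmoothField 𝓘(ℝ, EG) V k)
    (hW : SmoothField 𝓘(ℝ, EG) W k) (hV0 : ∀ᶠ y in 𝓝 k, 𝒢.srcD y (V y) = 0)
    (hW0 : ∀ᶠ y in 𝓝 k, 𝒢.srcD y (W y) = 0) : 𝒢.srcD k (fieldBracket 𝓘(ℝ, EG) V W k) = 0 := by
  have := fieldBracket_of_related (s := univ) (V' := fun _ => 0) (W' := fun _ => 0)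
    (𝒢.smoothNear_src k) hV hW (SmoothAlong.zero (SmoothNear.id _))
    (SmoothAlong.zero (SmoothNear.id _)) (TangentTo.univ _ _) (TangentTo.univ _ _)
    (hV0.mono fun y hy _ => hy) (hW0.mono fun y hy _ => hy)
  rwa [fieldBracket_zero] at this

/-- The bracket of the left-invariant vector fields of the frame. -/
def leftBracket (𝒢 : LieGroupoid EG EM G M) (x₀ : M) (a b : AlgModel EG EM) (k : G) : EG :=
  fieldBracket 𝓘(ℝ, EG) (fun y => 𝒢.leftFrame x₀ y a) (fun y => 𝒢.leftFrame x₀ y b) k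

theorem exists_structure (𝒢 : LieGroupoid EG EM G M) (x₀ x : M) (a b : AlgModel EG EM) :
    ∃ c, x ∈ 𝒢.algBase x₀ → 𝒢.unitFrame x₀ x c = 𝒢.leftBracket x₀ a b (𝒢.unit x) := by
  by_cases hx : x ∈ 𝒢.algBase x₀
  · have hx' : 𝒢.tgt (𝒢.unit x) ∈ 𝒢.algBase x₀ := by rwa [𝒢.tgt_unit]
    obtain ⟨c, hc⟩ := exists_unitFrame hx (srcD_fieldBracket (smoothFamily_leftFrame hx' a)
      (smoothFamily_leftFrame hx' b)
      ((eventually_tgt_mem hx').mono fun y hy => srcD_leftFrame hy a)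
      ((eventually_tgt_mem hx').mono fun y hy => srcD_leftFrame hy b))
    exact ⟨c, fun _ => hc⟩
  · exact ⟨0, fun h => absurd h hx⟩

/-- The structure functions of `AG` in the local frame near `x₀`. -/
def structureFn (𝒢 : LieGroupoid EG EM G M) (x₀ x : M) (a b : AlgModel EG EM) : AlgModel EG EM :=
  Classical.choose (𝒢.exists_structure x₀ x a b)

theorem unitFrame_structureFn {x : M} (hx : x ∈ 𝒢.algBase x₀) (a b : AlgModel EG EM) :
    𝒢.unitFrame x₀ x (𝒢.structureFn x₀ x a b) = 𝒢.leftBracket x₀ a b (𝒢.unit x) :=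
  Classical.choose_spec (𝒢.exists_structure x₀ x a b) hx

theorem fieldBracket_leftFrame {k : G} (hk : 𝒢.tgt k ∈ 𝒢.algBase x₀) (a b : AlgModel EG EM) :
    fieldBracket 𝓘(ℝ, EG) (fun y => 𝒢.leftFrame x₀ y a) (fun y => 𝒢.leftFrame x₀ y b) k =
      𝒢.leftFrame x₀ k (𝒢.structureFn x₀ (𝒢.tgt k) a b) := by
  set u := 𝒢.unit (𝒢.tgt k) with hu
  have hku : 𝒢.tgt k = 𝒢.src u := (𝒢.src_unit _).symm
  have hut : 𝒢.tgt u ∈ 𝒢.algBase x₀ := by rwa [hu, 𝒢.tgt_unit]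
  have hq : SmoothNear 𝓘(ℝ, EG) (𝓘(ℝ, EG).prod 𝓘(ℝ, EG)) (fun y : G => (k, y)) u :=
    (SmoothNear.const k u).prodMk (SmoothNear.id u)
  have hf : SmoothNear 𝓘(ℝ, EG) 𝓘(ℝ, EG) (fun y : G => 𝒢.mulExt k u (k, y)) u :=
    (smoothNear_mulExt hku).comp hq
  have hm : 𝒢.mulExt k u (k, u) = k := by
    rw [(eventually_mulExt hku).self_of_nhds hku, hu, 𝒢.unit_right]
  have d : ∀ᶠ y in 𝓝 u, 𝒢.src y = 𝒢.tgt k → 𝒢.mulExt k u (k, y) = 𝒢.mul k y ∧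
      ∀ v, 𝒢.srcD y v = 0 → tderiv 𝓘(ℝ, EG) 𝓘(ℝ, EG) (fun y : G => 𝒢.mulExt k u (k, y)) y v =
        𝒢.mulD k y (0, v) := by
    filter_upwards [hq.continuousAt.eventually (eventually_eventually_nhds.2 (eventually_mulExt hku)),
      hq.continuousAt.eventually (smoothNear_mulExt hku).eventually] with y h1 h2 h3
    refine ⟨h1.self_of_nhds h3.symm, fun v hv => ?_⟩
    rw [tderiv_comp (f := fun y : G => (k, y)) h2.mdifferentiableAt
      ((SmoothNear.const k y).prodMk (SmoothNear.id y)).mdifferentiableAt,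
      tderiv_prodMk (SmoothNear.const k y).mdifferentiableAt (SmoothNear.id y).mdifferentiableAt,
      tderiv_const, tderiv_id]
    exact tderiv_eq_mulD h3.symm h2.mdifferentiableAt h1 (by
      rw [zero_apply, map_zero]
      exact hv.symm)
  have rel : ∀ c, ∀ᶠ y in 𝓝 u, y ∈ 𝒢.src ⁻¹' {𝒢.tgt k} →
      tderiv 𝓘(ℝ, EG) 𝓘(ℝ, EG) (fun y : G => 𝒢.mulExt k u (k, y)) y (𝒢.leftFrame x₀ y c) =
        𝒢.leftFrame x₀ (𝒢.mulExt k u (k, y)) c := by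
    intro c
    filter_upwards [d, eventually_tgt_mem hut] with y h1 h2 h3
    obtain ⟨h4, h5⟩ := h1 h3
    rw [h5 _ (srcD_leftFrame h2 c), h4, mulD_leftFrame (Eq.symm h3) h2]
  have tan : ∀ c, TangentTo 𝓘(ℝ, EG) (𝒢.src ⁻¹' {𝒢.tgt k}) u (𝒢.leftFrame x₀ u c) := fun c =>
    TangentTo.fibre (𝒢.smoothNear_src u) (𝒢.surjective_srcD u) hku.symm (srcD_leftFrame hut c)
  have hk' : 𝒢.tgt (𝒢.mulExt k u (k, u)) ∈ 𝒢.algBase x₀ := by rwa [hm]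
  have key := fieldBracket_of_related hf (smoothFamily_leftFrame hut a) (smoothFamily_leftFrame hut b)
    (smoothFamily_leftFrame hk' a) (smoothFamily_leftFrame hk' b) (tan a) (tan b) (rel a) (rel b)
  rw [hm] at key
  rw [← key]
  have hb : fieldBracket 𝓘(ℝ, EG) (fun y => 𝒢.leftFrame x₀ y a) (fun y => 𝒢.leftFrame x₀ y b) u =
      𝒢.leftFrame x₀ u (𝒢.structureFn x₀ (𝒢.tgt k) a b) := by
    rw [hu, leftFrame_unit hk, unitFrame_structureFn hk]
    rfl
  rw [hb, (d.self_of_nhds hku.symm).2 _ (srcD_leftFrame hut _), mulD_leftFrame hku hut, hu,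
    𝒢.unit_right]

theorem fieldBracket_rightFrame {g : G} (hg : 𝒢.src g ∈ 𝒢.algBase x₀) (a b : AlgModel EG EM) :
    fieldBracket 𝓘(ℝ, EG) (fun y => 𝒢.rightFrame x₀ y a) (fun y => 𝒢.rightFrame x₀ y b) g =
      𝒢.rightFrame x₀ g (𝒢.structureFn x₀ (𝒢.src g) a b) := by
  have hg' := tgt_inv_mem hg
  have hg2 : 𝒢.src (𝒢.inv (𝒢.inv g)) ∈ 𝒢.algBase x₀ := by rwa [𝒢.inv_inv]
  have rel : ∀ c, ∀ᶠ y in 𝓝 (𝒢.inv g), y ∈ univ →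
      tderiv 𝓘(ℝ, EG) 𝓘(ℝ, EG) 𝒢.inv y (𝒢.leftFrame x₀ y c) = 𝒢.rightFrame x₀ (𝒢.inv y) c :=
    fun c => Eventually.of_forall fun y _ => invD_leftFrame y c
  have key := fieldBracket_of_related (𝒢.smoothNear_inv (𝒢.inv g))
    (smoothFamily_leftFrame hg' a) (smoothFamily_leftFrame hg' b)
    (smoothFamily_rightFrame hg2 a) (smoothFamily_rightFrame hg2 b)
    (TangentTo.univ _ _) (TangentTo.univ _ _) (rel a) (rel b)
  rw [𝒢.inv_inv, fieldBracket_leftFrame hg', 𝒢.tgt_inv] at key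
  exact key.symm

/-- Left-invariant and right-invariant vector fields commute. -/
theorem fieldBracket_rightFrame_leftFrame {x₁ : M} {g : G} (hs : 𝒢.src g ∈ 𝒢.algBase x₀)
    (ht : 𝒢.tgt g ∈ 𝒢.algBase x₁) (a b : AlgModel EG EM) :
    fieldBracket 𝓘(ℝ, EG) (fun y => 𝒢.rightFrame x₀ y a) (fun y => 𝒢.leftFrame x₁ y b) g = 0 := by
  set u := 𝒢.unit (𝒢.tgt g) with hu
  have hgu : 𝒢.tgt g = 𝒢.src u := (𝒢.src_unit _).symm
  have hut : 𝒢.tgt u ∈ 𝒢.algBase x₁ := by rwa [hu, 𝒢.tgt_unit]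
  have hm : 𝒢.mulExt g u (g, u) = g := by
    rw [(eventually_mulExt hgu).self_of_nhds hgu, hu, 𝒢.unit_right]
  have z : ∀ y : G, SmoothField 𝓘(ℝ, EG) (fun _ : G => (0 : EG)) y := fun y =>
    SmoothAlong.zero (SmoothNear.id y)
  have s : ∀ (U U' : G → EG), SmoothField 𝓘(ℝ, EG) U g → SmoothField 𝓘(ℝ, EG) U' u →
      SmoothField (𝓘(ℝ, EG).prod 𝓘(ℝ, EG)) (fun q : G × G => (U q.1, U' q.2)) (g, u) :=
    fun U U' hU hU' =>
    SmoothAlong.prodMk (f := fun q : G × G => q.1) (g := fun q : G × G => q.2)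
      (SmoothAlong.comp (k := fun q : G × G => q.1) (x := (g, u)) hU (SmoothNear.fst (g, u)))
      (SmoothAlong.comp (k := fun q : G × G => q.2) (x := (g, u)) hU' (SmoothNear.snd (g, u)))
  have m1 : ∀ᶠ p : G × G in 𝓝 (g, u), 𝒢.src p.1 ∈ 𝒢.algBase x₀ :=
    (continuousAt_fst (p := (g, u))).eventually (eventually_src_mem hs)
  have m2 : ∀ᶠ p : G × G in 𝓝 (g, u), 𝒢.tgt p.2 ∈ 𝒢.algBase x₁ :=
    (continuousAt_snd (p := (g, u))).eventually (eventually_tgt_mem hut)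
  have hs' : 𝒢.src (𝒢.mulExt g u (g, u)) ∈ 𝒢.algBase x₀ := by rwa [hm]
  have ht' : 𝒢.tgt (𝒢.mulExt g u (g, u)) ∈ 𝒢.algBase x₁ := by rwa [hm]
  have key := fieldBracket_of_related (s := {p : G × G | 𝒢.tgt p.1 = 𝒢.src p.2})
    (V := fun q : G × G => (𝒢.rightFrame x₀ q.1 a, 0)) (W := fun q : G × G => (0, 𝒢.leftFrame x₁ q.2 b))
    (smoothNear_mulExt hgu)
    (s _ _ (smoothFamily_rightFrame hs a) (z u)) (s _ _ (z g) (smoothFamily_leftFrame hut b))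
    (smoothFamily_rightFrame hs' a) (smoothFamily_leftFrame ht' b)
    (tangentTo_composable hgu (by rw [tgtD_rightFrame hs, map_zero]))
    (tangentTo_composable hgu (by rw [srcD_leftFrame hut, map_zero]))
    (by
      filter_upwards [eventually_eventually_nhds.2 (eventually_mulExt hgu),
        (smoothNear_mulExt hgu).eventually, m1] with p h1 h2 h3 h4
      rw [tderiv_eq_mulD h4 h2.mdifferentiableAt h1 (by rw [tgtD_rightFrame h3, map_zero]),
        mulD_rightFrame h4 h3, h1.self_of_nhds h4])
    (by
      filter_upwards [eventually_eventually_nhds.2 (eventually_mulExt hgu),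
        (smoothNear_mulExt hgu).eventually, m2] with p h1 h2 h3 h4
      rw [tderiv_eq_mulD h4 h2.mdifferentiableAt h1 (by rw [srcD_leftFrame h3, map_zero]),
        mulD_leftFrame h4 h3, h1.self_of_nhds h4])
  rw [hm] at key
  rw [← key, fieldBracket_prod (p := (g, u)) (V' := fun _ => 0) (W := fun _ => 0)
    (smoothFamily_rightFrame hs a) (z g) (z u) (smoothFamily_leftFrame hut b)]
  have e1 : fieldBracket 𝓘(ℝ, EG) (fun y => 𝒢.rightFrame x₀ y a) (fun _ : G => (0 : EG)) g = 0 :=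
    congrFun (VectorField.mlieBracket_zero_right (I := 𝓘(ℝ, EG))
      (W := fun y : G => (𝒢.rightFrame x₀ y a : TangentSpace 𝓘(ℝ, EG) y))) g
  have e2 : fieldBracket 𝓘(ℝ, EG) (fun _ : G => (0 : EG)) (fun y => 𝒢.leftFrame x₁ y b) u = 0 :=
    congrFun (VectorField.mlieBracket_zero_left (I := 𝓘(ℝ, EG))
      (W := fun y : G => (𝒢.leftFrame x₁ y b : TangentSpace 𝓘(ℝ, EG) y))) u
  rw [e1, e2]
  exact map_zero _

end Structure

end LieGroupoid

section BracketAlgebra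

variable {E H N : Type*} [NormedAddCommGroup E] [NormedSpace ℝ E] [TopologicalSpace H]
  {I : ModelWithCorners ℝ E H} [TopologicalSpace N] [ChartedSpace H N] [IsManifold I ∞ N]
  [I.Boundaryless] [CompleteSpace E]

theorem SmoothAlong.mdifferentiableAt_field {V : N → E} {x : N} (hV : SmoothField I V x) :
    MDifferentiableAt I I.tangent (fun y => (⟨y, V y⟩ : TangentBundle I N)) x :=
  SmoothNear.mdifferentiableAt hV

theorem fieldBracket_swap (V W : N → E) (x : N) : fieldBracket I V W x = -fieldBracket I W V x :=
  VectorField.mlieBracket_swap_apply (I := I) (V := fun y : N => (V y : TangentSpace I y))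
    (W := fun y => W y)

theorem fieldBracket_congr {V W V' W' : N → E} {x : N} (hV : V =ᶠ[𝓝 x] V') (hW : W =ᶠ[𝓝 x] W') :
    fieldBracket I V W x = fieldBracket I V' W' x :=
  Filter.EventuallyEq.mlieBracket_vectorField_eq (I := I)
    (V₁ := fun y : N => (V y : TangentSpace I y)) (W₁ := fun y => W y) hV hW

theorem fieldBracket_add_left {V V' : N → E} (W : N → E) {x : N} (hV : SmoothField I V x)
    (hV' : SmoothField I V' x) : fieldBracket I (fun y => V y + V' y) W x =
      fieldBracket I V W x + fieldBracket I V' W x :=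
  VectorField.mlieBracket_add_left (I := I) (V := fun y : N => (V y : TangentSpace I y))
    (V₁ := fun y => V' y) (W := fun y => W y) hV.mdifferentiableAt_field hV'.mdifferentiableAt_field

theorem fieldBracket_add_right (V : N → E) {W W' : N → E} {x : N} (hW : SmoothField I W x)
    (hW' : SmoothField I W' x) : fieldBracket I V (fun y => W y + W' y) x =
      fieldBracket I V W x + fieldBracket I V W' x :=
  VectorField.mlieBracket_add_right (I := I) (V := fun y : N => (V y : TangentSpace I y))
    (W := fun y => W y) (W₁ := fun y => W' y) hW.mdifferentiableAt_field hW'.mdifferentiableAt_field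

theorem fieldBracket_const_smul_right (V : N → E) {W : N → E} {x : N} (c : ℝ)
    (hW : SmoothField I W x) :
    fieldBracket I V (fun y => c • W y) x = c • fieldBracket I V W x :=
  VectorField.mlieBracket_const_smul_right (I := I) (V := fun y : N => (V y : TangentSpace I y))
    (W := fun y => W y) hW.mdifferentiableAt_field

theorem fieldBracket_jacobi {U V W : N → E} {x : N} (hU : SmoothField I U x)
    (hV : SmoothField I V x) (hW : SmoothField I W x) :
    fieldBracket I U (fieldBracket I V W) x + fieldBracket I V (fieldBracket I W U) x +
      fieldBracket I W (fieldBracket I U V) x = 0 := by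
  have hm : IsManifold I (minSmoothness ℝ 3) N := by
    simp only [minSmoothness_of_isRCLikeNormedField]
    exact IsManifold.of_le (n := ∞) (by norm_cast)
  have s : ∀ {Z : N → E}, SmoothField I Z x →
      ContMDiffAt I I.tangent (minSmoothness ℝ 2) (fun y => (⟨y, Z y⟩ : TangentBundle I N)) x := by
    intro Z hZ
    simp only [minSmoothness_of_isRCLikeNormedField]
    exact (SmoothNear.contMDiffAt hZ).of_le (by norm_cast)
  have h := VectorField.leibniz_identity_mlieBracket_apply (I := I)
    (U := fun y : N => (U y : TangentSpace I y)) (V := fun y => V y) (W := fun y => W y)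
    (s hU) (s hV) (s hW)
  have h' : fieldBracket I U (fieldBracket I V W) x =
    fieldBracket I (fieldBracket I U V) W x + fieldBracket I V (fieldBracket I U W) x := h
  have e1 : fieldBracket I V (fieldBracket I W U) x = -fieldBracket I V (fieldBracket I U W) x := by
    have : fieldBracket I W U = fun y => (-1 : ℝ) • fieldBracket I U W y := by
      funext y
      rw [fieldBracket_swap, neg_one_smul]
    rw [this, fieldBracket_const_smul_right V (-1) (hU.bracket hW), neg_one_smul]
  rw [h', e1, fieldBracket_swap W]
  abel

end BracketAlgebra

namespace LieGroupoid

variable {EG EM G M : Type*} [NormedAddCommGroup EG] [NormedSpace ℝ EG]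
  [NormedAddCommGroup EM] [NormedSpace ℝ EM] [TopologicalSpace G] [ChartedSpace EG G]
  [TopologicalSpace M] [ChartedSpace EM M] [FiniteDimensional ℝ EG] [FiniteDimensional ℝ EM]
  [IsManifold 𝓘(ℝ, EG) ∞ G] [IsManifold 𝓘(ℝ, EM) ∞ M] {𝒢 : LieGroupoid EG EM G M}

/-- The component of a section of `Vβ ⊕ Vα` in `Vβ`. -/
def fstField (σ : ∀ g, 𝒢.PTau g) (g : G) : EG := (σ g).1

/-- The component of a section of `Vβ ⊕ Vα` in `Vα`. -/
def sndField (σ : ∀ g, 𝒢.PTau g) (g : G) : EG := (σ g).2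

/-- The image of a section of `Vβ ⊕ Vα` under the anchor. -/
def sumField (σ : ∀ g, 𝒢.PTau g) (g : G) : EG := fstField σ g + sndField σ g

theorem pTau_ext {σ σ' : ∀ g, 𝒢.PTau g} {g : G} (h1 : fstField σ g = fstField σ' g)
    (h2 : sumField σ g = sumField σ' g) : σ g = σ' g := by
  refine Prod.ext h1 ?_
  rw [sumField, sumField, h1] at h2
  have h3 : sndField σ g = sndField σ' g := add_left_cancel h2
  exact h3

namespace IsPTauSection

variable {σ σ' : ∀ g, 𝒢.PTau g}

theorem smoothField_fst (hσ : 𝒢.IsPTauSection σ) (g : G) : SmoothField 𝓘(ℝ, EG) (fstField σ) g :=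
  hσ.smooth_fst.smoothNear g

theorem smoothField_snd (hσ : 𝒢.IsPTauSection σ) (g : G) : SmoothField 𝓘(ℝ, EG) (sndField σ) g :=
  hσ.smooth_snd.smoothNear g

theorem smoothField_sum (hσ : 𝒢.IsPTauSection σ) (g : G) : SmoothField 𝓘(ℝ, EG) (sumField σ) g :=
  (hσ.smoothField_fst g).add (hσ.smoothField_snd g)

theorem tgtD_fstField (hσ : 𝒢.IsPTauSection σ) (g : G) : 𝒢.tgtD g (fstField σ g) = 0 := hσ.tgt_fst g

theorem srcD_sndField (hσ : 𝒢.IsPTauSection σ) (g : G) : 𝒢.srcD g (sndField σ g) = 0 := hσ.src_snd g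

theorem srcD_sumField (hσ : 𝒢.IsPTauSection σ) (g : G) :
    𝒢.srcD g (sumField σ g) = 𝒢.srcD g (fstField σ g) := by
  rw [sumField, map_add, hσ.srcD_sndField, add_zero]

theorem tgtD_sumField (hσ : 𝒢.IsPTauSection σ) (g : G) :
    𝒢.tgtD g (sumField σ g) = 𝒢.tgtD g (sndField σ g) := by
  rw [sumField, map_add, hσ.tgtD_fstField, zero_add]

theorem of_fields (h1 : ∀ g, SmoothField 𝓘(ℝ, EG) (fstField σ) g)
    (h2 : ∀ g, SmoothField 𝓘(ℝ, EG) (sumField σ) g) (h3 : ∀ g, 𝒢.tgtD g (fstField σ g) = 0)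
    (h4 : ∀ g, 𝒢.srcD g (sndField σ g) = 0) : 𝒢.IsPTauSection σ where
  smooth_fst g := SmoothNear.contMDiffAt (h1 g)
  smooth_snd g := by
    refine SmoothNear.contMDiffAt (SmoothAlong.congr ((h2 g).sub (h1 g)) (W := sndField σ)
      (g := fun y => y) ?_)
    exact Eventually.of_forall fun y => ⟨rfl, (add_sub_cancel_left _ _).symm⟩
  tgt_fst := h3
  src_snd := h4

theorem exists_rightCoeff (hσ : 𝒢.IsPTauSection σ) {x₀ : M} {g : G} (hg : 𝒢.src g ∈ 𝒢.algBase x₀) :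
    ∃ w : G → AlgModel EG EM, SmoothNear 𝓘(ℝ, EG) 𝓘(ℝ, AlgModel EG EM) w g ∧
      ∀ᶠ y in 𝓝 g, 𝒢.rightFrame x₀ y (w y) = fstField σ y :=
  (smoothFamily_rightFrame hg).exists_coeff (hσ.smoothField_fst g) (rightFrame_injective hg)
    ((eventually_src_mem hg).mono fun y hy => exists_rightFrame hy (hσ.tgtD_fstField y))

theorem exists_leftCoeff (hσ : 𝒢.IsPTauSection σ) {x₀ : M} {g : G} (hg : 𝒢.tgt g ∈ 𝒢.algBase x₀) :
    ∃ v : G → AlgModel EG EM, SmoothNear 𝓘(ℝ, EG) 𝓘(ℝ, AlgModel EG EM) v g ∧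
      ∀ᶠ y in 𝓝 g, 𝒢.leftFrame x₀ y (v y) = sndField σ y :=
  (smoothFamily_leftFrame hg).exists_coeff (hσ.smoothField_snd g) (leftFrame_injective hg)
    ((eventually_tgt_mem hg).mono fun y hy => exists_leftFrame hy (hσ.srcD_sndField y))

end IsPTauSection

section Bracket

variable {σ σ' : ∀ g, 𝒢.PTau g} {x₀ : M} {g : G} {w w' : G → AlgModel EG EM}

/-- The left-invariant vector field of a section, read in the frame of right-invariant fields. -/
def starExt (𝒢 : LieGroupoid EG EM G M) (x₀ : M) (w : G → AlgModel EG EM) (U : G → EG)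
    (q : G × G) : EG × EG := (𝒢.rightFrame x₀ q.1 (w q.2), U q.2)

theorem starField_eq (hσ : 𝒢.IsPTauSection σ) {p : G × G} (hp : 𝒢.src p.1 = 𝒢.src p.2)
    (hs : 𝒢.src p.2 ∈ 𝒢.algBase x₀) (hw : 𝒢.rightFrame x₀ p.2 (w p.2) = fstField σ p.2) :
    (𝒢.starField σ p : EG × EG) = 𝒢.starExt x₀ w (sumField σ) p := by
  refine Prod.ext ?_ rfl
  have h1 : 𝒢.tgt (𝒢.inv p.2) = 𝒢.src p.1 := by rw [𝒢.tgt_inv, hp]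
  have h2 : 𝒢.tgt p.2 = 𝒢.src (𝒢.mul (𝒢.inv p.2) p.1) := by rw [𝒢.src_mul _ _ h1, 𝒢.src_inv]
  have h3 : 𝒢.mul p.2 (𝒢.mul (𝒢.inv p.2) p.1) = p.1 := by
    rw [𝒢.assoc _ _ _ (𝒢.src_inv _).symm h1, 𝒢.inv_right, ← hp, 𝒢.unit_left]
  have h4 := tangentR_eq h2 (hσ.tgtD_fstField p.2)
  rw [← congrArg (fun u : EG => 𝒢.mulD p.2 (𝒢.mul (𝒢.inv p.2) p.1) (u, 0)) hw,
    mulD_rightFrame h2 hs, h3] at h4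
  exact h4

theorem smoothField_starExt (hg : 𝒢.src g ∈ 𝒢.algBase x₀)
    (hw : SmoothNear 𝓘(ℝ, EG) 𝓘(ℝ, AlgModel EG EM) w g) (hσ : 𝒢.IsPTauSection σ) :
    SmoothField (𝓘(ℝ, EG).prod 𝓘(ℝ, EG)) (𝒢.starExt x₀ w (sumField σ)) (g, g) :=
  SmoothFamily.prodField (smoothFamily_rightFrame hg) hw (hσ.smoothField_sum g)

theorem tangentTo_starFibre (hg : 𝒢.src g ∈ 𝒢.algBase x₀) (hσ : 𝒢.IsPTauSection σ)
    (hwσ : 𝒢.rightFrame x₀ g (w g) = fstField σ g) :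
    TangentTo (𝓘(ℝ, EG).prod 𝓘(ℝ, EG)) (𝒢.starFibre g) (g, g)
      (𝒢.starExt x₀ w (sumField σ) (g, g)) := by
  refine TangentTo.mono (TangentTo.graph (TangentTo.fibre (c := 𝒢.tgt g) (𝒢.smoothNear_tgt g)
    (𝒢.surjective_tgtD g) rfl (tgtD_rightFrame hg _)) (𝒢.smoothNear_src g) (𝒢.surjective_srcD g)
    (𝒢.smoothNear_src g).mdifferentiableAt rfl ?_) fun p hp => ⟨hp.1, hp.2.symm⟩
  refine (hσ.srcD_sumField g).trans ?_
  rw [← hwσ]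
  rfl

theorem eventually_starField_eq (hg : 𝒢.src g ∈ 𝒢.algBase x₀) (hσ : 𝒢.IsPTauSection σ)
    (hwσ : ∀ᶠ y in 𝓝 g, 𝒢.rightFrame x₀ y (w y) = fstField σ y) :
    ∀ᶠ p : G × G in 𝓝 (g, g), p ∈ 𝒢.starFibre g →
      (𝒢.starField σ p : EG × EG) = 𝒢.starExt x₀ w (sumField σ) p := by
  filter_upwards [(continuousAt_snd (p := (g, g))).eventually hwσ,
    (continuousAt_snd (p := (g, g))).eventually (eventually_src_mem hg)] with p h1 h2 h3
  exact starField_eq hσ h3.2 h2 h1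

theorem pTauBracket_eq_starExt (hσ : 𝒢.IsPTauSection σ) (hσ' : 𝒢.IsPTauSection σ')
    (hg : 𝒢.src g ∈ 𝒢.algBase x₀)
    (hw : SmoothNear 𝓘(ℝ, EG) 𝓘(ℝ, AlgModel EG EM) w g)
    (hw' : SmoothNear 𝓘(ℝ, EG) 𝓘(ℝ, AlgModel EG EM) w' g)
    (hwσ : ∀ᶠ y in 𝓝 g, 𝒢.rightFrame x₀ y (w y) = fstField σ y)
    (hwσ' : ∀ᶠ y in 𝓝 g, 𝒢.rightFrame x₀ y (w' y) = fstField σ' y) :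
    (fstField (𝒢.pTauBracket σ σ') g, sumField (𝒢.pTauBracket σ σ') g) =
      fieldBracket (𝓘(ℝ, EG).prod 𝓘(ℝ, EG)) (𝒢.starExt x₀ w (sumField σ))
        (𝒢.starExt x₀ w' (sumField σ')) (g, g) := by
  have h := mlieBracketWithin_eq_fieldBracket (I := 𝓘(ℝ, EG).prod 𝓘(ℝ, EG))
    (V := fun q => (𝒢.starField σ q : EG × EG)) (W := fun q => (𝒢.starField σ' q : EG × EG))
    (smoothField_starExt hg hw hσ) (smoothField_starExt hg hw' hσ')
    (eventually_starField_eq hg hσ hwσ) (eventually_starField_eq hg hσ' hwσ')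
    (tangentTo_starFibre hg hσ hwσ.self_of_nhds) (tangentTo_starFibre hg hσ' hwσ'.self_of_nhds)
  rw [← h]
  refine Prod.ext rfl ?_
  exact add_sub_cancel _ _

theorem sumField_pTauBracket (hσ : 𝒢.IsPTauSection σ) (hσ' : 𝒢.IsPTauSection σ') (g : G) :
    sumField (𝒢.pTauBracket σ σ') g = fieldBracket 𝓘(ℝ, EG) (sumField σ) (sumField σ') g := by
  have hg := 𝒢.mem_algBase (𝒢.src g)
  obtain ⟨w, hw, hwσ⟩ := hσ.exists_rightCoeff hg
  obtain ⟨w', hw', hwσ'⟩ := hσ'.exists_rightCoeff hg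
  have e := pTauBracket_eq_starExt hσ hσ' hg hw hw' hwσ hwσ'
  unfold starExt at e
  rw [fieldBracket_prodField (smoothFamily_rightFrame hg) hw hw' (hσ.smoothField_sum g)
    (hσ'.smoothField_sum g)] at e
  exact congrArg Prod.snd e

theorem fstField_pTauBracket (hσ : 𝒢.IsPTauSection σ) (hσ' : 𝒢.IsPTauSection σ')
    (hg : 𝒢.src g ∈ 𝒢.algBase x₀)
    (hw : SmoothNear 𝓘(ℝ, EG) 𝓘(ℝ, AlgModel EG EM) w g)
    (hw' : SmoothNear 𝓘(ℝ, EG) 𝓘(ℝ, AlgModel EG EM) w' g)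
    (hwσ : ∀ᶠ y in 𝓝 g, 𝒢.rightFrame x₀ y (w y) = fstField σ y)
    (hwσ' : ∀ᶠ y in 𝓝 g, 𝒢.rightFrame x₀ y (w' y) = fstField σ' y) :
    fstField (𝒢.pTauBracket σ σ') g = 𝒢.rightFrame x₀ g (𝒢.structureFn x₀ (𝒢.src g) (w g) (w' g) +
      (tderiv 𝓘(ℝ, EG) 𝓘(ℝ, AlgModel EG EM) w' g (sumField σ g) -
        tderiv 𝓘(ℝ, EG) 𝓘(ℝ, AlgModel EG EM) w g (sumField σ' g))) := by
  have e := pTauBracket_eq_starExt hσ hσ' hg hw hw' hwσ hwσ'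
  unfold starExt at e
  rw [fieldBracket_prodField (smoothFamily_rightFrame hg) hw hw' (hσ.smoothField_sum g)
    (hσ'.smoothField_sum g), fieldBracket_rightFrame hg, ← map_add] at e
  exact congrArg Prod.fst e

theorem fieldBracket_rightCombination (hg : 𝒢.src g ∈ 𝒢.algBase x₀)
    (hw : SmoothNear 𝓘(ℝ, EG) 𝓘(ℝ, AlgModel EG EM) w g)
    (hw' : SmoothNear 𝓘(ℝ, EG) 𝓘(ℝ, AlgModel EG EM) w' g)
    (hwσ : ∀ᶠ y in 𝓝 g, 𝒢.rightFrame x₀ y (w y) = fstField σ y)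
    (hwσ' : ∀ᶠ y in 𝓝 g, 𝒢.rightFrame x₀ y (w' y) = fstField σ' y) :
    fieldBracket 𝓘(ℝ, EG) (fstField σ) (fstField σ') g =
      𝒢.rightFrame x₀ g (𝒢.structureFn x₀ (𝒢.src g) (w g) (w' g)) +
      𝒢.rightFrame x₀ g (tderiv 𝓘(ℝ, EG) 𝓘(ℝ, AlgModel EG EM) w' g (fstField σ g)) -
      𝒢.rightFrame x₀ g (tderiv 𝓘(ℝ, EG) 𝓘(ℝ, AlgModel EG EM) w g (fstField σ' g)) := by
  rw [← fieldBracket_congr hwσ hwσ', fieldBracket_families (smoothFamily_rightFrame hg)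
    (smoothFamily_rightFrame hg) hw hw', fieldBracket_rightFrame hg, hwσ.self_of_nhds,
    hwσ'.self_of_nhds]

theorem fstField_pTauBracket' (hσ : 𝒢.IsPTauSection σ) (hσ' : 𝒢.IsPTauSection σ')
    (hg : 𝒢.src g ∈ 𝒢.algBase x₀)
    (hw : SmoothNear 𝓘(ℝ, EG) 𝓘(ℝ, AlgModel EG EM) w g)
    (hw' : SmoothNear 𝓘(ℝ, EG) 𝓘(ℝ, AlgModel EG EM) w' g)
    (hwσ : ∀ᶠ y in 𝓝 g, 𝒢.rightFrame x₀ y (w y) = fstField σ y)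
    (hwσ' : ∀ᶠ y in 𝓝 g, 𝒢.rightFrame x₀ y (w' y) = fstField σ' y) :
    fstField (𝒢.pTauBracket σ σ') g = fieldBracket 𝓘(ℝ, EG) (fstField σ) (fstField σ') g +
      𝒢.rightFrame x₀ g (tderiv 𝓘(ℝ, EG) 𝓘(ℝ, AlgModel EG EM) w' g (sndField σ g) -
        tderiv 𝓘(ℝ, EG) 𝓘(ℝ, AlgModel EG EM) w g (sndField σ' g)) := by
  rw [fstField_pTauBracket hσ hσ' hg hw hw' hwσ hwσ',
    fieldBracket_rightCombination hg hw hw' hwσ hwσ', sumField, sumField]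
  simp only [map_add, map_sub]
  abel

/-- The bracket of a section of `Vβ` and a section of `Vα`. -/
theorem fieldBracket_fst_snd {x₁ : M} {v : G → AlgModel EG EM} (hg : 𝒢.src g ∈ 𝒢.algBase x₀)
    (ht : 𝒢.tgt g ∈ 𝒢.algBase x₁) (hw : SmoothNear 𝓘(ℝ, EG) 𝓘(ℝ, AlgModel EG EM) w g)
    (hv : SmoothNear 𝓘(ℝ, EG) 𝓘(ℝ, AlgModel EG EM) v g)
    (hwσ : ∀ᶠ y in 𝓝 g, 𝒢.rightFrame x₀ y (w y) = fstField σ y)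
    (hvσ : ∀ᶠ y in 𝓝 g, 𝒢.leftFrame x₁ y (v y) = sndField σ' y) :
    fieldBracket 𝓘(ℝ, EG) (fstField σ) (sndField σ') g =
      𝒢.leftFrame x₁ g (tderiv 𝓘(ℝ, EG) 𝓘(ℝ, AlgModel EG EM) v g (fstField σ g)) -
      𝒢.rightFrame x₀ g (tderiv 𝓘(ℝ, EG) 𝓘(ℝ, AlgModel EG EM) w g (sndField σ' g)) := by
  rw [← fieldBracket_congr hwσ hvσ, fieldBracket_families (smoothFamily_rightFrame hg)
    (smoothFamily_leftFrame ht) hw hv, fieldBracket_rightFrame_leftFrame hg ht, hwσ.self_of_nhds,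
    hvσ.self_of_nhds, zero_add]

theorem sndField_pTauBracket {x₁ : M} {v v' : G → AlgModel EG EM} (hσ : 𝒢.IsPTauSection σ)
    (hσ' : 𝒢.IsPTauSection σ') (ht : 𝒢.tgt g ∈ 𝒢.algBase x₁)
    (hv : SmoothNear 𝓘(ℝ, EG) 𝓘(ℝ, AlgModel EG EM) v g)
    (hv' : SmoothNear 𝓘(ℝ, EG) 𝓘(ℝ, AlgModel EG EM) v' g)
    (hvσ : ∀ᶠ y in 𝓝 g, 𝒢.leftFrame x₁ y (v y) = sndField σ y)
    (hvσ' : ∀ᶠ y in 𝓝 g, 𝒢.leftFrame x₁ y (v' y) = sndField σ' y) :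
    sndField (𝒢.pTauBracket σ σ') g = 𝒢.leftFrame x₁ g (𝒢.structureFn x₁ (𝒢.tgt g) (v g) (v' g) +
      (tderiv 𝓘(ℝ, EG) 𝓘(ℝ, AlgModel EG EM) v' g (sumField σ g) -
        tderiv 𝓘(ℝ, EG) 𝓘(ℝ, AlgModel EG EM) v g (sumField σ' g))) := by
  have hg := 𝒢.mem_algBase (𝒢.src g)
  obtain ⟨w, hw, hwσ⟩ := hσ.exists_rightCoeff hg
  obtain ⟨w', hw', hwσ'⟩ := hσ'.exists_rightCoeff hg
  have e1 := sumField_pTauBracket hσ hσ' g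
  have e2 := fstField_pTauBracket' hσ hσ' hg hw hw' hwσ hwσ'
  have e3 : fieldBracket 𝓘(ℝ, EG) (sumField σ) (sumField σ') g =
      fieldBracket 𝓘(ℝ, EG) (fstField σ) (fstField σ') g +
      fieldBracket 𝓘(ℝ, EG) (fstField σ) (sndField σ') g +
      (fieldBracket 𝓘(ℝ, EG) (sndField σ) (fstField σ') g +
      fieldBracket 𝓘(ℝ, EG) (sndField σ) (sndField σ') g) := by
    unfold sumField
    rw [fieldBracket_add_left _ (hσ.smoothField_fst g) (hσ.smoothField_snd g),
      fieldBracket_add_right _ (hσ'.smoothField_fst g) (hσ'.smoothField_snd g),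
      fieldBracket_add_right _ (hσ'.smoothField_fst g) (hσ'.smoothField_snd g)]
  have e4 : fieldBracket 𝓘(ℝ, EG) (sndField σ) (sndField σ') g =
      𝒢.leftFrame x₁ g (𝒢.structureFn x₁ (𝒢.tgt g) (v g) (v' g)) +
      𝒢.leftFrame x₁ g (tderiv 𝓘(ℝ, EG) 𝓘(ℝ, AlgModel EG EM) v' g (sndField σ g)) -
      𝒢.leftFrame x₁ g (tderiv 𝓘(ℝ, EG) 𝓘(ℝ, AlgModel EG EM) v g (sndField σ' g)) := by
    rw [← fieldBracket_congr hvσ hvσ', fieldBracket_families (smoothFamily_leftFrame ht)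
      (smoothFamily_leftFrame ht) hv hv', fieldBracket_leftFrame ht, hvσ.self_of_nhds,
      hvσ'.self_of_nhds]
  rw [fieldBracket_swap (sndField σ) (fstField σ'),
    fieldBracket_fst_snd hg ht hw hv' hwσ hvσ', fieldBracket_fst_snd hg ht hw' hv hwσ' hvσ, e4] at e3
  have e5 : sndField (𝒢.pTauBracket σ σ') g =
      sumField (𝒢.pTauBracket σ σ') g - fstField (𝒢.pTauBracket σ σ') g :=
    (add_sub_cancel_left _ _).symm
  rw [e5, e1, e2, e3, sumField, sumField]
  simp only [map_add, map_sub]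
  abel

theorem IsPTauSection.bracket (hσ : 𝒢.IsPTauSection σ) (hσ' : 𝒢.IsPTauSection σ') :
    𝒢.IsPTauSection (𝒢.pTauBracket σ σ') := by
  refine IsPTauSection.of_fields (fun g => ?_) (fun g => ?_) (fun g => ?_) (fun g => ?_)
  · have hg := 𝒢.mem_algBase (𝒢.src g)
    obtain ⟨w, hw, hwσ⟩ := hσ.exists_rightCoeff hg
    obtain ⟨w', hw', hwσ'⟩ := hσ'.exists_rightCoeff hg
    have h1 := ((hσ.smoothField_fst g).bracket (hσ'.smoothField_fst g)).add
      (SmoothFamily.apply (f := fun y => y) (smoothFamily_rightFrame hg) (SmoothNear.id g)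
        (((hσ.smoothField_snd g).deriv hw').sub ((hσ'.smoothField_snd g).deriv hw)))
    refine SmoothAlong.congr h1 ?_
    filter_upwards [hw.eventually, hw'.eventually, eventually_eventually_nhds.2 hwσ,
      eventually_eventually_nhds.2 hwσ', eventually_src_mem hg] with y a1 a2 a3 a4 a5
    exact ⟨rfl, fstField_pTauBracket' hσ hσ' a5 a1 a2 a3 a4⟩
  · refine SmoothAlong.congr ((hσ.smoothField_sum g).bracket (hσ'.smoothField_sum g)) ?_
    exact Eventually.of_forall fun y => ⟨rfl, sumField_pTauBracket hσ hσ' y⟩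
  · have hg := 𝒢.mem_algBase (𝒢.src g)
    obtain ⟨w, hw, hwσ⟩ := hσ.exists_rightCoeff hg
    obtain ⟨w', hw', hwσ'⟩ := hσ'.exists_rightCoeff hg
    rw [fstField_pTauBracket hσ hσ' hg hw hw' hwσ hwσ', tgtD_rightFrame hg]
  · have hg := 𝒢.mem_algBase (𝒢.tgt g)
    obtain ⟨w, hw, hwσ⟩ := hσ.exists_leftCoeff hg
    obtain ⟨w', hw', hwσ'⟩ := hσ'.exists_leftCoeff hg
    rw [sndField_pTauBracket hσ hσ' hg hw hw' hwσ hwσ', srcD_leftFrame hg]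

end Bracket

section LieAlgebra

variable {σ σ' σ'' : ∀ g, 𝒢.PTau g}

theorem IsPTauSection.zero : 𝒢.IsPTauSection 0 :=
  IsPTauSection.of_fields (fun g => SmoothAlong.zero (SmoothNear.id g))
    (fun g => SmoothAlong.congr (SmoothAlong.zero (SmoothNear.id g))
      (Eventually.of_forall fun _ => ⟨rfl, add_zero (0 : EG)⟩))
    (fun _ => map_zero _) (fun _ => map_zero _)

theorem IsPTauSection.add (hσ : 𝒢.IsPTauSection σ) (hσ' : 𝒢.IsPTauSection σ') :
    𝒢.IsPTauSection (σ + σ') :=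
  IsPTauSection.of_fields (fun g => (hσ.smoothField_fst g).add (hσ'.smoothField_fst g))
    (fun g => SmoothAlong.congr ((hσ.smoothField_sum g).add (hσ'.smoothField_sum g))
      (Eventually.of_forall fun y => ⟨rfl, add_add_add_comm _ _ _ _⟩))
    (fun g => (map_add (𝒢.tgtD g) (fstField σ g) (fstField σ' g)).trans (by
      rw [hσ.tgtD_fstField, hσ'.tgtD_fstField, add_zero]))
    (fun g => (map_add (𝒢.srcD g) (sndField σ g) (sndField σ' g)).trans (by
      rw [hσ.srcD_sndField, hσ'.srcD_sndField, add_zero]))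

/-- The product of a section with a smooth function is a section. -/
theorem IsPTauSection.smul {f : G → ℝ} (hf : ContMDiff 𝓘(ℝ, EG) 𝓘(ℝ, ℝ) ∞ f)
    (hσ : 𝒢.IsPTauSection σ) : 𝒢.IsPTauSection (fun g => f g • σ g) :=
  IsPTauSection.of_fields (fun g => SmoothAlong.smul (hf.smoothNear g) (hσ.smoothField_fst g))
    (fun g => SmoothAlong.congr (SmoothAlong.smul (hf.smoothNear g) (hσ.smoothField_sum g))
      (Eventually.of_forall fun y => ⟨rfl, (smul_add (f y) (fstField σ y) (sndField σ y)).symm⟩))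
    (fun g => (map_smul (𝒢.tgtD g) (f g) (fstField σ g)).trans (by
      rw [hσ.tgtD_fstField, smul_zero]))
    (fun g => (map_smul (𝒢.srcD g) (f g) (sndField σ g)).trans (by
      rw [hσ.srcD_sndField, smul_zero]))

theorem IsPTauSection.const_smul (c : ℝ) (hσ : 𝒢.IsPTauSection σ) : 𝒢.IsPTauSection (c • σ) :=
  hσ.smul (f := fun _ => c) contMDiff_const

theorem sumField_add (σ σ' : ∀ g, 𝒢.PTau g) (g : G) :
    sumField (σ + σ') g = sumField σ g + sumField σ' g := add_add_add_comm _ _ _ _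

theorem sumField_smul (c : ℝ) (σ : ∀ g, 𝒢.PTau g) (g : G) :
    sumField (c • σ) g = c • sumField σ g := (smul_add c (fstField σ g) (sndField σ g)).symm

theorem pTauBracket_add (hσ : 𝒢.IsPTauSection σ) (hσ' : 𝒢.IsPTauSection σ')
    (hσ'' : 𝒢.IsPTauSection σ'') :
    𝒢.pTauBracket σ (σ' + σ'') = 𝒢.pTauBracket σ σ' + 𝒢.pTauBracket σ σ'' := by
  funext g
  have hg := 𝒢.mem_algBase (𝒢.src g)
  obtain ⟨w, hw, hwσ⟩ := hσ.exists_rightCoeff hg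
  obtain ⟨w', hw', hwσ'⟩ := hσ'.exists_rightCoeff hg
  obtain ⟨w'', hw'', hwσ''⟩ := hσ''.exists_rightCoeff hg
  have hadd : ∀ᶠ y in 𝓝 g, 𝒢.rightFrame (𝒢.src g) y (w' y + w'' y) = fstField (σ' + σ'') y := by
    filter_upwards [hwσ', hwσ''] with y h1 h2
    rw [map_add, h1, h2]
    rfl
  refine pTau_ext ?_ ?_
  · refine Eq.trans ?_ (congrArg₂ (· + ·) (fstField_pTauBracket' hσ hσ' hg hw hw' hwσ hwσ')
      (fstField_pTauBracket' hσ hσ'' hg hw hw'' hwσ hwσ'')).symm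
    rw [fstField_pTauBracket' hσ (hσ'.add hσ'') hg hw (hw'.add hw'') hwσ hadd,
      tderiv_add hw'.mdifferentiableAt hw''.mdifferentiableAt,
      show sndField (σ' + σ'') g = sndField σ' g + sndField σ'' g from rfl,
      show fstField (σ' + σ'') = fun y => fstField σ' y + fstField σ'' y from rfl,
      fieldBracket_add_right _ (hσ'.smoothField_fst g) (hσ''.smoothField_fst g)]
    simp only [map_add, map_sub]
    abel
  · rw [sumField_pTauBracket hσ (hσ'.add hσ''), sumField_add, sumField_pTauBracket hσ hσ',
      sumField_pTauBracket hσ hσ'', funext (sumField_add σ' σ''),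
      fieldBracket_add_right _ (hσ'.smoothField_sum g) (hσ''.smoothField_sum g)]

theorem pTauBracket_smul (c : ℝ) (hσ : 𝒢.IsPTauSection σ) (hσ' : 𝒢.IsPTauSection σ') :
    𝒢.pTauBracket σ (c • σ') = c • 𝒢.pTauBracket σ σ' := by
  funext g
  have hg := 𝒢.mem_algBase (𝒢.src g)
  obtain ⟨w, hw, hwσ⟩ := hσ.exists_rightCoeff hg
  obtain ⟨w', hw', hwσ'⟩ := hσ'.exists_rightCoeff hg
  have hsm : ∀ᶠ y in 𝓝 g, 𝒢.rightFrame (𝒢.src g) y (c • w' y) = fstField (c • σ') y := by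
    filter_upwards [hwσ'] with y h1
    rw [map_smul, h1]
    rfl
  refine pTau_ext ?_ ?_
  · refine Eq.trans ?_ (congrArg (c • ·) (fstField_pTauBracket' hσ hσ' hg hw hw' hwσ hwσ')).symm
    rw [fstField_pTauBracket' hσ (hσ'.const_smul c) hg hw ((SmoothNear.const c g).smul hw') hwσ hsm,
      tderiv_smul (SmoothNear.const c g).mdifferentiableAt hw'.mdifferentiableAt, tderiv_const,
      show sndField (c • σ') g = c • sndField σ' g from rfl,
      show fstField (c • σ') = fun y => c • fstField σ' y from rfl,
      fieldBracket_const_smul_right _ c (hσ'.smoothField_fst g)]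
    simp only [map_smul, map_sub, smul_add, smul_sub, zero_apply, zero_smul, zero_add]
  · rw [sumField_pTauBracket hσ (hσ'.const_smul c), sumField_smul, sumField_pTauBracket hσ hσ',
      funext (sumField_smul c σ'), fieldBracket_const_smul_right _ c (hσ'.smoothField_sum g)]

theorem pTauBracket_skew (hσ : 𝒢.IsPTauSection σ) (hσ' : 𝒢.IsPTauSection σ') :
    𝒢.pTauBracket σ σ' = -𝒢.pTauBracket σ' σ := by
  funext g
  have hg := 𝒢.mem_algBase (𝒢.src g)
  obtain ⟨w, hw, hwσ⟩ := hσ.exists_rightCoeff hg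
  obtain ⟨w', hw', hwσ'⟩ := hσ'.exists_rightCoeff hg
  have e := pTauBracket_eq_starExt hσ hσ' hg hw hw' hwσ hwσ'
  rw [fieldBracket_swap, ← pTauBracket_eq_starExt hσ' hσ hg hw' hw hwσ' hwσ] at e
  have e1 := congrArg (Prod.fst : EG × EG → EG) e
  have e2 := congrArg (Prod.snd : EG × EG → EG) e
  refine pTau_ext e1 (e2.trans ?_)
  exact neg_add (fstField (𝒢.pTauBracket σ' σ) g) (sndField (𝒢.pTauBracket σ' σ) g)

/-- The bracket of sections corresponds to the bracket of left-invariant vector fields. -/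
theorem fieldBracket_starExt {x₀ : M} {g : G} {w w' z : G → AlgModel EG EM}
    (hσ : 𝒢.IsPTauSection σ) (hσ' : 𝒢.IsPTauSection σ') (hg : 𝒢.src g ∈ 𝒢.algBase x₀)
    (hw : SmoothNear 𝓘(ℝ, EG) 𝓘(ℝ, AlgModel EG EM) w g)
    (hw' : SmoothNear 𝓘(ℝ, EG) 𝓘(ℝ, AlgModel EG EM) w' g)
    (hwσ : ∀ᶠ y in 𝓝 g, 𝒢.rightFrame x₀ y (w y) = fstField σ y)
    (hwσ' : ∀ᶠ y in 𝓝 g, 𝒢.rightFrame x₀ y (w' y) = fstField σ' y)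
    (hz : ∀ᶠ y in 𝓝 g, 𝒢.rightFrame x₀ y (z y) = fstField (𝒢.pTauBracket σ σ') y) :
    ∀ᶠ p : G × G in 𝓝 (g, g), 𝒢.src p.1 = 𝒢.src p.2 →
      fieldBracket (𝓘(ℝ, EG).prod 𝓘(ℝ, EG)) (𝒢.starExt x₀ w (sumField σ))
        (𝒢.starExt x₀ w' (sumField σ')) p = 𝒢.starExt x₀ z (sumField (𝒢.pTauBracket σ σ')) p := by
  have c := (continuousAt_snd (p := (g, g)))
  filter_upwards [c.eventually hw.eventually, c.eventually hw'.eventually,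
    c.eventually (eventually_eventually_nhds.2 hwσ), c.eventually (eventually_eventually_nhds.2 hwσ'),
    c.eventually hz, c.eventually (eventually_src_mem hg)] with p a1 a2 a3 a4 a5 a6 a7
  obtain ⟨k, p⟩ := p
  simp only at a1 a2 a3 a4 a5 a6 a7
  have hk : 𝒢.src k ∈ 𝒢.algBase x₀ := by rwa [a7]
  rw [fstField_pTauBracket hσ hσ' a6 a1 a2 a3 a4] at a5
  have e := rightFrame_injective a6 a5
  unfold starExt
  rw [fieldBracket_prodField (smoothFamily_rightFrame hk) a1 a2 (hσ.smoothField_sum p)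
    (hσ'.smoothField_sum p), fieldBracket_rightFrame hk, ← map_add, sumField_pTauBracket hσ hσ', e, a7]

theorem fieldBracket_starExt_starExt {x₀ : M} {g : G} {w w' w'' : G → AlgModel EG EM}
    (hσ : 𝒢.IsPTauSection σ) (hσ' : 𝒢.IsPTauSection σ') (hσ'' : 𝒢.IsPTauSection σ'')
    (hg : 𝒢.src g ∈ 𝒢.algBase x₀)
    (hw : SmoothNear 𝓘(ℝ, EG) 𝓘(ℝ, AlgModel EG EM) w g)
    (hw' : SmoothNear 𝓘(ℝ, EG) 𝓘(ℝ, AlgModel EG EM) w' g)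
    (hw'' : SmoothNear 𝓘(ℝ, EG) 𝓘(ℝ, AlgModel EG EM) w'' g)
    (hwσ : ∀ᶠ y in 𝓝 g, 𝒢.rightFrame x₀ y (w y) = fstField σ y)
    (hwσ' : ∀ᶠ y in 𝓝 g, 𝒢.rightFrame x₀ y (w' y) = fstField σ' y)
    (hwσ'' : ∀ᶠ y in 𝓝 g, 𝒢.rightFrame x₀ y (w'' y) = fstField σ'' y) :
    (fstField (𝒢.pTauBracket σ (𝒢.pTauBracket σ' σ'')) g,
      sumField (𝒢.pTauBracket σ (𝒢.pTauBracket σ' σ'')) g) =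
    fieldBracket (𝓘(ℝ, EG).prod 𝓘(ℝ, EG)) (𝒢.starExt x₀ w (sumField σ))
      (fieldBracket (𝓘(ℝ, EG).prod 𝓘(ℝ, EG)) (𝒢.starExt x₀ w' (sumField σ'))
        (𝒢.starExt x₀ w'' (sumField σ''))) (g, g) := by
  have hb := hσ'.bracket hσ''
  obtain ⟨z, hz, hzσ⟩ := hb.exists_rightCoeff hg
  have h1 := fieldBracket_starExt hσ' hσ'' hg hw' hw'' hwσ' hwσ'' hzσ
  rw [pTauBracket_eq_starExt hσ hb hg hw hz hwσ hzσ]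
  have s1 := smoothField_starExt hg hw hσ
  have s2 := (smoothField_starExt hg hw' hσ').bracket (smoothField_starExt hg hw'' hσ'')
  have s3 := smoothField_starExt hg hz hb
  have t1 := (tangentTo_starFibre hg hσ hwσ.self_of_nhds)
  have t3 := (tangentTo_starFibre hg hb hzσ.self_of_nhds)
  have e := mlieBracketWithin_eq_fieldBracket (s := 𝒢.starFibre g) s1 s3
    (V := 𝒢.starExt x₀ w (sumField σ)) (W := 𝒢.starExt x₀ z (sumField (𝒢.pTauBracket σ' σ'')))
    (Eventually.of_forall fun _ _ => rfl) (Eventually.of_forall fun _ _ => rfl) t1 t3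
  rw [← e]
  refine mlieBracketWithin_eq_fieldBracket s1 s2 (Eventually.of_forall fun _ _ => rfl)
    (h1.mono fun p hp hs => (hp hs.2).symm) t1 ?_
  rw [h1.self_of_nhds rfl]
  exact t3

theorem pTauBracket_jacobi (hσ : 𝒢.IsPTauSection σ) (hσ' : 𝒢.IsPTauSection σ')
    (hσ'' : 𝒢.IsPTauSection σ'') :
    𝒢.pTauBracket σ (𝒢.pTauBracket σ' σ'') + 𝒢.pTauBracket σ' (𝒢.pTauBracket σ'' σ)
      + 𝒢.pTauBracket σ'' (𝒢.pTauBracket σ σ') = 0 := by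
  funext g
  have hg := 𝒢.mem_algBase (𝒢.src g)
  obtain ⟨w, hw, hwσ⟩ := hσ.exists_rightCoeff hg
  obtain ⟨w', hw', hwσ'⟩ := hσ'.exists_rightCoeff hg
  obtain ⟨w'', hw'', hwσ''⟩ := hσ''.exists_rightCoeff hg
  have key := fieldBracket_jacobi (smoothField_starExt hg hw hσ) (smoothField_starExt hg hw' hσ')
    (smoothField_starExt hg hw'' hσ'')
  rw [← fieldBracket_starExt_starExt hσ hσ' hσ'' hg hw hw' hw'' hwσ hwσ' hwσ'',
    ← fieldBracket_starExt_starExt hσ' hσ'' hσ hg hw' hw'' hw hwσ' hwσ'' hwσ,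
    ← fieldBracket_starExt_starExt hσ'' hσ hσ' hg hw'' hw hw' hwσ'' hwσ hwσ'] at key
  have e1 := congrArg (Prod.fst : EG × EG → EG) key
  have e2 := congrArg (Prod.snd : EG × EG → EG) key
  refine pTau_ext e1 ?_
  rw [sumField_add, sumField_add]
  refine e2.trans ?_
  exact (add_zero (0 : EG)).symm

variable (𝒢) in
theorem pTau_isLieAlgebra : 𝒢.pTau.IsLieAlgebra where
  zero := IsPTauSection.zero
  add _ _ h h' := IsPTauSection.add h h'
  smul c _ h := IsPTauSection.const_smul c h
  bracket _ _ h h' := IsPTauSection.bracket h h'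
  bracket_add _ _ _ h h' h'' := pTauBracket_add h h' h''
  bracket_smul c _ _ h h' := pTauBracket_smul c h h'
  bracket_skew _ _ h h' := pTauBracket_skew h h'
  jacobi _ _ _ h h' h'' := pTauBracket_jacobi h h' h''

end LieAlgebra

end LieGroupoid

namespace BundleBracket

variable {E H N : Type*} [NormedAddCommGroup E] [NormedSpace ℝ E] [TopologicalSpace H]
  [TopologicalSpace N] [ChartedSpace H N] {I : ModelWithCorners ℝ E H} {V : N → Type*}
  [∀ x, AddCommGroup (V x)] [∀ x, Module ℝ (V x)] {A : BundleBracket I N V}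

/-- The anchor is a homomorphism, and sections differentiate smooth functions. -/
structure IsLieAlgebroid (A : BundleBracket I N V) : Prop extends A.IsLieAlgebra where
  smooth_deriv : ∀ f σ, IsSmoothFun I f → A.IsSection σ → IsSmoothFun I (A.deriv f σ)
  deriv_bracket : ∀ f σ σ', IsSmoothFun I f → A.IsSection σ → A.IsSection σ' → ∀ x,
    A.deriv f (A.bracket σ σ') x = A.deriv (A.deriv f σ') σ x - A.deriv (A.deriv f σ) σ' x

theorem _root_.IsSmoothFun.mdifferentiableAt {f : N → ℝ} (hf : IsSmoothFun I f) (x : N) :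
    MDifferentiableAt I 𝓘(ℝ, ℝ) f x := hf.mdifferentiable (by simp) x

theorem _root_.IsSmoothFun.add {f g : N → ℝ} (hf : IsSmoothFun I f) (hg : IsSmoothFun I g) :
    IsSmoothFun I (f + g) := ContMDiff.add hf hg

theorem _root_.IsSmoothFun.sub {f g : N → ℝ} (hf : IsSmoothFun I f) (hg : IsSmoothFun I g) :
    IsSmoothFun I (f - g) := ContMDiff.sub hf hg

theorem _root_.IsSmoothFun.mul {f g : N → ℝ} (hf : IsSmoothFun I f) (hg : IsSmoothFun I g) :
    IsSmoothFun I (f * g) := ContMDiff.mul hf hg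

theorem _root_.IsSmoothFun.const_smul (c : ℝ) {f : N → ℝ} (hf : IsSmoothFun I f) :
    IsSmoothFun I (c • f) := ContMDiff.mul (contMDiff_const (c := c)) hf

section Deriv

theorem deriv_eq (f : N → ℝ) (σ : ∀ x, V x) (x : N) :
    A.deriv f σ x = tderiv I 𝓘(ℝ, ℝ) f x (A.anchor x (σ x)) := rfl

theorem deriv_add {f g : N → ℝ} (hf : IsSmoothFun I f) (hg : IsSmoothFun I g) (σ : ∀ x, V x)
    (x : N) : A.deriv (f + g) σ x = A.deriv f σ x + A.deriv g σ x :=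
  tderiv_add (hf.mdifferentiableAt x) (hg.mdifferentiableAt x) _

theorem deriv_sub {f g : N → ℝ} (hf : IsSmoothFun I f) (hg : IsSmoothFun I g) (σ : ∀ x, V x)
    (x : N) : A.deriv (f - g) σ x = A.deriv f σ x - A.deriv g σ x :=
  tderiv_sub (hf.mdifferentiableAt x) (hg.mdifferentiableAt x) _

theorem deriv_neg (f : N → ℝ) (σ : ∀ x, V x) (x : N) : A.deriv (-f) σ x = -A.deriv f σ x := by
  have h : ∀ v : E, tderiv I 𝓘(ℝ, ℝ) (-f) x v = -tderiv I 𝓘(ℝ, ℝ) f x v := tderiv_neg f x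
  exact h _

theorem deriv_mul {f g : N → ℝ} (hf : IsSmoothFun I f) (hg : IsSmoothFun I g) (σ : ∀ x, V x)
    (x : N) : A.deriv (f * g) σ x = f x * A.deriv g σ x + g x * A.deriv f σ x := by
  rw [mul_comm (g x), add_comm]
  exact tderiv_mul (hf.mdifferentiableAt x) (hg.mdifferentiableAt x) _

theorem deriv_smul (c : ℝ) {f : N → ℝ} (hf : IsSmoothFun I f) (σ : ∀ x, V x) (x : N) :
    A.deriv (c • f) σ x = c * A.deriv f σ x := by
  have h : ∀ v : E, tderiv I 𝓘(ℝ, ℝ) (c • f) x v = c * tderiv I 𝓘(ℝ, ℝ) f x v := fun v => by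
    have := tderiv_smul (mdifferentiableAt_const (c := c)) (hf.mdifferentiableAt x) v
    rw [tderiv_const, zero_apply, zero_smul, zero_add] at this
    exact this
  exact h _

theorem deriv_add_section (f : N → ℝ) (σ σ' : ∀ x, V x) (x : N) :
    A.deriv f (σ + σ') x = A.deriv f σ x + A.deriv f σ' x := by
  simp only [deriv_eq, Pi.add_apply]
  exact (congrArg (tderiv I 𝓘(ℝ, ℝ) f x) ((A.anchor x).map_add _ _)).trans (map_add _ _ _)

theorem deriv_smul_section (f : N → ℝ) (c : ℝ) (σ : ∀ x, V x) (x : N) :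
    A.deriv f (c • σ) x = c * A.deriv f σ x := by
  simp only [deriv_eq, Pi.smul_apply]
  exact (congrArg (tderiv I 𝓘(ℝ, ℝ) f x) ((A.anchor x).map_smul _ _)).trans (map_smul _ _ _)

end Deriv

section Closed

variable (hA : A.IsLieAlgebroid) {θ : ∀ x, V x →ₗ[ℝ] ℝ}
  (hθ : ∀ σ, A.IsSection σ → IsSmoothFun I (fun y => θ y (σ y)))

theorem extDeriv_eq (θ : ∀ x, V x →ₗ[ℝ] ℝ) (σ σ' : ∀ x, V x) :
    A.extDeriv θ σ σ' = A.deriv (fun y => θ y (σ' y)) σ - A.deriv (fun y => θ y (σ y)) σ' -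
      (fun y => θ y (A.bracket σ σ' y)) := rfl

include hA in
theorem extDeriv_skew {σ σ' : ∀ x, V x} (hσ : A.IsSection σ) (hσ' : A.IsSection σ') :
    A.extDeriv θ σ σ' = -A.extDeriv θ σ' σ := by
  funext x
  rw [Pi.neg_apply, extDeriv, extDeriv, hA.bracket_skew σ σ' hσ hσ', Pi.neg_apply, map_neg]
  ring

include hA hθ in
theorem deriv_extDeriv {σ σ' : ∀ x, V x} (hσ : A.IsSection σ) (hσ' : A.IsSection σ')
    (τ : ∀ x, V x) (x : N) : A.deriv (A.extDeriv θ σ σ') τ x =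
      A.deriv (A.deriv (fun y => θ y (σ' y)) σ) τ x - A.deriv (A.deriv (fun y => θ y (σ y)) σ') τ x -
      A.deriv (fun y => θ y (A.bracket σ σ' y)) τ x := by
  have h1 := hA.smooth_deriv _ _ (hθ _ hσ') hσ
  have h2 := hA.smooth_deriv _ _ (hθ _ hσ) hσ'
  rw [extDeriv_eq, deriv_sub (IsSmoothFun.sub h1 h2) (hθ _ (hA.bracket _ _ hσ hσ')),
    deriv_sub h1 h2]

include hA hθ in
/-- The differential of a `1`-section is closed. -/
theorem extDeriv_closed {a b c : ∀ x, V x} (ha : A.IsSection a) (hb : A.IsSection b)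
    (hc : A.IsSection c) (x : N) :
    A.deriv (A.extDeriv θ b c) a x + A.deriv (A.extDeriv θ c a) b x + A.deriv (A.extDeriv θ a b) c x -
      A.extDeriv θ (A.bracket a b) c x - A.extDeriv θ (A.bracket b c) a x -
      A.extDeriv θ (A.bracket c a) b x = 0 := by
  have hab := hA.bracket _ _ ha hb
  have hbc := hA.bracket _ _ hb hc
  have hca := hA.bracket _ _ hc ha
  rw [deriv_extDeriv hA hθ hb hc, deriv_extDeriv hA hθ hc ha, deriv_extDeriv hA hθ ha hb,
    extDeriv, extDeriv, extDeriv, hA.deriv_bracket _ _ _ (hθ _ hc) ha hb,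
    hA.deriv_bracket _ _ _ (hθ _ ha) hb hc, hA.deriv_bracket _ _ _ (hθ _ hb) hc ha]
  have hj := congrArg (θ x) (congrFun (hA.jacobi a b c ha hb hc) x)
  simp only [Pi.add_apply, map_add, Pi.zero_apply, map_zero] at hj
  rw [hA.bracket_skew a (A.bracket b c) ha hbc, hA.bracket_skew b (A.bracket c a) hb hca,
    hA.bracket_skew c (A.bracket a b) hc hab] at hj
  simp only [Pi.neg_apply, map_neg] at hj
  linear_combination -hj

/-- The `2`-section `-dθ`. -/
def twoSection (A : BundleBracket I N V) (θ : ∀ x, V x →ₗ[ℝ] ℝ) (σ σ' : ∀ x, V x) : N → ℝ :=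
  -A.extDeriv θ σ σ'

include hA in
theorem twoSection_skew {σ σ' : ∀ x, V x} (hσ : A.IsSection σ) (hσ' : A.IsSection σ') :
    A.twoSection θ σ σ' = -A.twoSection θ σ' σ := by
  rw [twoSection, twoSection, extDeriv_skew hA hσ hσ']

include hA hθ in
theorem IsHamiltonian.bracket {f g : N → ℝ} {ξ η : ∀ x, V x} (hf : IsSmoothFun I f)
    (hg : IsSmoothFun I g) (hξ : A.IsHamiltonian (A.twoSection θ) f ξ)
    (hη : A.IsHamiltonian (A.twoSection θ) g η) :
    A.IsHamiltonian (A.twoSection θ) (A.deriv g ξ) (A.bracket ξ η) := by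
  refine ⟨hA.bracket _ _ hξ.1 hη.1, fun σ hσ => ?_⟩
  funext x
  have hcl := extDeriv_closed hA hθ hξ.1 hη.1 hσ x
  have e : ∀ {h : N → ℝ} {ζ : ∀ x, V x}, A.IsHamiltonian (A.twoSection θ) h ζ → ∀ τ, A.IsSection τ →
      A.extDeriv θ ζ τ = -A.deriv h τ := by
    intro h ζ hζ τ hτ
    rw [← hζ.2 τ hτ, twoSection, neg_neg]
  have e1 := e hξ η hη.1
  have e3 := e hη σ hσ
  have e4 : A.extDeriv θ σ ξ = A.deriv f σ := by
    rw [extDeriv_skew hA hσ hξ.1, e hξ σ hσ, neg_neg]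
  have e5 : A.extDeriv θ (A.bracket η σ) ξ = A.deriv f (A.bracket η σ) := by
    rw [extDeriv_skew hA (hA.bracket _ _ hη.1 hσ) hξ.1, e hξ _ (hA.bracket _ _ hη.1 hσ), neg_neg]
  have e6 : A.extDeriv θ (A.bracket σ ξ) η = A.deriv g (A.bracket σ ξ) := by
    rw [extDeriv_skew hA (hA.bracket _ _ hσ hξ.1) hη.1, e hη _ (hA.bracket _ _ hσ hξ.1), neg_neg]
  have e7 : A.deriv f η = -A.deriv g ξ := by
    have h1 := e hη ξ hξ.1
    rw [extDeriv_skew hA hη.1 hξ.1, e1, neg_neg] at h1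
    exact h1
  rw [e1, e3, e4, e5, e6, deriv_neg, deriv_neg, hA.deriv_bracket _ _ _ hf hη.1 hσ,
    hA.deriv_bracket _ _ _ hg hσ hξ.1, e7, deriv_neg] at hcl
  change -(A.extDeriv θ (A.bracket ξ η) σ x) = _
  linear_combination hcl

include hA hθ in
theorem isLieSubalgebra_hamiltonian :
    A.IsLieSubalgebra {ξ | ∃ f, IsSmoothFun I f ∧ A.IsHamiltonian (A.twoSection θ) f ξ} where
  isSection := fun _ ⟨_, _, h⟩ => h.1
  zero := by
    refine ⟨0, contMDiff_const, hA.zero, fun σ hσ => ?_⟩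
    funext x
    have h0 : A.bracket 0 σ = 0 := by
      have h1 := hA.bracket_smul 0 σ 0 hσ hA.zero
      rw [zero_smul, zero_smul] at h1
      rw [hA.bracket_skew 0 σ hA.zero hσ, h1, neg_zero]
    have h2 : A.deriv 0 σ x = 0 := by
      have := deriv_smul (A := A) 0 (f := 0) (contMDiff_const (I := I)) σ x
      rwa [zero_smul, zero_mul] at this
    have h3 : A.deriv (fun y => θ y (σ y)) 0 x = 0 := by
      have := deriv_smul_section (A := A) (fun y => θ y (σ y)) 0 0 x
      rwa [zero_smul, zero_mul] at this
    have h4 : (fun y => θ y ((0 : ∀ x, V x) y)) = 0 := by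
      funext y; exact map_zero _
    rw [h2, twoSection, Pi.neg_apply, extDeriv, h0, h4, h3, h2, Pi.zero_apply, map_zero]
    simp
  add := by
    rintro σ ⟨f, hf, hσ⟩ σ' ⟨f', hf', hσ'⟩
    refine ⟨f + f', hf.add hf', hA.add _ _ hσ.1 hσ'.1, fun τ hτ => ?_⟩
    funext x
    rw [deriv_add hf hf', ← hσ.2 τ hτ, ← hσ'.2 τ hτ,
      twoSection_skew hA (hA.add _ _ hσ.1 hσ'.1) hτ, twoSection_skew hA hσ.1 hτ,
      twoSection_skew hA hσ'.1 hτ]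
    simp only [twoSection, Pi.neg_apply, extDeriv, hA.bracket_add _ _ _ hτ hσ.1 hσ'.1,
      deriv_add_section, Pi.add_apply, map_add]
    have := deriv_add (A := A) (hθ _ hσ.1) (hθ _ hσ'.1) τ x
    rw [show (fun y => θ y (σ y) + θ y (σ' y)) =
      (fun y => θ y (σ y)) + (fun y => θ y (σ' y)) from rfl, this]
    ring
  smul := by
    rintro c σ ⟨f, hf, hσ⟩
    refine ⟨c • f, hf.const_smul c, hA.smul _ _ hσ.1, fun τ hτ => ?_⟩
    funext x
    rw [deriv_smul c hf, ← hσ.2 τ hτ,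
      twoSection_skew hA (hA.smul _ _ hσ.1) hτ, twoSection_skew hA hσ.1 hτ]
    simp only [twoSection, Pi.neg_apply, extDeriv, hA.bracket_smul _ _ _ hτ hσ.1,
      deriv_smul_section, Pi.smul_apply, map_smul, smul_eq_mul]
    have := deriv_smul (A := A) c (hθ _ hσ.1) τ x
    rw [show (fun y => c * θ y (σ y)) = c • (fun y => θ y (σ y)) from rfl, this]
    ring
  bracket := by
    rintro σ ⟨f, hf, hσ⟩ σ' ⟨f', hf', hσ'⟩
    exact ⟨_, hA.smooth_deriv _ _ hf' hσ.1, IsHamiltonian.bracket hA hθ hf hf' hσ hσ'⟩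

end Closed

section Poisson

variable {Ω : (∀ x, V x) → (∀ x, V x) → N → ℝ}
  (hex : ∀ f, IsSmoothFun I f → ∃! ξ, A.IsHamiltonian Ω f ξ)

include hex in
theorem isHamiltonian_ham {f : N → ℝ} (hf : IsSmoothFun I f) : A.IsHamiltonian Ω f (A.ham Ω f) :=
  Classical.epsilon_spec (hex f hf).exists

include hex in
theorem ham_eq {f : N → ℝ} (hf : IsSmoothFun I f) {ξ : ∀ x, V x} (hξ : A.IsHamiltonian Ω f ξ) :
    A.ham Ω f = ξ := (hex f hf).unique (isHamiltonian_ham hex hf) hξ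

include hex in
theorem poisson_apply {f g : N → ℝ} (hf : IsSmoothFun I f) (hg : IsSmoothFun I g) (x : N) :
    A.poisson Ω f g x = -A.deriv f (A.ham Ω g) x := by
  rw [poisson, (isHamiltonian_ham hex hf).2 _ (isHamiltonian_ham hex hg).1]
  rfl

variable {θ : ∀ x, V x →ₗ[ℝ] ℝ} (hA : A.IsLieAlgebroid)
  (hθ : ∀ σ, A.IsSection σ → IsSmoothFun I (fun y => θ y (σ y)))
  (hex' : ∀ f, IsSmoothFun I f → ∃! ξ, A.IsHamiltonian (A.twoSection θ) f ξ)

include hA hex' in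
theorem poisson_apply' {f g : N → ℝ} (hf : IsSmoothFun I f) (hg : IsSmoothFun I g) (x : N) :
    A.poisson (A.twoSection θ) f g x = A.deriv g (A.ham (A.twoSection θ) f) x := by
  have hξ := isHamiltonian_ham hex' hf
  have hη := isHamiltonian_ham hex' hg
  rw [poisson, twoSection_skew hA hξ.1 hη.1, neg_neg, hη.2 _ hξ.1]

include hA hθ hex' in
theorem isPoissonBracket : IsPoissonBracket I (A.poisson (A.twoSection θ)) := by
  have l := fun {f g : N → ℝ} (hf : IsSmoothFun I f) (hg : IsSmoothFun I g) (x : N) =>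
    poisson_apply hex' hf hg x
  have r := fun {f g : N → ℝ} (hf : IsSmoothFun I f) (hg : IsSmoothFun I g) (x : N) =>
    poisson_apply' hA hex' hf hg x
  have hs := fun {f : N → ℝ} (hf : IsSmoothFun I f) => (isHamiltonian_ham hex' hf).1
  have sm : ∀ f g, IsSmoothFun I f → IsSmoothFun I g →
      IsSmoothFun I (A.poisson (A.twoSection θ) f g) := by
    intro f g hf hg
    rw [funext (r hf hg)]
    exact hA.smooth_deriv _ _ hg (hs hf)
  have sk : ∀ f g, IsSmoothFun I f → IsSmoothFun I g →
      A.poisson (A.twoSection θ) f g = -A.poisson (A.twoSection θ) g f := by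
    intro f g hf hg
    funext x
    rw [Pi.neg_apply, l hf hg, r hg hf]
  refine ⟨sm, sk, ?_, ?_, ?_, ?_, ?_, ?_, ?_⟩
  · intro f g h hf hg hh
    funext x
    rw [Pi.add_apply, l (hf.add hg) hh, l hf hh, l hg hh, deriv_add hf hg, neg_add]
  · intro f g h hf hg hh
    funext x
    rw [Pi.add_apply, r hf (hg.add hh), r hf hg, r hf hh, deriv_add hg hh]
  · intro c f g hf hg
    funext x
    rw [Pi.smul_apply, l (hf.const_smul c) hg, l hf hg, deriv_smul c hf, smul_eq_mul,
      mul_neg]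
  · intro c f g hf hg
    funext x
    rw [Pi.smul_apply, r hf (hg.const_smul c), r hf hg, deriv_smul c hg, smul_eq_mul]
  · intro f g h hf hg hh
    funext x
    rw [Pi.add_apply, Pi.mul_apply, Pi.mul_apply, l (hf.mul hg) hh, l hf hh, l hg hh,
      deriv_mul hf hg]
    ring
  · intro f g h hf hg hh
    funext x
    rw [Pi.add_apply, Pi.mul_apply, Pi.mul_apply, r hf (hg.mul hh), r hf hg, r hf hh,
      deriv_mul hg hh]
  · intro f g h hf hg hh
    have hb := IsHamiltonian.bracket hA hθ hf hg (isHamiltonian_ham hex' hf)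
      (isHamiltonian_ham hex' hg)
    rw [← funext (r hf hg)] at hb
    have e1 := ham_eq hex' (sm f g hf hg) hb
    funext x
    rw [Pi.add_apply, Pi.add_apply, r hf (sm g h hg hh), r hg (sm h f hh hf), l hh (sm f g hf hg),
      e1, hA.deriv_bracket h _ _ hh (hs hf) (hs hg), funext (r hg hh), sk h f hh hf, deriv_neg,
      funext (r hf hh), Pi.zero_apply]
    ring

end Poisson

section Existence

/-- A local frame near `x₀` in which the `2`-section `Ω` is given by a smooth family of bilinear
forms. -/
def HasFrame (A : BundleBracket I N V) (Ω : (∀ x, V x) → (∀ x, V x) → N → ℝ) (x₀ : N)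
    (F : Type*) [NormedAddCommGroup F] [NormedSpace ℝ F] : Prop :=
  ∃ (e : ∀ y, F → V y) (B : N → F →L[ℝ] F →L[ℝ] ℝ),
    SmoothNear I 𝓘(ℝ, F →L[ℝ] F →L[ℝ] ℝ) B x₀ ∧ (∀ a, e x₀ a = 0 → a = 0) ∧
    (∀ᶠ z in 𝓝 x₀, ∀ c : N → F, SmoothNear I 𝓘(ℝ, F) c z →
      ∃ τ, A.IsSection τ ∧ ∀ᶠ y in 𝓝 z, τ y = e y (c y)) ∧
    (∀ᶠ y in 𝓝 x₀, ∀ τ, A.IsSection τ → ∃ a, τ y = e y a) ∧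
    (∀ᶠ y in 𝓝 x₀, ∀ σ τ, A.IsSection σ → A.IsSection τ → ∀ a b, σ y = e y a → τ y = e y b →
      Ω σ τ y = B y a b) ∧
    (∀ f, IsSmoothFun I f → ∃ l : N → F →L[ℝ] ℝ, SmoothNear I 𝓘(ℝ, F →L[ℝ] ℝ) l x₀ ∧
      ∀ᶠ y in 𝓝 x₀, ∀ a, tderiv I 𝓘(ℝ, ℝ) f y (A.anchor y (e y a)) = l y a)

variable {Ω : (∀ x, V x) → (∀ x, V x) → N → ℝ} {F : Type*} [NormedAddCommGroup F] [NormedSpace ℝ F]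
  [FiniteDimensional ℝ F]

theorem HasFrame.injective {x₀ : N} (h : A.HasFrame Ω x₀ F) (hΩ : A.Nondegenerate Ω)
    {σ τ : ∀ x, V x} (hσ : A.IsSection σ) (hτ : A.IsSection τ)
    (hst : ∀ κ, A.IsSection κ → Ω σ κ x₀ = Ω τ κ x₀) : σ x₀ = τ x₀ := by
  obtain ⟨e, B, -, h2, h3, h4, h5, -⟩ := h
  obtain ⟨a, ha⟩ := h4.self_of_nhds σ hσ
  obtain ⟨b, hb⟩ := h4.self_of_nhds τ hτ
  obtain ⟨κ, hκ, hκe⟩ := h3.self_of_nhds (fun _ => a - b) (SmoothNear.const _ _)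
  have h6 : κ x₀ = 0 := by
    refine hΩ κ hκ x₀ fun ρ hρ => ?_
    obtain ⟨c, hc⟩ := h4.self_of_nhds ρ hρ
    have e0 := hst ρ hρ
    rw [h5.self_of_nhds σ ρ hσ hρ a c ha hc, h5.self_of_nhds τ ρ hτ hρ b c hb hc] at e0
    rw [h5.self_of_nhds κ ρ hκ hρ _ c hκe.self_of_nhds hc, map_sub, sub_apply, e0, sub_self]
  rw [hκe.self_of_nhds] at h6
  rw [ha, hb, sub_eq_zero.1 (h2 _ h6)]

theorem HasFrame.exists_hamiltonian_near {x₀ : N} (h : A.HasFrame Ω x₀ F) (hΩ : A.Nondegenerate Ω)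
    {f : N → ℝ} (hf : IsSmoothFun I f) : ∃ ξ, A.IsSection ξ ∧
      ∀ᶠ y in 𝓝 x₀, ∀ σ, A.IsSection σ → Ω ξ σ y = A.deriv f σ y := by
  obtain ⟨e, B, h1, h2, h3, h4, h5, h6⟩ := h
  obtain ⟨l, hl, hle⟩ := h6 f hf
  have hinj : Function.Injective (B x₀) := by
    rw [injective_iff_map_eq_zero]
    intro a ha
    obtain ⟨κ, hκ, hκe⟩ := h3.self_of_nhds (fun _ => a) (SmoothNear.const _ _)
    apply h2
    rw [← hκe.self_of_nhds]
    refine hΩ κ hκ x₀ fun ρ hρ => ?_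
    obtain ⟨c, hc⟩ := h4.self_of_nhds ρ hρ
    rw [h5.self_of_nhds κ ρ hκ hρ _ c hκe.self_of_nhds hc, ha, zero_apply]
  have hinv : (B x₀).IsInvertible := by
    have hd : Module.finrank ℝ F = Module.finrank ℝ (F →L[ℝ] ℝ) := by
      rw [← LinearEquiv.finrank_eq (LinearMap.toContinuousLinearMap (𝕜 := ℝ) (E := F) (F' := ℝ)),
        Subspace.dual_finrank_eq]
    refine ⟨(LinearEquiv.ofInjectiveOfFinrankEq (B x₀ : F →ₗ[ℝ] (F →L[ℝ] ℝ)) hinj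
      hd).toContinuousLinearEquiv, ?_⟩
    ext v
    rfl
  obtain ⟨ξ, hξ, hξe⟩ := h3.self_of_nhds (fun y => (B y).inverse (l y))
    ((h1.clm_inverse hinv).clm_apply hl)
  refine ⟨ξ, hξ, ?_⟩
  filter_upwards [hξe, h4, h5, hle, h1.continuousAt.eventually
    (ContinuousLinearEquiv.isOpen.mem_nhds hinv)] with y k1 k2 k3 k4 k5 σ hσ
  obtain ⟨b, hb⟩ := k2 σ hσ
  rw [k3 ξ σ hξ hσ _ b k1 hb, deriv_eq, hb, k4]
  rw [ContinuousLinearMap.IsInvertible.self_apply_inverse k5]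

/-- A nondegenerate `2`-section with local frames has unique Hamiltonian sections. -/
theorem existsUnique_hamiltonian (hΩ : A.Nondegenerate Ω) (hF : ∀ x, A.HasFrame Ω x F)
    (hloc : ∀ σ, (∀ x, ∃ τ, A.IsSection τ ∧ ∀ᶠ y in 𝓝 x, σ y = τ y) → A.IsSection σ)
    {f : N → ℝ} (hf : IsSmoothFun I f) : ∃! ξ, A.IsHamiltonian Ω f ξ := by
  choose ξ h1 h2 using fun x => (hF x).exists_hamiltonian_near hΩ hf
  have hs : A.IsSection fun x => ξ x x := by
    refine hloc _ fun x => ⟨ξ x, h1 x, ?_⟩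
    filter_upwards [h2 x] with y hy
    exact (hF y).injective hΩ (h1 y) (h1 x) fun κ hκ => by
      rw [(h2 y).self_of_nhds κ hκ, hy κ hκ]
  have hval : ∀ x σ, A.IsSection σ → Ω (fun x => ξ x x) σ x = A.deriv f σ x := by
    intro x σ hσ
    rw [← (h2 x).self_of_nhds σ hσ]
    obtain ⟨e, B, -, -, -, h4, h5, -⟩ := hF x
    obtain ⟨a, ha⟩ := h4.self_of_nhds _ (h1 x)
    obtain ⟨b, hb⟩ := h4.self_of_nhds σ hσ
    rw [h5.self_of_nhds _ _ (h1 x) hσ a b ha hb, h5.self_of_nhds _ _ hs hσ a b ha hb]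
  refine ⟨fun x => ξ x x, ⟨hs, fun σ hσ => funext fun x => hval x σ hσ⟩, fun η hη => ?_⟩
  funext x
  exact (hF x).injective (τ := fun x => ξ x x) hΩ hη.1 hs fun κ hκ => by rw [hval x κ hκ, hη.2 κ hκ]

end Existence

end BundleBracket

namespace BundleBracket

section Coordinates

variable {E H N : Type*} [NormedAddCommGroup E] [NormedSpace ℝ E] [TopologicalSpace H]
  [TopologicalSpace N] [ChartedSpace H N] {I : ModelWithCorners ℝ E H} {V : N → Type*}
  [∀ x, AddCommGroup (V x)] [∀ x, Module ℝ (V x)] {A : BundleBracket I N V}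
  {F F' : Type*} [NormedAddCommGroup F] [NormedSpace ℝ F] [NormedAddCommGroup F'] [NormedSpace ℝ F']

/-- The image of a section under the anchor. -/
def anchorField (A : BundleBracket I N V) (σ : ∀ x, V x) (x : N) : E := A.anchor x (σ x)

/-- The `2`-section `-dθ` in coordinates in which `θ(σ) = l v` and the bracket has coordinates
`C + ρ(σ) v' - ρ(σ') v`. -/
theorem twoSection_coord {θ : ∀ x, V x →ₗ[ℝ] ℝ} {σ σ' : ∀ x, V x} {x : N} {l : N → F →L[ℝ] ℝ}
    {v v' : N → F} {C : F} (hl : SmoothNear I 𝓘(ℝ, F →L[ℝ] ℝ) l x) (hv : SmoothNear I 𝓘(ℝ, F) v x)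
    (hv' : SmoothNear I 𝓘(ℝ, F) v' x) (h : ∀ᶠ y in 𝓝 x, θ y (σ y) = l y (v y))
    (h' : ∀ᶠ y in 𝓝 x, θ y (σ' y) = l y (v' y))
    (hb : θ x (A.bracket σ σ' x) = l x (C + (tderiv I 𝓘(ℝ, F) v' x (A.anchorField σ x) -
      tderiv I 𝓘(ℝ, F) v x (A.anchorField σ' x)))) :
    A.twoSection θ σ σ' x = -tderiv I 𝓘(ℝ, F →L[ℝ] ℝ) l x (A.anchorField σ x) (v' x) +
      tderiv I 𝓘(ℝ, F →L[ℝ] ℝ) l x (A.anchorField σ' x) (v x) + l x C := by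
  have e1 : A.deriv (fun y => θ y (σ' y)) σ x = tderiv I 𝓘(ℝ, ℝ) (fun y => l y (v' y)) x
      (A.anchorField σ x) :=
    congrArg (fun L : E →L[ℝ] ℝ => L (A.anchorField σ x)) (tderiv_congr h')
  have e2 : A.deriv (fun y => θ y (σ y)) σ' x = tderiv I 𝓘(ℝ, ℝ) (fun y => l y (v y)) x
      (A.anchorField σ' x) :=
    congrArg (fun L : E →L[ℝ] ℝ => L (A.anchorField σ' x)) (tderiv_congr h)
  rw [tderiv_clm_apply hl.mdifferentiableAt hv'.mdifferentiableAt] at e1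
  rw [tderiv_clm_apply hl.mdifferentiableAt hv.mdifferentiableAt] at e2
  rw [twoSection, Pi.neg_apply, extDeriv, e1, e2, hb, map_add, map_sub]
  ring

/-- The bilinear form of the `2`-section `-dθ` in a frame, where `T` is the anchor and `P` the
projection to the coordinates on which `θ` depends. -/
def frameForm (I : ModelWithCorners ℝ E H) (T : N → F' →L[ℝ] E) (P : F' →L[ℝ] F)
    (l : N → F →L[ℝ] ℝ) (c : N → F →L[ℝ] F →L[ℝ] F) (y : N) : F' →L[ℝ] F' →L[ℝ] ℝ :=
  -(((tderiv I 𝓘(ℝ, F →L[ℝ] ℝ) l y).comp (T y)).bilinearComp (ContinuousLinearMap.id ℝ F') P) +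
    (((tderiv I 𝓘(ℝ, F →L[ℝ] ℝ) l y).comp (T y)).bilinearComp (ContinuousLinearMap.id ℝ F') P).flip +
    (ContinuousLinearMap.compL ℝ F' F ℝ (l y)).comp ((c y).bilinearComp P P)

theorem frameForm_apply (T : N → F' →L[ℝ] E) (P : F' →L[ℝ] F) (l : N → F →L[ℝ] ℝ)
    (c : N → F →L[ℝ] F →L[ℝ] F) (y : N) (s t : F') :
    frameForm I T P l c y s t = -tderiv I 𝓘(ℝ, F →L[ℝ] ℝ) l y (T y s) (P t) +
      tderiv I 𝓘(ℝ, F →L[ℝ] ℝ) l y (T y t) (P s) + l y (c y (P s) (P t)) := rfl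

theorem smoothNear_frameForm [FiniteDimensional ℝ F] [FiniteDimensional ℝ F'] [IsManifold I ∞ N]
    {T : N → F' →L[ℝ] E} (P : F' →L[ℝ] F) {l : N → F →L[ℝ] ℝ} {c : N → F →L[ℝ] F →L[ℝ] F} {x : N}
    (hT : SmoothFamily I T x) (hl : SmoothNear I 𝓘(ℝ, F →L[ℝ] ℝ) l x)
    (hc : ∀ a b, SmoothNear I 𝓘(ℝ, F) (fun y => c y a b) x) :
    SmoothNear I 𝓘(ℝ, F' →L[ℝ] F' →L[ℝ] ℝ) (frameForm I T P l c) x := by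
  refine SmoothNear.of_apply fun s => SmoothNear.of_apply fun t => ?_
  simp only [frameForm_apply]
  have d : ∀ s a, SmoothNear I 𝓘(ℝ, ℝ)
      (fun y => tderiv I 𝓘(ℝ, F →L[ℝ] ℝ) l y (T y s) a) x := fun s a =>
    SmoothNear.clm_apply ((hT s).deriv hl) (SmoothNear.const a x)
  exact ((d s (P t)).neg.add (d t (P s))).add (SmoothNear.clm_apply hl (hc (P s) (P t)))

theorem hasFrame_of_frameForm [FiniteDimensional ℝ F] [FiniteDimensional ℝ F'] [IsManifold I ∞ N]
    [I.Boundaryless]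
    {Ω : (∀ x, V x) → (∀ x, V x) → N → ℝ} {e : ∀ y, F' → V y}
    {T : N → F' →L[ℝ] E} (P : F' →L[ℝ] F) {l : N → F →L[ℝ] ℝ} {c : N → F →L[ℝ] F →L[ℝ] F} {x : N}
    (hT : SmoothFamily I T x) (hl : SmoothNear I 𝓘(ℝ, F →L[ℝ] ℝ) l x)
    (hc : ∀ a b, SmoothNear I 𝓘(ℝ, F) (fun y => c y a b) x)
    (hinj : ∀ a, e x a = 0 → a = 0)
    (hsec : ∀ᶠ z in 𝓝 x, ∀ c : N → F', SmoothNear I 𝓘(ℝ, F') c z →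
      ∃ τ, A.IsSection τ ∧ ∀ᶠ y in 𝓝 z, τ y = e y (c y))
    (hspan : ∀ᶠ y in 𝓝 x, ∀ τ, A.IsSection τ → ∃ a, τ y = e y a)
    (hanchor : ∀ᶠ y in 𝓝 x, ∀ s, (A.anchor y (e y s) : E) = T y s)
    (hΩ : ∀ᶠ y in 𝓝 x, ∀ σ τ, A.IsSection σ → A.IsSection τ → ∀ a b, σ y = e y a → τ y = e y b →
      Ω σ τ y = frameForm I T P l c y a b) : A.HasFrame Ω x F' := by
  refine ⟨e, frameForm I T P l c, smoothNear_frameForm P hT hl hc, hinj, hsec, hspan, hΩ, ?_⟩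
  intro f hf
  refine ⟨fun y => (tderiv I 𝓘(ℝ, ℝ) f y).comp (T y), hT.coord (ContMDiff.smoothNear hf x), ?_⟩
  filter_upwards [hanchor] with y hy a
  exact congrArg (tderiv I 𝓘(ℝ, ℝ) f y) (hy a)

end Coordinates

end BundleBracket

namespace LieGroupoid

variable {EG EM G M : Type*} [NormedAddCommGroup EG] [NormedSpace ℝ EG]
  [NormedAddCommGroup EM] [NormedSpace ℝ EM] [TopologicalSpace G] [ChartedSpace EG G]
  [TopologicalSpace M] [ChartedSpace EM M] [FiniteDimensional ℝ EG] [FiniteDimensional ℝ EM]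
  [IsManifold 𝓘(ℝ, EG) ∞ G] [IsManifold 𝓘(ℝ, EM) ∞ M] {𝒢 : LieGroupoid EG EM G M}

section StructureFunctions

variable {x₀ x : M}

theorem tgt_unit_mem (hx : x ∈ 𝒢.algBase x₀) : 𝒢.tgt (𝒢.unit x) ∈ 𝒢.algBase x₀ := by
  rwa [𝒢.tgt_unit]

theorem structureFn_eq (hx : x ∈ 𝒢.algBase x₀) {a b d : AlgModel EG EM}
    (h : 𝒢.leftBracket x₀ a b (𝒢.unit x) = 𝒢.unitFrame x₀ x d) : 𝒢.structureFn x₀ x a b = d :=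
  unitFrame_injective hx ((unitFrame_structureFn hx a b).trans h)

theorem structureFn_swap (hx : x ∈ 𝒢.algBase x₀) (a b : AlgModel EG EM) :
    𝒢.structureFn x₀ x a b = -𝒢.structureFn x₀ x b a := by
  refine structureFn_eq hx ?_
  rw [map_neg, unitFrame_structureFn hx]
  exact fieldBracket_swap _ _ _

theorem structureFn_add (hx : x ∈ 𝒢.algBase x₀) (a b b' : AlgModel EG EM) :
    𝒢.structureFn x₀ x a (b + b') = 𝒢.structureFn x₀ x a b + 𝒢.structureFn x₀ x a b' := by
  refine structureFn_eq hx ?_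
  rw [map_add, unitFrame_structureFn hx, unitFrame_structureFn hx]
  unfold leftBracket
  simp only [map_add]
  exact fieldBracket_add_right _ (smoothFamily_leftFrame (tgt_unit_mem hx) b)
    (smoothFamily_leftFrame (tgt_unit_mem hx) b')

theorem structureFn_smul (hx : x ∈ 𝒢.algBase x₀) (r : ℝ) (a b : AlgModel EG EM) :
    𝒢.structureFn x₀ x a (r • b) = r • 𝒢.structureFn x₀ x a b := by
  refine structureFn_eq hx ?_
  rw [map_smul, unitFrame_structureFn hx]
  unfold leftBracket
  simp only [map_smul]
  exact fieldBracket_const_smul_right _ r (smoothFamily_leftFrame (tgt_unit_mem hx) b)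

theorem smoothNear_structureFn (hx : x ∈ 𝒢.algBase x₀) (a b : AlgModel EG EM) :
    SmoothNear 𝓘(ℝ, EM) 𝓘(ℝ, AlgModel EG EM) (fun y => 𝒢.structureFn x₀ y a b) x := by
  have hu := tgt_unit_mem hx
  have hT := smoothFamily_leftFrame (𝒢 := 𝒢) hu
  obtain ⟨w, hw, hwe⟩ := hT.exists_coeff (V := 𝒢.leftBracket x₀ a b) ((hT a).bracket (hT b))
    (leftFrame_injective hu) (by
      filter_upwards [eventually_tgt_mem hu] with y hy
      exact ⟨_, (fieldBracket_leftFrame hy a b).symm⟩)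
  refine (hw.comp (𝒢.smoothNear_unit x)).congr ?_
  filter_upwards [(𝒢.smoothNear_unit x).continuousAt.eventually hwe,
    (𝒢.isOpen_algBase x₀).mem_nhds hx] with y h1 h2
  refine structureFn_eq h2 ?_
  rw [← leftFrame_unit h2, h1]

open Classical in
/-- The structure functions as a bilinear map. -/
def structureBilin (𝒢 : LieGroupoid EG EM G M) (x₀ x : M) :
    AlgModel EG EM →L[ℝ] AlgModel EG EM →L[ℝ] AlgModel EG EM :=
  if hx : x ∈ 𝒢.algBase x₀ then
    LinearMap.toContinuousLinearMap
      ((LinearMap.toContinuousLinearMap :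
        (AlgModel EG EM →ₗ[ℝ] AlgModel EG EM) ≃ₗ[ℝ] _).toLinearMap ∘ₗ
      LinearMap.mk₂ ℝ (𝒢.structureFn x₀ x)
        (fun a a' b => by
          rw [structureFn_swap hx, structureFn_add hx, neg_add, ← structureFn_swap hx,
            ← structureFn_swap hx])
        (fun r a b => by
          rw [structureFn_swap hx, structureFn_smul hx, ← smul_neg, ← structureFn_swap hx])
        (structureFn_add hx) (fun r a b => structureFn_smul hx r a b))
  else 0

theorem structureBilin_apply (hx : x ∈ 𝒢.algBase x₀) (a b : AlgModel EG EM) :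
    𝒢.structureBilin x₀ x a b = 𝒢.structureFn x₀ x a b := by
  rw [structureBilin, dif_pos hx]
  rfl

theorem smoothNear_structureBilin (hx : x ∈ 𝒢.algBase x₀) (a b : AlgModel EG EM) :
    SmoothNear 𝓘(ℝ, EM) 𝓘(ℝ, AlgModel EG EM) (fun y => 𝒢.structureBilin x₀ y a b) x := by
  refine (smoothNear_structureFn hx a b).congr ?_
  filter_upwards [(𝒢.isOpen_algBase x₀).mem_nhds hx] with y hy
  exact structureBilin_apply hy a b

end StructureFunctions

end LieGroupoid

/-- A vector field along a map into a vector space is smooth if both are smooth maps. -/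
theorem SmoothAlong.of_space {E H N E' : Type*} [NormedAddCommGroup E] [NormedSpace ℝ E]
    [TopologicalSpace H] {I : ModelWithCorners ℝ E H} [TopologicalSpace N] [ChartedSpace H N]
    [IsManifold I ∞ N] [NormedAddCommGroup E'] [NormedSpace ℝ E'] {f : N → E'} {V : N → E'} {x : N}
    (hf : SmoothNear I 𝓘(ℝ, E') f x) (hV : SmoothNear I 𝓘(ℝ, E') V x) :
    SmoothAlong I 𝓘(ℝ, E') f V x := by
  refine SmoothAlong.of_coord hf ?_
  simp only [extChartAt_model_space_eq_id]
  have : ∀ y : E', tderiv 𝓘(ℝ, E') 𝓘(ℝ, E') (PartialEquiv.refl E') y = ContinuousLinearMap.id ℝ E' :=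
    fun y => tderiv_id y
  simp only [this]
  exact hV

namespace LieGroupoid

variable {EG EM G M : Type*} [NormedAddCommGroup EG] [NormedSpace ℝ EG]
  [NormedAddCommGroup EM] [NormedSpace ℝ EM] [TopologicalSpace G] [ChartedSpace EG G]
  [TopologicalSpace M] [ChartedSpace EM M] [FiniteDimensional ℝ EG] [FiniteDimensional ℝ EM]
  [IsManifold 𝓘(ℝ, EG) ∞ G] [IsManifold 𝓘(ℝ, EM) ∞ M]

section DualCoordinates

/-- The trivialization of `A^*G` near `x₀`. -/
abbrev dualTriv (𝒢 : LieGroupoid EG EM G M) (x₀ : M) :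
    Trivialization (AlgModel EG EM →L[ℝ] ℝ)
      (π (AlgModel EG EM →L[ℝ] ℝ) (fun x : M => 𝒢.Alg x →L[ℝ] Bundle.Trivial M ℝ x)) :=
  trivializationAt (AlgModel EG EM →L[ℝ] ℝ) (fun x : M => 𝒢.Alg x →L[ℝ] Bundle.Trivial M ℝ x) x₀

/-- The fibre coordinate of `A^*G` near `x₀`. -/
def dualCoord (𝒢 : LieGroupoid EG EM G M) (x₀ : M) (μ : 𝒢.Dual) : AlgModel EG EM →L[ℝ] ℝ :=
  (𝒢.dualTriv x₀ μ).2

/-- The trivialization of `A^*G` near `x₀`, as a map. -/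
def dualChart (𝒢 : LieGroupoid EG EM G M) (x₀ : M) (μ : 𝒢.Dual) : M × (AlgModel EG EM →L[ℝ] ℝ) :=
  (μ.proj, 𝒢.dualCoord x₀ μ)

/-- The inverse of the trivialization of `A^*G` near `x₀`. -/
def dualSymm (𝒢 : LieGroupoid EG EM G M) (x₀ : M) (p : M × (AlgModel EG EM →L[ℝ] ℝ)) : 𝒢.Dual :=
  (𝒢.dualTriv x₀).toOpenPartialHomeomorph.symm p

variable {𝒢 : LieGroupoid EG EM G M} {x₀ : M}

theorem dualTriv_baseSet : (𝒢.dualTriv x₀).baseSet = 𝒢.algBase x₀ := by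
  rw [dualTriv, hom_trivializationAt_baseSet]
  exact inter_univ _

theorem mem_dualTriv_source {μ : 𝒢.Dual} (hμ : μ.proj ∈ 𝒢.algBase x₀) :
    μ ∈ (𝒢.dualTriv x₀).source := by
  rwa [Trivialization.mem_source, dualTriv_baseSet]

theorem mem_dualTriv_target {p : M × (AlgModel EG EM →L[ℝ] ℝ)} (hp : p.1 ∈ 𝒢.algBase x₀) :
    p ∈ (𝒢.dualTriv x₀).target := by
  rwa [Trivialization.mem_target, dualTriv_baseSet]

theorem dualCoord_apply {μ : 𝒢.Dual} (h : μ.proj ∈ 𝒢.algBase x₀) (a : AlgModel EG EM) :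
    𝒢.dualCoord x₀ μ a = μ.snd (𝒢.algSymm x₀ μ.proj a) := by
  rw [dualCoord, dualTriv, hom_trivializationAt_apply, ContinuousLinearMap.inCoordinates]
  change Trivialization.continuousLinearMapAt ℝ _ _ (μ.snd (Trivialization.symmL ℝ _ _ a)) = _
  have h2 : Trivialization.symmL ℝ (trivializationAt (AlgModel EG EM) 𝒢.Alg x₀) μ.proj a =
      𝒢.algSymm x₀ μ.proj a := by
    rw [Trivialization.symmL_apply _ h]
    exact 𝒢.algPretriv_symm h a
  rw [h2]
  simp

theorem smoothNear_dualProj (μ : 𝒢.Dual) :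
    SmoothNear (dualModel EG EM) 𝓘(ℝ, EM) (TotalSpace.proj : 𝒢.Dual → M) μ :=
  (contMDiff_proj (IB := 𝓘(ℝ, EM)) (n := ∞)
    (fun x : M => 𝒢.Alg x →L[ℝ] Bundle.Trivial M ℝ x)).smoothNear μ

theorem eventually_proj_mem {μ : 𝒢.Dual} (hμ : μ.proj ∈ 𝒢.algBase x₀) :
    ∀ᶠ ν : 𝒢.Dual in 𝓝 μ, ν.proj ∈ 𝒢.algBase x₀ :=
  (smoothNear_dualProj μ).continuousAt.eventually ((𝒢.isOpen_algBase x₀).mem_nhds hμ)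

theorem smoothNear_dualChart {μ : 𝒢.Dual} (hμ : μ.proj ∈ 𝒢.algBase x₀) :
    SmoothNear (dualModel EG EM) (dualModel EG EM) (𝒢.dualChart x₀) μ :=
  ((𝒢.dualTriv x₀).contMDiffOn (IB := 𝓘(ℝ, EM)) (n := ∞)).smoothNear
    ((𝒢.dualTriv x₀).open_source.mem_nhds (mem_dualTriv_source hμ))

theorem smoothNear_dualCoord {μ : 𝒢.Dual} (hμ : μ.proj ∈ 𝒢.algBase x₀) :
    SmoothNear (dualModel EG EM) 𝓘(ℝ, AlgModel EG EM →L[ℝ] ℝ) (𝒢.dualCoord x₀) μ :=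
  SmoothNear.comp (g := fun p : M × (AlgModel EG EM →L[ℝ] ℝ) => p.2)
    (SmoothNear.snd (𝒢.dualChart x₀ μ)) (smoothNear_dualChart hμ)

theorem smoothNear_dualSymm {p : M × (AlgModel EG EM →L[ℝ] ℝ)} (hp : p.1 ∈ 𝒢.algBase x₀) :
    SmoothNear (dualModel EG EM) (dualModel EG EM) (𝒢.dualSymm x₀) p :=
  ((𝒢.dualTriv x₀).contMDiffOn_symm (IB := 𝓘(ℝ, EM)) (n := ∞)).smoothNear
    ((𝒢.dualTriv x₀).open_target.mem_nhds (mem_dualTriv_target hp))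

theorem dualChart_dualSymm {p : M × (AlgModel EG EM →L[ℝ] ℝ)} (hp : p.1 ∈ 𝒢.algBase x₀) :
    𝒢.dualChart x₀ (𝒢.dualSymm x₀ p) = p :=
  (𝒢.dualTriv x₀).toOpenPartialHomeomorph.right_inv (mem_dualTriv_target hp)

theorem dualSymm_dualChart {μ : 𝒢.Dual} (hμ : μ.proj ∈ 𝒢.algBase x₀) :
    𝒢.dualSymm x₀ (𝒢.dualChart x₀ μ) = μ :=
  (𝒢.dualTriv x₀).toOpenPartialHomeomorph.left_inv (mem_dualTriv_source hμ)

/-- The differential of the trivialization of `A^*G`. -/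
def dualChartD (𝒢 : LieGroupoid EG EM G M) (x₀ : M) (μ : 𝒢.Dual) :
    EM × (AlgModel EG EM →L[ℝ] ℝ) →L[ℝ] EM × (AlgModel EG EM →L[ℝ] ℝ) :=
  tderiv (dualModel EG EM) (dualModel EG EM) (𝒢.dualChart x₀) μ

/-- The inverse of the differential of the trivialization of `A^*G`. -/
def dualSymmD (𝒢 : LieGroupoid EG EM G M) (x₀ : M) (μ : 𝒢.Dual) :
    EM × (AlgModel EG EM →L[ℝ] ℝ) →L[ℝ] EM × (AlgModel EG EM →L[ℝ] ℝ) :=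
  tderiv (dualModel EG EM) (dualModel EG EM) (𝒢.dualSymm x₀) (𝒢.dualChart x₀ μ)

theorem dualChartD_dualSymmD {μ : 𝒢.Dual} (hμ : μ.proj ∈ 𝒢.algBase x₀)
    (z : EM × (AlgModel EG EM →L[ℝ] ℝ)) : 𝒢.dualChartD x₀ μ (𝒢.dualSymmD x₀ μ z) = z := by
  have hp : (𝒢.dualChart x₀ μ).1 ∈ 𝒢.algBase x₀ := hμ
  have e := tderiv_comp_of_eq (smoothNear_dualChart hμ).mdifferentiableAt
    (smoothNear_dualSymm hp).mdifferentiableAt (dualSymm_dualChart hμ) z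
  have ev : (fun p => 𝒢.dualChart x₀ (𝒢.dualSymm x₀ p)) =ᶠ[𝓝 (𝒢.dualChart x₀ μ)] fun p => p := by
    filter_upwards [(continuousAt_fst (p := 𝒢.dualChart x₀ μ)).eventually
      ((𝒢.isOpen_algBase x₀).mem_nhds hp)] with p h
    exact dualChart_dualSymm h
  rw [tderiv_congr ev, tderiv_id] at e
  exact e.symm

theorem dualSymmD_dualChartD {μ : 𝒢.Dual} (hμ : μ.proj ∈ 𝒢.algBase x₀)
    (z : EM × (AlgModel EG EM →L[ℝ] ℝ)) : 𝒢.dualSymmD x₀ μ (𝒢.dualChartD x₀ μ z) = z := by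
  have hp : (𝒢.dualChart x₀ μ).1 ∈ 𝒢.algBase x₀ := hμ
  have e := tderiv_comp (smoothNear_dualSymm hp).mdifferentiableAt
    (smoothNear_dualChart hμ).mdifferentiableAt z
  have ev : (fun ν => 𝒢.dualSymm x₀ (𝒢.dualChart x₀ ν)) =ᶠ[𝓝 μ] fun ν => ν := by
    filter_upwards [eventually_proj_mem hμ] with ν h
    exact dualSymm_dualChart h
  rw [tderiv_congr ev, tderiv_id] at e
  exact e.symm

/-- The differential of the projection of `A^*G`. -/
def dualProjD (𝒢 : LieGroupoid EG EM G M) (μ : 𝒢.Dual) :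
    EM × (AlgModel EG EM →L[ℝ] ℝ) →L[ℝ] EM :=
  tderiv (dualModel EG EM) 𝓘(ℝ, EM) (TotalSpace.proj : 𝒢.Dual → M) μ

theorem dualChartD_eq {μ : 𝒢.Dual} (hμ : μ.proj ∈ 𝒢.algBase x₀)
    (z : EM × (AlgModel EG EM →L[ℝ] ℝ)) : 𝒢.dualChartD x₀ μ z = (𝒢.dualProjD μ z,
      tderiv (dualModel EG EM) 𝓘(ℝ, AlgModel EG EM →L[ℝ] ℝ) (𝒢.dualCoord x₀) μ z) :=
  tderiv_prodMk (smoothNear_dualProj μ).mdifferentiableAt (smoothNear_dualCoord hμ).mdifferentiableAt z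

theorem surjective_dualProjD (μ : 𝒢.Dual) : Function.Surjective (𝒢.dualProjD μ) := by
  intro u
  have hμ := 𝒢.mem_algBase μ.proj
  refine ⟨𝒢.dualSymmD μ.proj μ (u, 0), ?_⟩
  have e := dualChartD_dualSymmD hμ (u, 0)
  rw [dualChartD_eq hμ] at e
  exact congrArg Prod.fst e

theorem t2Space_dual [T2Space M] : T2Space 𝒢.Dual := by
  refine ⟨fun μ ν h => ?_⟩
  have hc : Continuous (TotalSpace.proj : 𝒢.Dual → M) :=
    continuous_iff_continuousAt.2 fun μ => (smoothNear_dualProj μ).continuousAt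
  by_cases hp : μ.proj = ν.proj
  · have h1 : μ ∈ (𝒢.dualTriv μ.proj).source := mem_dualTriv_source (𝒢.mem_algBase _)
    have h2 : ν ∈ (𝒢.dualTriv μ.proj).source :=
      mem_dualTriv_source (by rw [← hp]; exact 𝒢.mem_algBase _)
    have hne : 𝒢.dualTriv μ.proj μ ≠ 𝒢.dualTriv μ.proj ν := fun e =>
      h ((𝒢.dualTriv μ.proj).injOn h1 h2 e)
    obtain ⟨u, v, hu, hv, hμu, hνv, huv⟩ := t2_separation hne
    refine ⟨_, _, (𝒢.dualTriv μ.proj).continuousOn.isOpen_inter_preimage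
      (𝒢.dualTriv μ.proj).open_source hu, (𝒢.dualTriv μ.proj).continuousOn.isOpen_inter_preimage
      (𝒢.dualTriv μ.proj).open_source hv, ⟨h1, hμu⟩, ⟨h2, hνv⟩, ?_⟩
    exact (huv.preimage _).mono inter_subset_right inter_subset_right
  · obtain ⟨u, v, hu, hv, hμu, hνv, huv⟩ := t2_separation hp
    exact ⟨_, _, hu.preimage hc, hv.preimage hc, hμu, hνv, huv.preimage _⟩

end DualCoordinates

section DualSections

variable {𝒢 : LieGroupoid EG EM G M} {x₀ : M} {σ σ' : ∀ μ, 𝒢.PTauStar μ}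

/-- The coefficients of the `AG`-component of a section of the prolongation. -/
def algCoeff (x₀ : M) (σ : ∀ μ, 𝒢.PTauStar μ) (μ : 𝒢.Dual) : AlgModel EG EM :=
  𝒢.algCoord x₀ μ.proj (σ μ).1

/-- The vector field component of a section of the prolongation. -/
def dualField (σ : ∀ μ, 𝒢.PTauStar μ) (μ : 𝒢.Dual) : EM × (AlgModel EG EM →L[ℝ] ℝ) := (σ μ).2

theorem IsPTauStarSection.smoothNear_algCoeff (hσ : 𝒢.IsPTauStarSection σ) {μ : 𝒢.Dual}
    (hμ : μ.proj ∈ 𝒢.algBase x₀) :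
    SmoothNear (dualModel EG EM) 𝓘(ℝ, AlgModel EG EM) (algCoeff x₀ σ) μ := by
  have h1 : SmoothNear (𝓘(ℝ, EM).prod 𝓘(ℝ, AlgModel EG EM)) (𝓘(ℝ, EM).prod 𝓘(ℝ, AlgModel EG EM))
      (trivializationAt (AlgModel EG EM) 𝒢.Alg x₀) ⟨μ.proj, (σ μ).1⟩ :=
    ((trivializationAt (AlgModel EG EM) 𝒢.Alg x₀).contMDiffOn (IB := 𝓘(ℝ, EM)) (n := ∞)).smoothNear
      ((trivializationAt (AlgModel EG EM) 𝒢.Alg x₀).open_source.mem_nhds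
        (by rw [Trivialization.mem_source]; exact hμ))
  exact SmoothNear.comp (g := fun p : M × AlgModel EG EM => p.2) (SmoothNear.snd _)
    (SmoothNear.comp (f := fun μ : 𝒢.Dual => (⟨μ.proj, (σ μ).1⟩ : TotalSpace (AlgModel EG EM) 𝒢.Alg))
      h1 (hσ.smooth_fst.smoothNear μ))

theorem IsPTauStarSection.smoothField (hσ : 𝒢.IsPTauStarSection σ) (μ : 𝒢.Dual) :
    SmoothField (dualModel EG EM) (dualField σ) μ := hσ.smooth_snd.smoothNear μ

theorem IsPTauStarSection.dualProjD_dualField (hσ : 𝒢.IsPTauStarSection σ) {μ : 𝒢.Dual}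
    (hμ : μ.proj ∈ 𝒢.algBase x₀) :
    𝒢.dualProjD μ (dualField σ μ) = 𝒢.anchorFrame x₀ μ.proj (algCoeff x₀ σ μ) := by
  refine (hσ.anchor_eq μ).symm.trans ?_
  exact congrArg (𝒢.tgtD (𝒢.unit μ.proj)) (unitFrame_algCoord hμ (σ μ).1).symm

theorem IsPTauStarSection.of_local
    (h : ∀ μ : 𝒢.Dual, ∃ x₀, μ.proj ∈ 𝒢.algBase x₀ ∧
      SmoothNear (dualModel EG EM) 𝓘(ℝ, AlgModel EG EM) (algCoeff x₀ σ) μ ∧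
      SmoothField (dualModel EG EM) (dualField σ) μ ∧
      𝒢.dualProjD μ (dualField σ μ) = 𝒢.anchorFrame x₀ μ.proj (algCoeff x₀ σ μ)) :
    𝒢.IsPTauStarSection σ where
  smooth_fst μ := by
    obtain ⟨x₀, h1, h2, -, -⟩ := h μ
    refine (Trivialization.contMDiffAt_iff (IB := 𝓘(ℝ, EM))
      (e := trivializationAt (AlgModel EG EM) 𝒢.Alg x₀)
      (f := fun μ : 𝒢.Dual => (⟨μ.proj, (σ μ).1⟩ : TotalSpace (AlgModel EG EM) 𝒢.Alg))
      (by rw [Trivialization.mem_source]; exact h1)).2 ⟨(smoothNear_dualProj μ).contMDiffAt, ?_⟩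
    exact h2.contMDiffAt
  smooth_snd μ := by
    obtain ⟨x₀, -, -, h3, -⟩ := h μ
    exact SmoothNear.contMDiffAt h3
  anchor_eq μ := by
    obtain ⟨x₀, h1, -, -, h4⟩ := h μ
    refine Eq.trans ?_ h4.symm
    exact congrArg (𝒢.tgtD (𝒢.unit μ.proj)) (unitFrame_algCoord h1 (σ μ).1).symm

theorem IsPTauStarSection.of_eventuallyEq
    (h : ∀ μ, ∃ τ, 𝒢.IsPTauStarSection τ ∧ ∀ᶠ ν in 𝓝 μ, σ ν = τ ν) : 𝒢.IsPTauStarSection σ := by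
  refine IsPTauStarSection.of_local fun μ => ?_
  obtain ⟨τ, hτ, he⟩ := h μ
  have hμ := 𝒢.mem_algBase μ.proj
  refine ⟨μ.proj, hμ, (hτ.smoothNear_algCoeff hμ).congr ?_, (hτ.smoothField μ).congr ?_, ?_⟩
  · filter_upwards [he] with ν hν
    rw [algCoeff, hν]
    rfl
  · filter_upwards [he] with ν hν
    refine ⟨rfl, ?_⟩
    rw [dualField, hν]
    rfl
  · have e := hτ.dualProjD_dualField hμ
    rw [dualField, algCoeff, ← he.self_of_nhds] at e
    exact e

theorem prolField_eq {p : G × 𝒢.Dual} (hp : 𝒢.tgt p.1 = p.2.proj)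
    (hp' : p.2.proj ∈ 𝒢.algBase x₀) :
    (𝒢.prolField σ p : EG × (EM × (AlgModel EG EM →L[ℝ] ℝ))) =
      (𝒢.leftFrame x₀ p.1 (algCoeff x₀ σ p.2), dualField σ p.2) := by
  refine Prod.ext ?_ rfl
  rw [leftFrame_eq hp, algCoeff, unitFrame_algCoord hp']
  exact tangentL_eq (by rw [𝒢.src_unit, hp]) (𝒢.mfderiv_src_algIncl _ _)

theorem tangentTo_prolFibre (hσ : 𝒢.IsPTauStarSection σ) {μ : 𝒢.Dual}
    (hμ : μ.proj ∈ 𝒢.algBase x₀) :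
    TangentTo (𝓘(ℝ, EG).prod (dualModel EG EM)) (𝒢.prolFibre μ) (𝒢.unit μ.proj, μ)
      (𝒢.leftFrame x₀ (𝒢.unit μ.proj) (algCoeff x₀ σ μ), dualField σ μ) := by
  refine TangentTo.mono (TangentTo.graph (TangentTo.fibre (c := μ.proj) (𝒢.smoothNear_src _)
    (𝒢.surjective_srcD _) (𝒢.src_unit _) (srcD_leftFrame (tgt_unit_mem hμ) _))
    (smoothNear_dualProj μ) (surjective_dualProjD μ)
    (𝒢.smoothNear_tgt _).mdifferentiableAt (𝒢.tgt_unit _).symm ?_) fun p hp => ⟨hp.1, hp.2.symm⟩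
  refine (hσ.dualProjD_dualField hμ).trans ?_
  have e := tgtD_leftFrame (tgt_unit_mem hμ) (algCoeff x₀ σ μ)
  rw [𝒢.tgt_unit] at e
  exact e.symm

theorem algCoeff_pTauStarBracket (hσ : 𝒢.IsPTauStarSection σ) (hσ' : 𝒢.IsPTauStarSection σ')
    {μ : 𝒢.Dual} (hμ : μ.proj ∈ 𝒢.algBase x₀) :
    algCoeff x₀ (𝒢.pTauStarBracket σ σ') μ =
      𝒢.structureFn x₀ μ.proj (algCoeff x₀ σ μ) (algCoeff x₀ σ' μ) +
      (tderiv (dualModel EG EM) 𝓘(ℝ, AlgModel EG EM) (algCoeff x₀ σ') μ (dualField σ μ) -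
        tderiv (dualModel EG EM) 𝓘(ℝ, AlgModel EG EM) (algCoeff x₀ σ) μ (dualField σ' μ)) := by
  have hu := tgt_unit_mem (𝒢 := 𝒢) hμ
  have hT := smoothFamily_leftFrame (𝒢 := 𝒢) hu
  have c := (continuousAt_snd (p := (𝒢.unit μ.proj, μ))).eventually (eventually_proj_mem hμ)
  have h := mlieBracketWithin_eq_fieldBracket (I := 𝓘(ℝ, EG).prod (dualModel EG EM))
    (V := fun q => (𝒢.prolField σ q : EG × (EM × (AlgModel EG EM →L[ℝ] ℝ))))
    (W := fun q => (𝒢.prolField σ' q : EG × (EM × (AlgModel EG EM →L[ℝ] ℝ))))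
    (hT.prodField (hσ.smoothNear_algCoeff hμ) (hσ.smoothField μ))
    (hT.prodField (hσ'.smoothNear_algCoeff hμ) (hσ'.smoothField μ))
    (c.mono fun p hp hs => prolField_eq hs.2 hp) (c.mono fun p hp hs => prolField_eq hs.2 hp)
    (tangentTo_prolFibre hσ hμ) (tangentTo_prolFibre hσ' hμ)
  rw [fieldBracket_prodField hT (hσ.smoothNear_algCoeff hμ) (hσ'.smoothNear_algCoeff hμ)
    (hσ.smoothField μ) (hσ'.smoothField μ), fieldBracket_leftFrame hu, ← map_add, 𝒢.tgt_unit,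
    leftFrame_unit hμ] at h
  have h1 := congrArg (Prod.fst : EG × (EM × (AlgModel EG EM →L[ℝ] ℝ)) → EG) h
  apply unitFrame_injective hμ
  refine Eq.trans ?_ h1
  rw [algCoeff, unitFrame_algCoord hμ]
  unfold pTauStarBracket
  have h2 := srcD_unitFrame hμ (𝒢.structureFn x₀ μ.proj (algCoeff x₀ σ μ) (algCoeff x₀ σ' μ) +
      (tderiv (dualModel EG EM) 𝓘(ℝ, AlgModel EG EM) (algCoeff x₀ σ') μ (dualField σ μ) -
        tderiv (dualModel EG EM) 𝓘(ℝ, AlgModel EG EM) (algCoeff x₀ σ) μ (dualField σ' μ)))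
  simp only at h1
  rw [← h1] at h2
  exact congrArg (𝒢.algIncl μ.proj) (dif_pos h2)

theorem liouville_eq (σ : ∀ μ, 𝒢.PTauStar μ) {μ : 𝒢.Dual} (hμ : μ.proj ∈ 𝒢.algBase x₀) :
    𝒢.liouville μ (σ μ) = 𝒢.dualCoord x₀ μ (algCoeff x₀ σ μ) := by
  rw [dualCoord_apply hμ, algCoeff, 𝒢.algSymm_algCoord hμ]
  rfl

theorem omegaDual_eq (hσ : 𝒢.IsPTauStarSection σ) (hσ' : 𝒢.IsPTauStarSection σ')
    {μ : 𝒢.Dual} (hμ : μ.proj ∈ 𝒢.algBase x₀) :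
    𝒢.omegaDual σ σ' μ =
      -tderiv (dualModel EG EM) 𝓘(ℝ, AlgModel EG EM →L[ℝ] ℝ) (𝒢.dualCoord x₀) μ (dualField σ μ)
        (algCoeff x₀ σ' μ) +
      tderiv (dualModel EG EM) 𝓘(ℝ, AlgModel EG EM →L[ℝ] ℝ) (𝒢.dualCoord x₀) μ (dualField σ' μ)
        (algCoeff x₀ σ μ) +
      𝒢.dualCoord x₀ μ (𝒢.structureFn x₀ μ.proj (algCoeff x₀ σ μ) (algCoeff x₀ σ' μ)) := by
  refine BundleBracket.twoSection_coord (A := 𝒢.pTauStar) (smoothNear_dualCoord hμ)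
    (hσ.smoothNear_algCoeff hμ) (hσ'.smoothNear_algCoeff hμ)
    ((eventually_proj_mem hμ).mono fun ν hν => liouville_eq σ hν)
    ((eventually_proj_mem hμ).mono fun ν hν => liouville_eq σ' hν) ?_
  refine (liouville_eq (𝒢.pTauStarBracket σ σ') hμ).trans ?_
  rw [algCoeff_pTauStarBracket hσ hσ' hμ]
  rfl

end DualSections

section DualFrame

variable {𝒢 : LieGroupoid EG EM G M} {x₀ : M}

/-- The vector fields of the local frame of the prolongation. -/
def dualFrameField (𝒢 : LieGroupoid EG EM G M) (x₀ : M) (μ : 𝒢.Dual) :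
    AlgModel EG EM × (AlgModel EG EM →L[ℝ] ℝ) →L[ℝ] EM × (AlgModel EG EM →L[ℝ] ℝ) :=
  (𝒢.dualSymmD x₀ μ).comp (((𝒢.anchorFrame x₀ μ.proj).comp (ContinuousLinearMap.fst ℝ _ _)).prod
    (ContinuousLinearMap.snd ℝ _ _))

/-- The local frame of the prolongation of `AG` over `A^*G`. -/
def dualFrame (𝒢 : LieGroupoid EG EM G M) (x₀ : M) (μ : 𝒢.Dual)
    (s : AlgModel EG EM × (AlgModel EG EM →L[ℝ] ℝ)) : 𝒢.PTauStar μ :=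
  (𝒢.algSymm x₀ μ.proj s.1, 𝒢.dualFrameField x₀ μ s)

theorem dualChartD_dualFrameField {μ : 𝒢.Dual} (hμ : μ.proj ∈ 𝒢.algBase x₀)
    (s : AlgModel EG EM × (AlgModel EG EM →L[ℝ] ℝ)) :
    𝒢.dualChartD x₀ μ (𝒢.dualFrameField x₀ μ s) = (𝒢.anchorFrame x₀ μ.proj s.1, s.2) :=
  dualChartD_dualSymmD hμ _

theorem smoothFamily_dualFrameField {μ : 𝒢.Dual} (hμ : μ.proj ∈ 𝒢.algBase x₀) :
    SmoothFamily (dualModel EG EM) (𝒢.dualFrameField x₀) μ := by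
  intro s
  have h1 : SmoothAlong 𝓘(ℝ, EM) 𝓘(ℝ, EM) (fun x : M => x) (fun x => 𝒢.anchorFrame x₀ x s.1)
      μ.proj :=
    ((smoothAlong_unitFrame hμ s.1).map (𝒢.smoothNear_tgt _)).congr
      (Eventually.of_forall fun x => ⟨(𝒢.tgt_unit x).symm, rfl⟩)
  have h2 : SmoothAlong (dualModel EG EM) 𝓘(ℝ, EM) (fun ν : 𝒢.Dual => ν.proj)
      (fun ν => 𝒢.anchorFrame x₀ ν.proj s.1) μ :=
    SmoothAlong.comp (k := (TotalSpace.proj : 𝒢.Dual → M)) h1 (smoothNear_dualProj μ)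
  have h3 : SmoothAlong (dualModel EG EM) 𝓘(ℝ, AlgModel EG EM →L[ℝ] ℝ) (𝒢.dualCoord x₀)
      (fun _ => s.2) μ := SmoothAlong.of_space (smoothNear_dualCoord hμ) (SmoothNear.const _ _)
  have h4 : SmoothAlong (dualModel EG EM) (dualModel EG EM) (𝒢.dualChart x₀)
      (fun ν => (𝒢.anchorFrame x₀ ν.proj s.1, s.2)) μ := h2.prodMk h3
  refine (h4.map (smoothNear_dualSymm (show (𝒢.dualChart x₀ μ).1 ∈ _ from hμ))).congr ?_
  filter_upwards [eventually_proj_mem hμ] with ν hν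
  exact ⟨(dualSymm_dualChart hν).symm, rfl⟩

theorem exists_dualFrame {σ : ∀ μ, 𝒢.PTauStar μ} (hσ : 𝒢.IsPTauStarSection σ) {μ : 𝒢.Dual}
    (hμ : μ.proj ∈ 𝒢.algBase x₀) : ∃ s, σ μ = 𝒢.dualFrame x₀ μ s := by
  refine ⟨(algCoeff x₀ σ μ, (𝒢.dualChartD x₀ μ (dualField σ μ)).2), Prod.ext ?_ ?_⟩
  · exact (𝒢.algSymm_algCoord hμ _).symm
  · refine (dualSymmD_dualChartD hμ (dualField σ μ)).symm.trans ?_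
    refine congrArg (𝒢.dualSymmD x₀ μ) (Prod.ext ?_ rfl)
    rw [dualChartD_eq hμ]
    exact hσ.dualProjD_dualField hμ

theorem exists_section_dualFrame [T2Space M] {μ : 𝒢.Dual} (hμ : μ.proj ∈ 𝒢.algBase x₀)
    {c : 𝒢.Dual → AlgModel EG EM × (AlgModel EG EM →L[ℝ] ℝ)}
    (hc : SmoothNear (dualModel EG EM) 𝓘(ℝ, AlgModel EG EM × (AlgModel EG EM →L[ℝ] ℝ)) c μ) :
    ∃ τ, 𝒢.IsPTauStarSection τ ∧ ∀ᶠ ν in 𝓝 μ, τ ν = 𝒢.dualFrame x₀ ν (c ν) := by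
  have := t2Space_dual (𝒢 := 𝒢)
  obtain ⟨O, hO, hOo, hμO⟩ := eventually_nhds_iff.1 (hc.eventually.and (eventually_proj_mem hμ))
  obtain ⟨χ, h1, h2, h3⟩ := exists_bump (I := dualModel EG EM) (hOo.mem_nhds hμO)
  refine ⟨fun ν => χ ν • 𝒢.dualFrame x₀ ν (c ν), IsPTauStarSection.of_local fun ν => ?_, ?_⟩
  · by_cases hν : ν ∈ O
    · obtain ⟨h4, h5⟩ := hO ν hν
      have h6 := hOo.mem_nhds hν
      refine ⟨x₀, h5, ?_, ?_, ?_⟩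
      · refine ((h1.smoothNear ν).smul (h4.clm (ContinuousLinearMap.fst ℝ _ _))).congr ?_
        filter_upwards [h6] with κ hκ
        refine (map_smul (𝒢.algCoord x₀ κ.proj) (χ κ) _).trans ?_
        exact congrArg (χ κ • ·) (𝒢.algCoord_algSymm (hO κ hκ).2 _)
      · exact SmoothAlong.smul (h1.smoothNear ν)
          (SmoothFamily.apply (f := fun κ => κ) (smoothFamily_dualFrameField h5) (SmoothNear.id ν) h4)
      · have e := congrArg Prod.fst (dualChartD_dualFrameField h5 (c ν))
        rw [dualChartD_eq h5] at e
        refine (map_smul (𝒢.dualProjD ν) (χ ν) (𝒢.dualFrameField x₀ ν (c ν))).trans ?_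
        refine (congrArg (χ ν • ·) e).trans ?_
        rw [← map_smul]
        refine congrArg (𝒢.anchorFrame x₀ ν.proj) ?_
        refine Eq.trans ?_ (map_smul (𝒢.algCoord x₀ ν.proj) (χ ν) _).symm
        exact congrArg (χ ν • ·) (𝒢.algCoord_algSymm h5 _).symm
    · have h4 : ∀ᶠ κ in 𝓝 ν, χ κ = 0 := notMem_tsupport_iff_eventuallyEq.1 fun h => hν (h3 h)
      have h5 := 𝒢.mem_algBase ν.proj
      have h6 : ∀ κ : 𝒢.Dual, χ κ = 0 → algCoeff ν.proj
          (fun ν => χ ν • 𝒢.dualFrame x₀ ν (c ν)) κ = 0 := fun κ hκ => by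
        refine (map_smul (𝒢.algCoord ν.proj κ.proj) (χ κ) _).trans ?_
        rw [hκ, zero_smul]
      have h7 : ∀ κ : 𝒢.Dual, χ κ = 0 → dualField
          (fun ν => χ ν • 𝒢.dualFrame x₀ ν (c ν)) κ = 0 := fun κ hκ => by
        refine Eq.trans (show _ = χ κ • 𝒢.dualFrameField x₀ κ (c κ) from rfl) ?_
        rw [hκ, zero_smul]
      refine ⟨ν.proj, h5, (SmoothNear.const 0 ν).congr (h4.mono h6),
        (SmoothAlong.zero (SmoothNear.id ν)).congr (h4.mono fun κ hκ => ⟨rfl, h7 κ hκ⟩), ?_⟩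
      rw [h6 ν h4.self_of_nhds, h7 ν h4.self_of_nhds, map_zero, map_zero]
  · filter_upwards [h2] with ν hν
    rw [hν, one_smul]

theorem omegaDual_dualFrame {σ τ : ∀ μ, 𝒢.PTauStar μ} (hσ : 𝒢.IsPTauStarSection σ)
    (hτ : 𝒢.IsPTauStarSection τ) {μ : 𝒢.Dual} (hμ : μ.proj ∈ 𝒢.algBase x₀)
    {s t : AlgModel EG EM × (AlgModel EG EM →L[ℝ] ℝ)} (hs : σ μ = 𝒢.dualFrame x₀ μ s)
    (ht : τ μ = 𝒢.dualFrame x₀ μ t) :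
    𝒢.omegaDual σ τ μ = BundleBracket.frameForm (dualModel EG EM) (𝒢.dualFrameField x₀)
      (ContinuousLinearMap.fst ℝ _ _) (𝒢.dualCoord x₀) (fun ν => 𝒢.structureBilin x₀ ν.proj) μ s t := by
  have a1 : algCoeff x₀ σ μ = s.1 := by
    rw [algCoeff, hs]; exact 𝒢.algCoord_algSymm hμ s.1
  have a2 : algCoeff x₀ τ μ = t.1 := by
    rw [algCoeff, ht]; exact 𝒢.algCoord_algSymm hμ t.1
  have b1 : dualField σ μ = 𝒢.dualFrameField x₀ μ s := by rw [dualField, hs]; rfl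
  have b2 : dualField τ μ = 𝒢.dualFrameField x₀ μ t := by rw [dualField, ht]; rfl
  rw [omegaDual_eq hσ hτ hμ, BundleBracket.frameForm_apply, a1, a2, b1, b2,
    structureBilin_apply hμ]
  rfl

theorem hasFrame_omegaDual [T2Space M] (μ : 𝒢.Dual) :
    𝒢.pTauStar.HasFrame 𝒢.omegaDual μ (AlgModel EG EM × (AlgModel EG EM →L[ℝ] ℝ)) := by
  have hμ := 𝒢.mem_algBase μ.proj
  refine BundleBracket.hasFrame_of_frameForm (e := 𝒢.dualFrame μ.proj)
    (T := 𝒢.dualFrameField μ.proj) (l := 𝒢.dualCoord μ.proj)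
    (c := fun ν => 𝒢.structureBilin μ.proj ν.proj) (ContinuousLinearMap.fst ℝ _ _)
    (smoothFamily_dualFrameField hμ) (smoothNear_dualCoord hμ)
    (fun a b => SmoothNear.comp (f := (TotalSpace.proj : 𝒢.Dual → M))
      (smoothNear_structureBilin hμ a b) (smoothNear_dualProj μ)) ?_
    ((eventually_proj_mem hμ).mono fun ν hν c hc => exists_section_dualFrame hν hc)
    ((eventually_proj_mem hμ).mono fun ν hν τ hτ => exists_dualFrame hτ hν)
    (Eventually.of_forall fun ν s => rfl)
    ((eventually_proj_mem hμ).mono fun ν hν σ τ hσ hτ s t hs ht => omegaDual_dualFrame hσ hτ hν hs ht)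
  intro s hs
  have h1 : 𝒢.algSymm μ.proj μ.proj s.1 = 0 := congrArg Prod.fst hs
  have h2 : 𝒢.dualFrameField μ.proj μ s = 0 := congrArg Prod.snd hs
  have h3 := dualChartD_dualFrameField hμ s
  rw [h2, map_zero] at h3
  refine Prod.ext ?_ (congrArg Prod.snd h3).symm
  rw [← 𝒢.algCoord_algSymm hμ s.1, h1, map_zero]
  rfl

theorem nondegenerate_omegaDual [T2Space M] : 𝒢.pTauStar.Nondegenerate 𝒢.omegaDual := by
  intro σ hσ μ h
  have hμ := 𝒢.mem_algBase μ.proj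
  obtain ⟨s, hs⟩ := exists_dualFrame hσ hμ
  have key : ∀ t : AlgModel EG EM × (AlgModel EG EM →L[ℝ] ℝ),
      -s.2 t.1 + t.2 s.1 + 𝒢.dualCoord μ.proj μ (𝒢.structureBilin μ.proj μ.proj s.1 t.1) = 0 := by
    intro t
    obtain ⟨τ, hτ, hτe⟩ := exists_section_dualFrame hμ (SmoothNear.const t μ)
    have e := omegaDual_dualFrame hσ hτ hμ hs hτe.self_of_nhds
    have d : ∀ r, tderiv (dualModel EG EM) 𝓘(ℝ, AlgModel EG EM →L[ℝ] ℝ) (𝒢.dualCoord μ.proj) μ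
        (𝒢.dualFrameField μ.proj μ r) = r.2 := fun r => by
      have := dualChartD_dualFrameField hμ r
      rw [dualChartD_eq hμ] at this
      exact congrArg Prod.snd this
    rw [h τ hτ, BundleBracket.frameForm_apply, d, d] at e
    exact e.symm
  have h1 : s.1 = 0 := by
    by_contra hne
    obtain ⟨ζ, hζ⟩ := SeparatingDual.exists_ne_zero (R := ℝ) hne
    apply hζ
    have := key (0, ζ)
    simpa using this
  have h2 : s.2 = 0 := by
    ext b
    have := key (b, 0)
    simpa [h1] using this
  have h3 : s = 0 := Prod.ext h1 h2
  rw [hs, h3]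
  refine Prod.ext ?_ (map_zero (𝒢.dualFrameField μ.proj μ))
  apply 𝒢.algIncl_injective
  rw [show (𝒢.dualFrame μ.proj μ 0).1 = 𝒢.algSymm μ.proj μ.proj 0 from rfl, 𝒢.algIncl_algSymm hμ,
    map_zero]
  exact (map_zero _).symm

theorem existsUnique_hamiltonian_dual [T2Space M] {f : 𝒢.Dual → ℝ}
    (hf : IsSmoothFun (dualModel EG EM) f) : ∃! ξ, 𝒢.pTauStar.IsHamiltonian 𝒢.omegaDual f ξ :=
  BundleBracket.existsUnique_hamiltonian nondegenerate_omegaDual hasFrame_omegaDual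
    (fun _ h => IsPTauStarSection.of_eventuallyEq h) hf

end DualFrame

end LieGroupoid

theorem IsSmoothFun.of_smoothNear {E H N : Type*} [NormedAddCommGroup E] [NormedSpace ℝ E]
    [TopologicalSpace H] {I : ModelWithCorners ℝ E H} [TopologicalSpace N] [ChartedSpace H N]
    {f : N → ℝ} (h : ∀ x, SmoothNear I 𝓘(ℝ, ℝ) f x) : IsSmoothFun I f :=
  fun x => (h x).contMDiffAt

namespace BundleBracket

variable {E H N : Type*} [NormedAddCommGroup E] [NormedSpace ℝ E] [TopologicalSpace H]
  [TopologicalSpace N] [ChartedSpace H N] {I : ModelWithCorners ℝ E H} {V : N → Type*}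
  [∀ x, AddCommGroup (V x)] [∀ x, Module ℝ (V x)] {A : BundleBracket I N V}

/-- Adding an exact `1`-section does not change the differential. -/
theorem twoSection_add_exact (hA : A.IsLieAlgebroid) {θ θ' : ∀ x, V x →ₗ[ℝ] ℝ} {f : N → ℝ}
    (hf : IsSmoothFun I f) (hθ' : ∀ σ, A.IsSection σ → IsSmoothFun I (fun y => θ' y (σ y)))
    (h : ∀ σ x, θ x (σ x) = θ' x (σ x) + A.deriv f σ x) {σ σ' : ∀ x, V x} (hσ : A.IsSection σ)
    (hσ' : A.IsSection σ') : A.twoSection θ σ σ' = A.twoSection θ' σ σ' := by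
  funext x
  have e : ∀ τ, (fun y => θ y (τ y)) = (fun y => θ' y (τ y)) + A.deriv f τ :=
    fun τ => funext (h τ)
  rw [twoSection, twoSection, Pi.neg_apply, Pi.neg_apply, extDeriv, extDeriv, e, e,
    deriv_add (hθ' _ hσ') (hA.smooth_deriv f σ' hf hσ'),
    deriv_add (hθ' _ hσ) (hA.smooth_deriv f σ hf hσ), h, hA.deriv_bracket f σ σ' hf hσ hσ']
  ring

end BundleBracket

namespace LieGroupoid

variable {EG EM G M : Type*} [NormedAddCommGroup EG] [NormedSpace ℝ EG]
  [NormedAddCommGroup EM] [NormedSpace ℝ EM] [TopologicalSpace G] [ChartedSpace EG G]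
  [TopologicalSpace M] [ChartedSpace EM M] [FiniteDimensional ℝ EG] [FiniteDimensional ℝ EM]
  [IsManifold 𝓘(ℝ, EG) ∞ G] [IsManifold 𝓘(ℝ, EM) ∞ M] {𝒢 : LieGroupoid EG EM G M}

variable (𝒢) in
theorem pTau_isLieAlgebroid : 𝒢.pTau.IsLieAlgebroid where
  toIsLieAlgebra := 𝒢.pTau_isLieAlgebra
  smooth_deriv f σ hf hσ := IsSmoothFun.of_smoothNear fun g =>
    (IsPTauSection.smoothField_sum hσ g).deriv (ContMDiff.smoothNear hf g)
  deriv_bracket f σ σ' hf hσ hσ' g := by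
    have e := tderiv_fieldBracket (ContMDiff.smoothNear hf g) (IsPTauSection.smoothField_sum hσ g)
      (IsPTauSection.smoothField_sum hσ' g)
    rw [← sumField_pTauBracket hσ hσ'] at e
    exact e

section Sections

variable {x₀ x₁ : M} {g : G}

theorem IsPTauSection.of_components {σ : ∀ g, 𝒢.PTau g}
    (h : ∀ g, SmoothField 𝓘(ℝ, EG) (fstField σ) g ∧ SmoothField 𝓘(ℝ, EG) (sndField σ) g ∧
      𝒢.tgtD g (fstField σ g) = 0 ∧ 𝒢.srcD g (sndField σ g) = 0) : 𝒢.IsPTauSection σ :=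
  IsPTauSection.of_fields (fun g => (h g).1) (fun g => (h g).1.add (h g).2.1)
    (fun g => (h g).2.2.1) (fun g => (h g).2.2.2)

theorem IsPTauSection.of_eventuallyEq {σ : ∀ g, 𝒢.PTau g}
    (h : ∀ g, ∃ τ, 𝒢.IsPTauSection τ ∧ ∀ᶠ y in 𝓝 g, σ y = τ y) : 𝒢.IsPTauSection σ := by
  refine IsPTauSection.of_components fun g => ?_
  obtain ⟨τ, hτ, he⟩ := h g
  have e1 : ∀ᶠ y in 𝓝 g, fstField σ y = fstField τ y := he.mono fun y hy => congrArg Prod.fst hy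
  have e2 : ∀ᶠ y in 𝓝 g, sndField σ y = sndField τ y := he.mono fun y hy => congrArg Prod.snd hy
  refine ⟨(hτ.smoothField_fst g).congr (e1.mono fun y hy => ⟨rfl, hy⟩),
    (hτ.smoothField_snd g).congr (e2.mono fun y hy => ⟨rfl, hy⟩), ?_, ?_⟩
  · rw [e1.self_of_nhds, hτ.tgtD_fstField]
  · rw [e2.self_of_nhds, hτ.srcD_sndField]

/-- The local frame of `Vβ ⊕ Vα`. -/
def pTauFrame (𝒢 : LieGroupoid EG EM G M) (x₀ x₁ : M) (g : G) (s : AlgModel EG EM × AlgModel EG EM) :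
    𝒢.PTau g := (𝒢.rightFrame x₀ g s.1, 𝒢.leftFrame x₁ g s.2)

/-- The anchor in the local frame of `Vβ ⊕ Vα`. -/
def pTauFrameField (𝒢 : LieGroupoid EG EM G M) (x₀ x₁ : M) (g : G) :
    AlgModel EG EM × AlgModel EG EM →L[ℝ] EG :=
  (𝒢.rightFrame x₀ g).comp (ContinuousLinearMap.fst ℝ _ _) +
    (𝒢.leftFrame x₁ g).comp (ContinuousLinearMap.snd ℝ _ _)

theorem smoothFamily_pTauFrameField (hs : 𝒢.src g ∈ 𝒢.algBase x₀) (ht : 𝒢.tgt g ∈ 𝒢.algBase x₁) :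
    SmoothFamily 𝓘(ℝ, EG) (𝒢.pTauFrameField x₀ x₁) g :=
  fun s => SmoothAlong.add (smoothFamily_rightFrame hs s.1) (smoothFamily_leftFrame ht s.2)

theorem exists_pTauFrame {σ : ∀ g, 𝒢.PTau g} (hσ : 𝒢.IsPTauSection σ)
    (hs : 𝒢.src g ∈ 𝒢.algBase x₀) (ht : 𝒢.tgt g ∈ 𝒢.algBase x₁) :
    ∃ s, σ g = 𝒢.pTauFrame x₀ x₁ g s := by
  obtain ⟨a, ha⟩ := exists_rightFrame hs (hσ.tgtD_fstField g)
  obtain ⟨b, hb⟩ := exists_leftFrame ht (hσ.srcD_sndField g)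
  exact ⟨(a, b), Prod.ext ha.symm hb.symm⟩

theorem exists_section_pTauFrame [T2Space G] (hs : 𝒢.src g ∈ 𝒢.algBase x₀)
    (ht : 𝒢.tgt g ∈ 𝒢.algBase x₁) {c : G → AlgModel EG EM × AlgModel EG EM}
    (hc : SmoothNear 𝓘(ℝ, EG) 𝓘(ℝ, AlgModel EG EM × AlgModel EG EM) c g) :
    ∃ τ, 𝒢.IsPTauSection τ ∧ ∀ᶠ y in 𝓝 g, τ y = 𝒢.pTauFrame x₀ x₁ y (c y) := by
  obtain ⟨O, hO, hOo, hgO⟩ := eventually_nhds_iff.1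
    (hc.eventually.and ((eventually_src_mem hs).and (eventually_tgt_mem ht)))
  obtain ⟨χ, h1, h2, h3⟩ := exists_bump (I := 𝓘(ℝ, EG)) (hOo.mem_nhds hgO)
  refine ⟨fun y => χ y • 𝒢.pTauFrame x₀ x₁ y (c y), IsPTauSection.of_components fun y => ?_, ?_⟩
  · by_cases hy : y ∈ O
    · obtain ⟨h4, h5, h6⟩ := hO y hy
      refine ⟨SmoothAlong.smul (h1.smoothNear y) (SmoothFamily.apply (f := fun z => z)
        (smoothFamily_rightFrame h5) (SmoothNear.id y) (h4.clm (ContinuousLinearMap.fst ℝ _ _))),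
        SmoothAlong.smul (h1.smoothNear y) (SmoothFamily.apply (f := fun z => z)
        (smoothFamily_leftFrame h6) (SmoothNear.id y) (h4.clm (ContinuousLinearMap.snd ℝ _ _))),
        ?_, ?_⟩
      · refine (map_smul (𝒢.tgtD y) (χ y) (𝒢.rightFrame x₀ y (c y).1)).trans ?_
        rw [tgtD_rightFrame h5, smul_zero]
      · refine (map_smul (𝒢.srcD y) (χ y) (𝒢.leftFrame x₁ y (c y).2)).trans ?_
        rw [srcD_leftFrame h6, smul_zero]
    · have h4 : ∀ᶠ z in 𝓝 y, χ z = 0 := notMem_tsupport_iff_eventuallyEq.1 fun h => hy (h3 h)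
      have h5 : ∀ᶠ z in 𝓝 y, fstField (fun y => χ y • 𝒢.pTauFrame x₀ x₁ y (c y)) z = 0 :=
        h4.mono fun z hz => by
          refine Eq.trans (show _ = χ z • 𝒢.rightFrame x₀ z (c z).1 from rfl) ?_
          rw [hz, zero_smul]
      have h6 : ∀ᶠ z in 𝓝 y, sndField (fun y => χ y • 𝒢.pTauFrame x₀ x₁ y (c y)) z = 0 :=
        h4.mono fun z hz => by
          refine Eq.trans (show _ = χ z • 𝒢.leftFrame x₁ z (c z).2 from rfl) ?_
          rw [hz, zero_smul]
      refine ⟨(SmoothAlong.zero (SmoothNear.id y)).congr (h5.mono fun z hz => ⟨rfl, hz⟩),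
        (SmoothAlong.zero (SmoothNear.id y)).congr (h6.mono fun z hz => ⟨rfl, hz⟩), ?_, ?_⟩
      · rw [h5.self_of_nhds, map_zero]
      · rw [h6.self_of_nhds, map_zero]
  · filter_upwards [h2] with y hy
    rw [hy, one_smul]

/-- Every vector is the value of a section. -/
theorem exists_section_eq [T2Space G] {u v : EG} (hu : 𝒢.tgtD g u = 0) (hv : 𝒢.srcD g v = 0) :
    ∃ τ, 𝒢.IsPTauSection τ ∧ fstField τ g = u ∧ sndField τ g = v := by
  have hs := 𝒢.mem_algBase (𝒢.src g)
  have ht := 𝒢.mem_algBase (𝒢.tgt g)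
  obtain ⟨a, ha⟩ := exists_rightFrame hs hu
  obtain ⟨b, hb⟩ := exists_leftFrame ht hv
  obtain ⟨τ, hτ, he⟩ := exists_section_pTauFrame hs ht (SmoothNear.const (a, b) g)
  exact ⟨τ, hτ, (congrArg Prod.fst he.self_of_nhds).trans ha,
    (congrArg Prod.snd he.self_of_nhds).trans hb⟩

end Sections

section Cartan

variable {L : G → ℝ} {x₀ x₁ : M} {g : G} {σ σ' : ∀ g, 𝒢.PTau g}

/-- The left-invariant derivatives of `L`. -/
def leftMomentum (𝒢 : LieGroupoid EG EM G M) (L : G → ℝ) (x₁ : M) (g : G) : AlgModel EG EM →L[ℝ] ℝ :=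
  (tderiv 𝓘(ℝ, EG) 𝓘(ℝ, ℝ) L g).comp (𝒢.leftFrame x₁ g)

/-- The right-invariant derivatives of `L`. -/
def rightMomentum (𝒢 : LieGroupoid EG EM G M) (L : G → ℝ) (x₀ : M) (g : G) :
    AlgModel EG EM →L[ℝ] ℝ := -(tderiv 𝓘(ℝ, EG) 𝓘(ℝ, ℝ) L g).comp (𝒢.rightFrame x₀ g)

theorem smoothNear_leftMomentum (hL : IsSmoothFun 𝓘(ℝ, EG) L) (ht : 𝒢.tgt g ∈ 𝒢.algBase x₁) :
    SmoothNear 𝓘(ℝ, EG) 𝓘(ℝ, AlgModel EG EM →L[ℝ] ℝ) (𝒢.leftMomentum L x₁) g :=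
  (smoothFamily_leftFrame ht).coord (ContMDiff.smoothNear hL g)

theorem smoothNear_rightMomentum (hL : IsSmoothFun 𝓘(ℝ, EG) L) (hs : 𝒢.src g ∈ 𝒢.algBase x₀) :
    SmoothNear 𝓘(ℝ, EG) 𝓘(ℝ, AlgModel EG EM →L[ℝ] ℝ) (𝒢.rightMomentum L x₀) g :=
  ((smoothFamily_rightFrame hs).coord (ContMDiff.smoothNear hL g)).neg

/-- The Poincaré-Cartan `1`-section `Θ_L⁻(X, Y) = -X(L)`. -/
def thetaMinus (𝒢 : LieGroupoid EG EM G M) (L : G → ℝ) (g : G) : 𝒢.PTau g →ₗ[ℝ] ℝ :=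
  -((mfderiv 𝓘(ℝ, EG) 𝓘(ℝ, ℝ) L g).toLinearMap ∘ₗ LinearMap.fst ℝ _ _)

theorem thetaPlus_eq (σ : ∀ g, 𝒢.PTau g) (g : G) :
    𝒢.thetaPlus L g (σ g) = tderiv 𝓘(ℝ, EG) 𝓘(ℝ, ℝ) L g (sndField σ g) := rfl

theorem thetaMinus_eq (σ : ∀ g, 𝒢.PTau g) (g : G) :
    𝒢.thetaMinus L g (σ g) = -tderiv 𝓘(ℝ, EG) 𝓘(ℝ, ℝ) L g (fstField σ g) := rfl

theorem smooth_thetaPlus (hL : IsSmoothFun 𝓘(ℝ, EG) L) (σ : ∀ g, 𝒢.PTau g)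
    (hσ : 𝒢.pTau.IsSection σ) : IsSmoothFun 𝓘(ℝ, EG) (fun y => 𝒢.thetaPlus L y (σ y)) :=
  IsSmoothFun.of_smoothNear fun g =>
    (IsPTauSection.smoothField_snd hσ g).deriv (ContMDiff.smoothNear hL g)

theorem smooth_thetaMinus (hL : IsSmoothFun 𝓘(ℝ, EG) L) (σ : ∀ g, 𝒢.PTau g)
    (hσ : 𝒢.pTau.IsSection σ) : IsSmoothFun 𝓘(ℝ, EG) (fun y => 𝒢.thetaMinus L y (σ y)) :=
  IsSmoothFun.of_smoothNear fun g =>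
    ((IsPTauSection.smoothField_fst hσ g).deriv (ContMDiff.smoothNear hL g)).neg

theorem omegaL_eq_thetaMinus (hL : IsSmoothFun 𝓘(ℝ, EG) L) (hσ : 𝒢.IsPTauSection σ)
    (hσ' : 𝒢.IsPTauSection σ') :
    𝒢.omegaL L σ σ' = 𝒢.pTau.twoSection (𝒢.thetaMinus L) σ σ' := by
  refine BundleBracket.twoSection_add_exact 𝒢.pTau_isLieAlgebroid (θ := 𝒢.thetaPlus L) hL
    (smooth_thetaMinus hL) (fun τ y => ?_) hσ hσ'
  rw [thetaPlus_eq, thetaMinus_eq]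
  have e : 𝒢.pTau.deriv L τ y =
    tderiv 𝓘(ℝ, EG) 𝓘(ℝ, ℝ) L y (fstField τ y + sndField τ y) := rfl
  rw [e, map_add]
  abel

theorem omegaL_eq_left (hL : IsSmoothFun 𝓘(ℝ, EG) L) (hσ : 𝒢.IsPTauSection σ)
    (hσ' : 𝒢.IsPTauSection σ') (ht : 𝒢.tgt g ∈ 𝒢.algBase x₁) {c c' : AlgModel EG EM}
    (hc : 𝒢.leftFrame x₁ g c = sndField σ g) (hc' : 𝒢.leftFrame x₁ g c' = sndField σ' g) :
    𝒢.omegaL L σ σ' g =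
      -tderiv 𝓘(ℝ, EG) 𝓘(ℝ, AlgModel EG EM →L[ℝ] ℝ) (𝒢.leftMomentum L x₁) g (sumField σ g) c' +
      tderiv 𝓘(ℝ, EG) 𝓘(ℝ, AlgModel EG EM →L[ℝ] ℝ) (𝒢.leftMomentum L x₁) g (sumField σ' g) c +
      𝒢.leftMomentum L x₁ g (𝒢.structureFn x₁ (𝒢.tgt g) c c') := by
  obtain ⟨v, hv, hvσ⟩ := hσ.exists_leftCoeff ht
  obtain ⟨v', hv', hvσ'⟩ := hσ'.exists_leftCoeff ht
  obtain rfl : v g = c := leftFrame_injective ht (hvσ.self_of_nhds.trans hc.symm)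
  obtain rfl : v' g = c' := leftFrame_injective ht (hvσ'.self_of_nhds.trans hc'.symm)
  refine BundleBracket.twoSection_coord (A := 𝒢.pTau) (smoothNear_leftMomentum hL ht) hv hv'
    (hvσ.mono fun y hy => ?_) (hvσ'.mono fun y hy => ?_) ?_
  · rw [thetaPlus_eq, ← hy]; rfl
  · rw [thetaPlus_eq, ← hy]; rfl
  · refine (thetaPlus_eq (𝒢.pTauBracket σ σ') g).trans ?_
    rw [sndField_pTauBracket hσ hσ' ht hv hv' hvσ hvσ']
    rfl

theorem omegaL_eq_right (hL : IsSmoothFun 𝓘(ℝ, EG) L) (hσ : 𝒢.IsPTauSection σ)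
    (hσ' : 𝒢.IsPTauSection σ') (hs : 𝒢.src g ∈ 𝒢.algBase x₀) {c c' : AlgModel EG EM}
    (hc : 𝒢.rightFrame x₀ g c = fstField σ g) (hc' : 𝒢.rightFrame x₀ g c' = fstField σ' g) :
    𝒢.omegaL L σ σ' g =
      -tderiv 𝓘(ℝ, EG) 𝓘(ℝ, AlgModel EG EM →L[ℝ] ℝ) (𝒢.rightMomentum L x₀) g (sumField σ g) c' +
      tderiv 𝓘(ℝ, EG) 𝓘(ℝ, AlgModel EG EM →L[ℝ] ℝ) (𝒢.rightMomentum L x₀) g (sumField σ' g) c +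
      𝒢.rightMomentum L x₀ g (𝒢.structureFn x₀ (𝒢.src g) c c') := by
  obtain ⟨v, hv, hvσ⟩ := hσ.exists_rightCoeff hs
  obtain ⟨v', hv', hvσ'⟩ := hσ'.exists_rightCoeff hs
  obtain rfl : v g = c := rightFrame_injective hs (hvσ.self_of_nhds.trans hc.symm)
  obtain rfl : v' g = c' := rightFrame_injective hs (hvσ'.self_of_nhds.trans hc'.symm)
  rw [omegaL_eq_thetaMinus hL hσ hσ']
  refine BundleBracket.twoSection_coord (A := 𝒢.pTau) (smoothNear_rightMomentum hL hs) hv hv'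
    (hvσ.mono fun y hy => ?_) (hvσ'.mono fun y hy => ?_) ?_
  · rw [thetaMinus_eq, ← hy]; rfl
  · rw [thetaMinus_eq, ← hy]; rfl
  · refine (thetaMinus_eq (𝒢.pTauBracket σ σ') g).trans ?_
    rw [fstField_pTauBracket hσ hσ' hs hv hv' hvσ hvσ']
    rfl

theorem hasFrame_omegaL [T2Space G] (hL : IsSmoothFun 𝓘(ℝ, EG) L) (g : G) :
    𝒢.pTau.HasFrame (𝒢.omegaL L) g (AlgModel EG EM × AlgModel EG EM) := by
  have hs := 𝒢.mem_algBase (𝒢.src g)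
  have ht := 𝒢.mem_algBase (𝒢.tgt g)
  refine BundleBracket.hasFrame_of_frameForm (e := 𝒢.pTauFrame (𝒢.src g) (𝒢.tgt g))
    (T := 𝒢.pTauFrameField (𝒢.src g) (𝒢.tgt g)) (l := 𝒢.leftMomentum L (𝒢.tgt g))
    (c := fun y => 𝒢.structureBilin (𝒢.tgt g) (𝒢.tgt y)) (ContinuousLinearMap.snd ℝ _ _)
    (smoothFamily_pTauFrameField hs ht) (smoothNear_leftMomentum hL ht)
    (fun a b => SmoothNear.comp (f := 𝒢.tgt) (smoothNear_structureBilin ht a b) (𝒢.smoothNear_tgt g))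
    (fun s h => ?_) ?_ ?_ (Eventually.of_forall fun y s => rfl) ?_
  · refine Prod.ext (rightFrame_injective hs ?_) (leftFrame_injective ht ?_)
    · exact (congrArg Prod.fst h).trans (map_zero _).symm
    · exact (congrArg Prod.snd h).trans (map_zero _).symm
  · filter_upwards [eventually_src_mem hs, eventually_tgt_mem ht] with y h1 h2 c hc
    exact exists_section_pTauFrame h1 h2 hc
  · filter_upwards [eventually_src_mem hs, eventually_tgt_mem ht] with y h1 h2 τ hτ
    exact exists_pTauFrame hτ h1 h2
  · filter_upwards [eventually_tgt_mem ht] with y h2 σ τ hσ hτ s t h3 h4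
    have e1 : sndField σ y = 𝒢.leftFrame (𝒢.tgt g) y s.2 := congrArg Prod.snd h3
    have e2 : sndField τ y = 𝒢.leftFrame (𝒢.tgt g) y t.2 := congrArg Prod.snd h4
    have f1 : fstField σ y = 𝒢.rightFrame (𝒢.src g) y s.1 := congrArg Prod.fst h3
    have f2 : fstField τ y = 𝒢.rightFrame (𝒢.src g) y t.1 := congrArg Prod.fst h4
    rw [omegaL_eq_left hL hσ hτ h2 e1.symm e2.symm, BundleBracket.frameForm_apply,
      structureBilin_apply h2, sumField, sumField, e1, e2, f1, f2]
    rfl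

theorem existsUnique_hamiltonian [T2Space G] (hL : IsSmoothFun 𝓘(ℝ, EG) L) (hreg : 𝒢.IsRegular L)
    {f : G → ℝ} (hf : IsSmoothFun 𝓘(ℝ, EG) f) : ∃! ξ, 𝒢.pTau.IsHamiltonian (𝒢.omegaL L) f ξ :=
  BundleBracket.existsUnique_hamiltonian hreg (hasFrame_omegaL hL)
    (fun _ h => IsPTauSection.of_eventuallyEq h) hf

end Cartan

end LieGroupoid

namespace LieGroupoid

variable {EG EM G M : Type*} [NormedAddCommGroup EG] [NormedSpace ℝ EG]
  [NormedAddCommGroup EM] [NormedSpace ℝ EM] [TopologicalSpace G] [ChartedSpace EG G]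
  [TopologicalSpace M] [ChartedSpace EM M] [FiniteDimensional ℝ EG] [FiniteDimensional ℝ EM]
  [IsManifold 𝓘(ℝ, EG) ∞ G] [IsManifold 𝓘(ℝ, EM) ∞ M] {𝒢 : LieGroupoid EG EM G M}

section SymplecticMaps

/-- The map `Φ : G → A^*G` is covered at `g` by a morphism of Lie algebroids that pulls the
canonical symplectic section back to `Ω_L`. Here `K σ c` says that the image of the section `σ` at
`g` has the coefficients `c` in the frame of `AG` near `x₁`. -/
structure IsSymplecticAt (𝒢 : LieGroupoid EG EM G M) (L : G → ℝ) (Φ : G → 𝒢.Dual) (g : G) (x₁ : M)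
    (K : (∀ g, 𝒢.PTau g) → AlgModel EG EM → Prop) : Prop where
  mem : (Φ g).proj ∈ 𝒢.algBase x₁
  smooth : SmoothNear 𝓘(ℝ, EG) (dualModel EG EM) Φ g
  omega : ∀ σ σ', 𝒢.IsPTauSection σ → 𝒢.IsPTauSection σ' → ∀ c c', K σ c → K σ' c' →
    𝒢.omegaL L σ σ' g =
      -tderiv (dualModel EG EM) 𝓘(ℝ, AlgModel EG EM →L[ℝ] ℝ) (𝒢.dualCoord x₁) (Φ g)
        (tderiv 𝓘(ℝ, EG) (dualModel EG EM) Φ g (sumField σ g)) c' +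
      tderiv (dualModel EG EM) 𝓘(ℝ, AlgModel EG EM →L[ℝ] ℝ) (𝒢.dualCoord x₁) (Φ g)
        (tderiv 𝓘(ℝ, EG) (dualModel EG EM) Φ g (sumField σ' g)) c +
      𝒢.dualCoord x₁ (Φ g) (𝒢.structureFn x₁ (Φ g).proj c c')
  exists_coeff : ∀ σ, 𝒢.IsPTauSection σ → ∃ c, K σ c
  anchor : ∀ σ, 𝒢.IsPTauSection σ → ∀ c, K σ c →
    𝒢.dualProjD (Φ g) (tderiv 𝓘(ℝ, EG) (dualModel EG EM) Φ g (sumField σ g)) =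
      𝒢.anchorFrame x₁ (Φ g).proj c
  exists_section : ∀ U c, 𝒢.dualProjD (Φ g) (tderiv 𝓘(ℝ, EG) (dualModel EG EM) Φ g U) =
    𝒢.anchorFrame x₁ (Φ g).proj c → ∃ σ, 𝒢.IsPTauSection σ ∧ sumField σ g = U ∧ K σ c

variable {L : G → ℝ} {Φ : G → 𝒢.Dual} {g : G} {x₁ : M}
  {K : (∀ g, 𝒢.PTau g) → AlgModel EG EM → Prop}

theorem IsSymplecticAt.injective (h : 𝒢.IsSymplecticAt L Φ g x₁ K) (hreg : 𝒢.IsRegular L) :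
    Function.Injective (tderiv 𝓘(ℝ, EG) (dualModel EG EM) Φ g) := by
  rw [injective_iff_map_eq_zero]
  intro U hU
  obtain ⟨σ, hσ, hσU, hK⟩ := h.exists_section U 0 (by rw [hU, map_zero, map_zero])
  have h0 : σ g = 0 := hreg σ hσ g fun σ' hσ' => by
    obtain ⟨c', hc'⟩ := h.exists_coeff σ' hσ'
    rw [h.omega σ σ' hσ hσ' 0 c' hK hc', hσU, hU, ← structureBilin_apply h.mem]
    simp
  rw [← hσU, sumField, show fstField σ g = 0 from congrArg Prod.fst h0,
    show sndField σ g = 0 from congrArg Prod.snd h0, add_zero]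

theorem IsSymplecticAt.isInvertible (h : 𝒢.IsSymplecticAt L Φ g x₁ K) (hreg : 𝒢.IsRegular L) :
    (tderiv 𝓘(ℝ, EG) (dualModel EG EM) Φ g).IsInvertible := by
  have hle : Module.finrank ℝ EM ≤ Module.finrank ℝ EG :=
    LinearMap.finrank_le_finrank_of_surjective (f := (𝒢.srcD g : EG →ₗ[ℝ] EM)) (𝒢.surjective_srcD g)
  have hd : Module.finrank ℝ EG = Module.finrank ℝ (EM × (AlgModel EG EM →L[ℝ] ℝ)) := by
    rw [Module.finrank_prod,
      ← LinearEquiv.finrank_eq (LinearMap.toContinuousLinearMap (𝕜 := ℝ) (E := AlgModel EG EM)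
        (F' := ℝ)), Subspace.dual_finrank_eq, finrank_euclideanSpace_fin]
    omega
  refine ⟨(LinearEquiv.ofInjectiveOfFinrankEq
    (tderiv 𝓘(ℝ, EG) (dualModel EG EM) Φ g : EG →ₗ[ℝ] EM × (AlgModel EG EM →L[ℝ] ℝ))
    (h.injective hreg) hd).toContinuousLinearEquiv, ?_⟩
  ext v : 1
  rfl

/-- The Hamiltonian vector fields of `f ∘ Φ` and `f` are related by `Φ`. -/
theorem IsSymplecticAt.tderiv_ham [T2Space M] (h : 𝒢.IsSymplecticAt L Φ g x₁ K)
    (hreg : 𝒢.IsRegular L) {f : 𝒢.Dual → ℝ} (hf : IsSmoothFun (dualModel EG EM) f)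
    {ξ : ∀ g, 𝒢.PTau g} (hξ : 𝒢.pTau.IsHamiltonian (𝒢.omegaL L) (f ∘ Φ) ξ)
    {η : ∀ μ, 𝒢.PTauStar μ} (hη : 𝒢.pTauStar.IsHamiltonian 𝒢.omegaDual f η) :
    tderiv 𝓘(ℝ, EG) (dualModel EG EM) Φ g (sumField ξ g) = dualField η (Φ g) := by
  obtain ⟨c, hc⟩ := h.exists_coeff ξ hξ.1
  set D := tderiv 𝓘(ℝ, EG) (dualModel EG EM) Φ g with hD
  set W := D (sumField ξ g) with hW
  have hμ := h.mem
  obtain ⟨τ, hτ, hτe⟩ := exists_section_dualFrame hμ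
    (SmoothNear.const (c, (𝒢.dualChartD x₁ (Φ g) W).2) (Φ g))
  have hτg := hτe.self_of_nhds
  have t1 : algCoeff x₁ τ (Φ g) = c := by
    rw [algCoeff, hτg]
    exact 𝒢.algCoord_algSymm hμ c
  have t2 : dualField τ (Φ g) = W := by
    rw [dualField, hτg]
    refine Eq.trans ?_ (dualSymmD_dualChartD hμ W)
    refine congrArg (𝒢.dualSymmD x₁ (Φ g)) (Prod.ext ?_ rfl)
    rw [dualChartD_eq hμ]
    exact (h.anchor ξ hξ.1 c hc).symm
  have e : τ (Φ g) = η (Φ g) := by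
    refine BundleBracket.HasFrame.injective (hasFrame_omegaDual (Φ g)) nondegenerate_omegaDual hτ hη.1
      fun τ' hτ' => ?_
    obtain ⟨U', hU'⟩ := (h.isInvertible hreg).bijective.2 (dualField τ' (Φ g))
    obtain ⟨σ', hσ', hσU, hK'⟩ := h.exists_section U' (algCoeff x₁ τ' (Φ g)) (by
      rw [hU']
      exact IsPTauStarSection.dualProjD_dualField hτ' hμ)
    have e1 := h.omega ξ σ' hξ.1 hσ' c _ hc hK'
    rw [hσU, hU'] at e1
    rw [omegaDual_eq hτ hτ' hμ, t1, t2, ← e1, hξ.2 σ' hσ', hη.2 τ' hτ']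
    have e2 := tderiv_comp (hf.mdifferentiableAt (Φ g)) h.smooth.mdifferentiableAt U'
    rw [hU', ← hσU] at e2
    exact e2
  rw [← t2, dualField, e]
  rfl

theorem poissonL_comp [T2Space G] [T2Space M] (hL : IsSmoothFun 𝓘(ℝ, EG) L) (hreg : 𝒢.IsRegular L)
    (hΦ : ∀ g, ∃ x₁ K, 𝒢.IsSymplecticAt L Φ g x₁ K) {f h : 𝒢.Dual → ℝ}
    (hf : IsSmoothFun (dualModel EG EM) f) (hh : IsSmoothFun (dualModel EG EM) h) :
    𝒢.poissonL L (f ∘ Φ) (h ∘ Φ) = 𝒢.poissonDual f h ∘ Φ := by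
  have hsm : ∀ {k : 𝒢.Dual → ℝ}, IsSmoothFun (dualModel EG EM) k → IsSmoothFun 𝓘(ℝ, EG) (k ∘ Φ) :=
    fun hk => IsSmoothFun.of_smoothNear fun g => by
      obtain ⟨x₁, K, hg⟩ := hΦ g
      exact (ContMDiff.smoothNear hk (Φ g)).comp hg.smooth
  funext g
  obtain ⟨x₁, K, hg⟩ := hΦ g
  have hex := fun f hf => existsUnique_hamiltonian (𝒢 := 𝒢) (f := f) hL hreg hf
  have hex' := fun f hf => existsUnique_hamiltonian_dual (𝒢 := 𝒢) (f := f) hf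
  have e := hg.tderiv_ham hreg hh (BundleBracket.isHamiltonian_ham hex (hsm hh))
    (BundleBracket.isHamiltonian_ham hex' hh)
  rw [poissonL, BundleBracket.poisson_apply hex (hsm hf) (hsm hh), Function.comp_apply, poissonDual,
    BundleBracket.poisson_apply hex' hf hh, neg_inj]
  refine (tderiv_comp (hf.mdifferentiableAt (Φ g)) hg.smooth.mdifferentiableAt _).trans ?_
  exact congrArg (tderiv (dualModel EG EM) 𝓘(ℝ, ℝ) f (Φ g)) e

theorem isLocalDiffeomorph_of_isSymplecticAt (hreg : 𝒢.IsRegular L)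
    (hΦ : ∀ g, ∃ x₁ K, 𝒢.IsSymplecticAt L Φ g x₁ K) :
    IsLocalDiffeomorph 𝓘(ℝ, EG) (dualModel EG EM) ∞ Φ := fun g => by
  obtain ⟨x₁, K, hg⟩ := hΦ g
  exact hg.smooth.isLocalDiffeomorphAt (hg.isInvertible hreg)

end SymplecticMaps

section MapsToDual

variable {Φ : G → 𝒢.Dual} {g : G} {x₁ : M} {pr : G → M} {l : G → AlgModel EG EM →L[ℝ] ℝ}

theorem smoothNear_of_dualCoord (hpr : SmoothNear 𝓘(ℝ, EG) 𝓘(ℝ, EM) pr g)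
    (hl : SmoothNear 𝓘(ℝ, EG) 𝓘(ℝ, AlgModel EG EM →L[ℝ] ℝ) l g) (hΦ : ∀ y, (Φ y).proj = pr y)
    (hg : pr g ∈ 𝒢.algBase x₁) (h : ∀ᶠ y in 𝓝 g, 𝒢.dualCoord x₁ (Φ y) = l y) :
    SmoothNear 𝓘(ℝ, EG) (dualModel EG EM) Φ g := by
  refine (SmoothNear.comp (f := fun y => (pr y, l y))
    (smoothNear_dualSymm (𝒢 := 𝒢) (x₀ := x₁) hg) (hpr.prodMk hl)).congr ?_
  filter_upwards [h, hpr.continuousAt.eventually ((𝒢.isOpen_algBase x₁).mem_nhds hg)] with y h1 h2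
  have h3 : (Φ y).proj ∈ 𝒢.algBase x₁ := by rwa [hΦ]
  rw [← dualSymm_dualChart h3, dualChart, h1, hΦ]

theorem tderiv_dualCoord_comp (hs : SmoothNear 𝓘(ℝ, EG) (dualModel EG EM) Φ g)
    (hg : (Φ g).proj ∈ 𝒢.algBase x₁) (h : ∀ᶠ y in 𝓝 g, 𝒢.dualCoord x₁ (Φ y) = l y) (U : EG) :
    tderiv (dualModel EG EM) 𝓘(ℝ, AlgModel EG EM →L[ℝ] ℝ) (𝒢.dualCoord x₁) (Φ g)
      (tderiv 𝓘(ℝ, EG) (dualModel EG EM) Φ g U) =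
    tderiv 𝓘(ℝ, EG) 𝓘(ℝ, AlgModel EG EM →L[ℝ] ℝ) l g U := by
  rw [← tderiv_comp (smoothNear_dualCoord hg).mdifferentiableAt hs.mdifferentiableAt]
  exact congrArg (fun A : EG →L[ℝ] AlgModel EG EM →L[ℝ] ℝ => A U) (tderiv_congr h)

theorem dualProjD_comp (hs : SmoothNear 𝓘(ℝ, EG) (dualModel EG EM) Φ g)
    (hΦ : ∀ y, (Φ y).proj = pr y) (U : EG) :
    𝒢.dualProjD (Φ g) (tderiv 𝓘(ℝ, EG) (dualModel EG EM) Φ g U) =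
      tderiv 𝓘(ℝ, EG) 𝓘(ℝ, EM) pr g U := by
  rw [dualProjD, ← tderiv_comp (smoothNear_dualProj _).mdifferentiableAt hs.mdifferentiableAt]
  exact congrArg (fun A : EG →L[ℝ] EM => A U) (tderiv_congr (Eventually.of_forall hΦ))

end MapsToDual

section Legendre

variable {L : G → ℝ} {g : G} {x₁ : M}

theorem dualCoord_legendrePlus (hL : IsSmoothFun 𝓘(ℝ, EG) L) (ht : 𝒢.tgt g ∈ 𝒢.algBase x₁) :
    𝒢.dualCoord x₁ (𝒢.legendrePlus L g) = 𝒢.leftMomentum L x₁ g := by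
  ext a
  rw [dualCoord_apply (show (𝒢.legendrePlus L g).proj ∈ _ from ht)]
  have hu : 𝒢.tgt g = 𝒢.src (𝒢.unit (𝒢.tgt g)) := (𝒢.src_unit _).symm
  have hq : SmoothNear 𝓘(ℝ, EG) (𝓘(ℝ, EG).prod 𝓘(ℝ, EG)) (fun k : G => (g, k))
      (𝒢.unit (𝒢.tgt g)) := (SmoothNear.const g _).prodMk (SmoothNear.id _)
  have hm := SmoothNear.comp (f := fun k : G => (g, k)) (smoothNear_mulExt hu) hq
  have hv : 𝒢.mulExt g (𝒢.unit (𝒢.tgt g)) (g, 𝒢.unit (𝒢.tgt g)) = g :=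
    ((eventually_mulExt hu).self_of_nhds hu).trans (𝒢.unit_right g)
  have hLd := hL.mdifferentiableAt g
  have e := TangentTo.mfderivWithin_eq (f := fun k => L (𝒢.mul g k))
    (g := fun k => L (𝒢.mulExt g (𝒢.unit (𝒢.tgt g)) (g, k)))
    (TangentTo.fibre (𝒢.smoothNear_src _) (𝒢.surjective_srcD _) hu.symm (srcD_unitFrame ht a))
    (MDifferentiableAt.comp_of_eq (g := L) _ hLd hm.mdifferentiableAt hv) (by
      filter_upwards [hq.continuousAt.eventually (eventually_mulExt hu)] with y hy hs
      rw [hy (show 𝒢.tgt g = 𝒢.src y from (Set.mem_singleton_iff.1 hs).symm)])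
  rw [tderiv_comp_of_eq (g := L) hLd hm.mdifferentiableAt hv,
    tderiv_comp (f := fun k : G => (g, k)) (smoothNear_mulExt hu).mdifferentiableAt
      hq.mdifferentiableAt, tderiv_prodMk (SmoothNear.const g _).mdifferentiableAt
      (SmoothNear.id _).mdifferentiableAt, tderiv_const, tderiv_id] at e
  refine Eq.trans ?_ e
  exact congrArg (mfderivWithin 𝓘(ℝ, EG) 𝓘(ℝ, ℝ) (fun k => L (𝒢.mul g k))
    (𝒢.src ⁻¹' {𝒢.tgt g}) (𝒢.unit (𝒢.tgt g))) (𝒢.algIncl_algSymm ht a)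

theorem dualCoord_legendreMinus (hL : IsSmoothFun 𝓘(ℝ, EG) L) (hs : 𝒢.src g ∈ 𝒢.algBase x₁) :
    𝒢.dualCoord x₁ (𝒢.legendreMinus L g) = 𝒢.rightMomentum L x₁ g := by
  ext a
  rw [dualCoord_apply (show (𝒢.legendreMinus L g).proj ∈ _ from hs)]
  set u := 𝒢.unit (𝒢.src g) with hu
  have iu : 𝒢.inv u = u := 𝒢.inv_unit _
  have hc : 𝒢.tgt u = 𝒢.src g := 𝒢.tgt_unit _
  have hq : SmoothNear 𝓘(ℝ, EG) (𝓘(ℝ, EG).prod 𝓘(ℝ, EG)) (fun k : G => (𝒢.inv k, g)) u :=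
    (𝒢.smoothNear_inv u).prodMk (SmoothNear.const g _)
  have hqu : ((𝒢.inv u, g) : G × G) = (u, g) := by rw [iu]
  have hm : SmoothNear 𝓘(ℝ, EG) 𝓘(ℝ, EG) (fun k => 𝒢.mulExt u g (𝒢.inv k, g)) u :=
    SmoothNear.comp_of_eq (f := fun k : G => (𝒢.inv k, g)) (smoothNear_mulExt hc) hq hqu
  have hv : 𝒢.mulExt u g (𝒢.inv u, g) = g := by
    rw [iu]
    exact ((eventually_mulExt hc).self_of_nhds hc).trans (𝒢.unit_left g)
  have hLd := hL.mdifferentiableAt g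
  have hcont := hq.continuousAt
  rw [ContinuousAt, hqu] at hcont
  have e := TangentTo.mfderivWithin_eq (f := fun k => L (𝒢.mul (𝒢.inv k) g))
    (g := fun k => L (𝒢.mulExt u g (𝒢.inv k, g)))
    (TangentTo.fibre (𝒢.smoothNear_src _) (𝒢.surjective_srcD _) (𝒢.src_unit _)
      (srcD_unitFrame hs a))
    (MDifferentiableAt.comp_of_eq (g := L) _ hLd hm.mdifferentiableAt hv) (by
      filter_upwards [hcont.eventually (eventually_mulExt hc)] with y hy hs
      rw [hy (show 𝒢.tgt (𝒢.inv y) = 𝒢.src g by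
        rw [𝒢.tgt_inv]; exact Set.mem_singleton_iff.1 hs)])
  have e1 : tderiv 𝓘(ℝ, EG) 𝓘(ℝ, EG) 𝒢.inv u (𝒢.unitFrame x₁ (𝒢.src g) a) =
      𝒢.rightFrame x₁ u a := by
    rw [← leftFrame_unit hs]
    exact (invD_leftFrame u a).trans (by rw [iu])
  have e2 := mulD_rightFrame hc (show 𝒢.src u ∈ 𝒢.algBase x₁ by rwa [hu, 𝒢.src_unit]) a
  rw [hu, 𝒢.unit_left, ← hu] at e2
  rw [tderiv_comp_of_eq (g := L) hLd hm.mdifferentiableAt hv,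
    tderiv_comp_of_eq (f := fun k : G => (𝒢.inv k, g)) (smoothNear_mulExt hc).mdifferentiableAt
      hq.mdifferentiableAt hqu, tderiv_prodMk (𝒢.smoothNear_inv u).mdifferentiableAt
      (SmoothNear.const g _).mdifferentiableAt, tderiv_const, e1] at e
  have e3 : tderiv (𝓘(ℝ, EG).prod 𝓘(ℝ, EG)) 𝓘(ℝ, EG) (𝒢.mulExt u g) (u, g)
    (𝒢.rightFrame x₁ u a, (0 : EG →L[ℝ] EG) (𝒢.unitFrame x₁ (𝒢.src g) a)) =
    𝒢.rightFrame x₁ g a := e2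
  rw [e3] at e
  refine Eq.trans ?_ (congrArg Neg.neg e)
  exact congrArg (fun v => -(mfderivWithin 𝓘(ℝ, EG) 𝓘(ℝ, ℝ) (fun k => L (𝒢.mul (𝒢.inv k) g))
    (𝒢.src ⁻¹' {𝒢.src g}) (𝒢.unit (𝒢.src g))) v) (𝒢.algIncl_algSymm hs a)

theorem isSymplecticAt_legendrePlus [T2Space G] (hL : IsSmoothFun 𝓘(ℝ, EG) L) (g : G) :
    𝒢.IsSymplecticAt L (𝒢.legendrePlus L) g (𝒢.tgt g)
      (fun σ c => 𝒢.leftFrame (𝒢.tgt g) g c = sndField σ g) := by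
  have ht := 𝒢.mem_algBase (𝒢.tgt g)
  have hm : (𝒢.legendrePlus L g).proj ∈ 𝒢.algBase (𝒢.tgt g) := ht
  have hc : ∀ᶠ y in 𝓝 g, 𝒢.dualCoord (𝒢.tgt g) (𝒢.legendrePlus L y) =
      𝒢.leftMomentum L (𝒢.tgt g) y :=
    (eventually_tgt_mem ht).mono fun y hy => dualCoord_legendrePlus hL hy
  have hsm := smoothNear_of_dualCoord (Φ := 𝒢.legendrePlus L) (𝒢.smoothNear_tgt g)
    (smoothNear_leftMomentum hL ht) (fun _ => rfl) ht hc
  have hp : ∀ U, 𝒢.dualProjD (𝒢.legendrePlus L g)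
      (tderiv 𝓘(ℝ, EG) (dualModel EG EM) (𝒢.legendrePlus L) g U) = 𝒢.tgtD g U :=
    dualProjD_comp hsm fun _ => rfl
  refine ⟨hm, hsm, fun σ σ' hσ hσ' c c' h h' => ?_, fun σ hσ => exists_leftFrame ht (hσ.srcD_sndField g),
    fun σ hσ c h => ?_, fun U c h => ?_⟩
  · rw [tderiv_dualCoord_comp hsm hm hc, tderiv_dualCoord_comp hsm hm hc, hc.self_of_nhds]
    exact omegaL_eq_left hL hσ hσ' ht h h'
  · rw [hp, hσ.tgtD_sumField, ← h, tgtD_leftFrame ht]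
    rfl
  · rw [hp] at h
    have h1 : 𝒢.tgtD g (U - 𝒢.leftFrame (𝒢.tgt g) g c) = 0 := by
      rw [map_sub, h, tgtD_leftFrame ht]
      exact sub_self _
    obtain ⟨σ, hσ, e1, e2⟩ := exists_section_eq h1 (srcD_leftFrame ht c)
    exact ⟨σ, hσ, by rw [sumField, e1, e2, sub_add_cancel], e2.symm⟩

theorem isSymplecticAt_legendreMinus [T2Space G] (hL : IsSmoothFun 𝓘(ℝ, EG) L) (g : G) :
    𝒢.IsSymplecticAt L (𝒢.legendreMinus L) g (𝒢.src g)
      (fun σ c => 𝒢.rightFrame (𝒢.src g) g c = fstField σ g) := by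
  have hs := 𝒢.mem_algBase (𝒢.src g)
  have hm : (𝒢.legendreMinus L g).proj ∈ 𝒢.algBase (𝒢.src g) := hs
  have hc : ∀ᶠ y in 𝓝 g, 𝒢.dualCoord (𝒢.src g) (𝒢.legendreMinus L y) =
      𝒢.rightMomentum L (𝒢.src g) y :=
    (eventually_src_mem hs).mono fun y hy => dualCoord_legendreMinus hL hy
  have hsm := smoothNear_of_dualCoord (Φ := 𝒢.legendreMinus L) (𝒢.smoothNear_src g)
    (smoothNear_rightMomentum hL hs) (fun _ => rfl) hs hc
  have hp : ∀ U, 𝒢.dualProjD (𝒢.legendreMinus L g)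
      (tderiv 𝓘(ℝ, EG) (dualModel EG EM) (𝒢.legendreMinus L) g U) = 𝒢.srcD g U :=
    dualProjD_comp hsm fun _ => rfl
  refine ⟨hm, hsm, fun σ σ' hσ hσ' c c' h h' => ?_,
    fun σ hσ => exists_rightFrame hs (hσ.tgtD_fstField g), fun σ hσ c h => ?_, fun U c h => ?_⟩
  · rw [tderiv_dualCoord_comp hsm hm hc, tderiv_dualCoord_comp hsm hm hc, hc.self_of_nhds]
    exact omegaL_eq_right hL hσ hσ' hs h h'
  · rw [hp, hσ.srcD_sumField, ← h, srcD_rightFrame hs]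
    rfl
  · rw [hp] at h
    have h1 : 𝒢.srcD g (U - 𝒢.rightFrame (𝒢.src g) g c) = 0 := by
      rw [map_sub, h, srcD_rightFrame hs]
      exact sub_self _
    obtain ⟨σ, hσ, e1, e2⟩ := exists_section_eq (tgtD_rightFrame hs c) h1
    exact ⟨σ, hσ, by rw [sumField, e1, e2, add_sub_cancel], e1.symm⟩

end Legendre

end LieGroupoid

end

theorem mainTheorem10 {EG EM G M : Type*}
    [NormedAddCommGroup EG] [NormedSpace ℝ EG] [FiniteDimensional ℝ EG]
    [NormedAddCommGroup EM] [NormedSpace ℝ EM] [FiniteDimensional ℝ EM]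
    [TopologicalSpace G] [ChartedSpace EG G] [IsManifold 𝓘(ℝ, EG) ∞ G] [T2Space G]
    [TopologicalSpace M] [ChartedSpace EM M] [IsManifold 𝓘(ℝ, EM) ∞ M] [T2Space M]
    (𝒢 : LieGroupoid EG EM G M) (L : G → ℝ) (hL : IsSmoothFun 𝓘(ℝ, EG) L)
    (hreg : 𝒢.IsRegular L) :
    -- the Hamiltonian sections form a Lie subalgebra of the Lie algebra of sections of `P^τ G`
    (𝒢.pTau.IsLieAlgebra ∧
      𝒢.pTau.IsLieSubalgebra
        {ξ | ∃ f, IsSmoothFun 𝓘(ℝ, EG) f ∧ 𝒢.pTau.IsHamiltonian (𝒢.omegaL L) f ξ}) ∧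
    -- the bracket of functions is well defined and makes `G` a Poisson manifold
    ((∀ f, IsSmoothFun 𝓘(ℝ, EG) f → ∃! ξ, 𝒢.pTau.IsHamiltonian (𝒢.omegaL L) f ξ) ∧
      IsPoissonBracket 𝓘(ℝ, EG) (𝒢.poissonL L)) ∧
    -- the Legendre transformations are local Poisson isomorphisms into `A^*G`
    ((∀ f, IsSmoothFun (LieGroupoid.dualModel EG EM) f →
        ∃! ξ, 𝒢.pTauStar.IsHamiltonian 𝒢.omegaDual f ξ) ∧
      (IsLocalDiffeomorph 𝓘(ℝ, EG) (LieGroupoid.dualModel EG EM) ∞ (𝒢.legendrePlus L) ∧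
        ∀ f h, IsSmoothFun (LieGroupoid.dualModel EG EM) f →
          IsSmoothFun (LieGroupoid.dualModel EG EM) h →
          𝒢.poissonL L (f ∘ 𝒢.legendrePlus L) (h ∘ 𝒢.legendrePlus L) =
            𝒢.poissonDual f h ∘ 𝒢.legendrePlus L) ∧
      (IsLocalDiffeomorph 𝓘(ℝ, EG) (LieGroupoid.dualModel EG EM) ∞ (𝒢.legendreMinus L) ∧
        ∀ f h, IsSmoothFun (LieGroupoid.dualModel EG EM) f →
          IsSmoothFun (LieGroupoid.dualModel EG EM) h →
          𝒢.poissonL L (f ∘ 𝒢.legendreMinus L) (h ∘ 𝒢.legendreMinus L) =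
            𝒢.poissonDual f h ∘ 𝒢.legendreMinus L)) := by
  have hA := 𝒢.pTau_isLieAlgebroid
  have hθ := LieGroupoid.smooth_thetaPlus (𝒢 := 𝒢) hL
  have hex := fun f hf => LieGroupoid.existsUnique_hamiltonian (𝒢 := 𝒢) (f := f) hL hreg hf
  have hplus : ∀ g, ∃ x₁ K, 𝒢.IsSymplecticAt L (𝒢.legendrePlus L) g x₁ K :=
    fun g => ⟨_, _, LieGroupoid.isSymplecticAt_legendrePlus hL g⟩
  have hminus : ∀ g, ∃ x₁ K, 𝒢.IsSymplecticAt L (𝒢.legendreMinus L) g x₁ K :=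
    fun g => ⟨_, _, LieGroupoid.isSymplecticAt_legendreMinus hL g⟩
  exact ⟨⟨𝒢.pTau_isLieAlgebra, BundleBracket.isLieSubalgebra_hamiltonian hA hθ⟩,
    ⟨hex, BundleBracket.isPoissonBracket hA hθ hex⟩,
    fun f hf => LieGroupoid.existsUnique_hamiltonian_dual hf,
    ⟨LieGroupoid.isLocalDiffeomorph_of_isSymplecticAt hreg hplus,
      fun f h hf hh => LieGroupoid.poissonL_comp hL hreg hplus hf hh⟩,
    ⟨LieGroupoid.isLocalDiffeomorph_of_isSymplecticAt hreg hminus,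
      fun f h hf hh => LieGroupoid.poissonL_comp hL hreg hminus hf hh⟩⟩
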